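/- **Setting.** A leader chooses actions $u^L$ in a compact set $U^L\subset\mathbb R^n$ and a follower chooses actions $u^F$ in a measurable set $U^F\subseteq\mathbb R^h$. Let $\Theta\subset\mathbb R^m$, let $\lambda\ge 0$, and let $J^F(u^F,u^L;\theta)$ be the follower's cost, measurable in $u^F$. For $u^L\in U^L$, $\theta\in\Theta$ put $$p(u^F\mid u^L,\theta)=\frac{e^{-\lambda J^F(u^F,u^L;\theta)}}{Z(u^L,\theta)},\qquad Z(u^L,\theta)=\int_{U^F}e^{-\lambda J^F(u^F,u^L;\theta)}\,du^F\in(0,\infty),$$ a probability density on $U^F$; $\mathbb E_{u^L,\theta}$ and $\mathrm{Var}_{u^L,\theta}$ are taken under it. Let $\Phi=\log p$, let $\dot\Phi$, $\ddot\Phi$ be the gradient and Hessian of $\Phi$ in $\theta\in\Theta$, and let $$\mathcal F(u^L\mid\theta)=\mathbb E_{u^L,\theta}\big[\dot\Phi(u^F;u^L,\theta)\dot\Phi(u^F;u^L,\theta)^\top\big].$$ Let $\mathcal H(u^L\mid\theta)$ be one of $\operatorname{tr}\mathcal F(u^L\mid\theta)$, $(\det\mathcal F(u^L\mid\theta))^{1/m}$,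 or the smallest eigenvalue of $\mathcal F(u^L\mid\theta)$. **Algorithm.** The true parameter is $\theta_0$; start from an initial estimate $\hat\theta(0)\in\Theta$. For $t=1,2,\dots$: the leader plays some $u^{L}(t)\in\arg\max_{u\in U^L}\mathcal H(u\mid\hat\theta(t-1))$; given the past and $u^{L}(t)$, the follower's action $u^F(t)$ is drawn from the density $p(\cdot\mid u^{L}(t),\theta_0)$; then $\hat\theta(t)\in\arg\max_{\theta\in\Theta}\frac1t\sum_{k=1}^t\Phi(u^F(k);u^{L}(k),\theta)$ is a maximum likelihood estimate. Ties are broken in any measurable, possibly randomized, way that does not look into the future. **Assumptions.** 1. $\Theta$ is compact and convex, and $\theta_0$ is an interior point of $\Theta$. 2. For every $u^F\in U^F$, $(u^L,\theta)\mapsto p(u^F\mid u^L,\theta)$ is continuously differentiable on $U^L\times\Theta$, and for every $u^L\in U^L$ it is twice continuously differentiable in $\theta\in\Theta$. 3. For all $u^L\in U^L$, $\theta\in\Theta$, the first and second $\theta$-derivatives of $p(\cdot\mid u^L,\theta)$ are integrable over $U^F$, and their integrals are the corresponding derivatives of $\int_{U^F}p(u^F\mid u^L,\theta)\,du^F$.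 4. For $\theta\in\Theta$: $\theta\ne\theta_0$ if and only if for all $u^L\in U^L$ the densities $p(\cdot\mid u^L,\theta)$ and $p(\cdot\mid u^L,\theta_0)$ differ on a subset of $U^F$ of positive measure. 5. (i) $\mathrm{Var}_{u^L,\theta}[J^F(u^F,u^L;\theta)]$ is bounded over $u^L\in U^L,\theta\in\Theta$. (ii) $\mathbb E_{u^L,\theta}\|\dot\Phi(u^F;u^L,\theta)\|^3$ is bounded over $u^L\in U^L,\theta\in\Theta$. (iii) For every $u^L_0\in U^L$ and all $i,j$ there are $\varepsilon,\delta>0$ and a measurable function $B_{ij}(u^F)$ with $|\ddot\Phi_{ij}(u^F;u^L,\theta)|\le B_{ij}(u^F)$ whenever $u^F\in U^F$, $u^L\in U^L$, $\theta\in\Theta$, $\|(\theta,u^L)-(\theta_0,u^L_0)\|\le\varepsilon$, and $\mathbb E_{u^L,\theta_0}|B_{ij}(u^F)|^{1+\delta}$ is bounded over $u^L\in U^L$ with $\|u^L-u^L_0\|\le\varepsilon$. (iv) For all $i,j$, $\mathbb E_{u^L,\theta}\big[\sup_{\theta'\in\Theta}|(\dot\Phi\dot\Phi^\top)_{ij}(u^F;u^L,\theta')|\big]$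 is bounded over $u^L\in U^L,\theta\in\Theta$. **Theorem.** Under these assumptions, suppose that $\mathcal H(\cdot\mid\theta_0)$ has a unique maximizer $u^{L\circ\circ}$ on $U^L$ and that $\mathcal F(u^{L\circ\circ}\mid\theta_0)$ is positive definite. Then, as $T\to\infty$, $$\sqrt T\,\big(\hat\theta(T)-\theta_0\big)\ \xrightarrow{\ L\ }\ N\big(0,\ \mathcal F(u^{L\circ\circ}\mid\theta_0)^{-1}\big).$$ -/

import Mathlib

open MeasureTheory ProbabilityTheory Filter Topology
open scoped ENNReal NNReal

noncomputable section

namespace Stackelberg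

/-- The gradient of `f` at `θ`, derivatives being taken within the set `s`. -/
def gradOn {m : ℕ} (s : Set (EuclideanSpace ℝ (Fin m))) (f : EuclideanSpace ℝ (Fin m) → ℝ)
    (θ : EuclideanSpace ℝ (Fin m)) : EuclideanSpace ℝ (Fin m) :=
  gradientWithin f s θ

/-- The Hessian matrix of `f` at `θ`, derivatives being taken within the set `s`. -/
def hessOn {m : ℕ} (s : Set (EuclideanSpace ℝ (Fin m))) (f : EuclideanSpace ℝ (Fin m) → ℝ)
    (θ : EuclideanSpace ℝ (Fin m)) : Matrix (Fin m) (Fin m) ℝ :=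
  Matrix.of fun i j => iteratedFDerivWithin ℝ 2 f s θ
    ![EuclideanSpace.single i (1 : ℝ), EuclideanSpace.single j (1 : ℝ)]

/-- The data of a parameterized Stackelberg game with a boundedly rational follower: the action
sets `UL` of the leader and `UF` of the follower, the parameter set `Θ`, the follower's cost
`J uF uL θ`, and the rationality coefficient `lam`. -/
structure Game (n h m : ℕ) where
  UL : Set (EuclideanSpace ℝ (Fin n))
  UF : Set (EuclideanSpace ℝ (Fin h))
  Θ : Set (EuclideanSpace ℝ (Fin m))
  J : EuclideanSpace ℝ (Fin h) → EuclideanSpace ℝ (Fin n) → EuclideanSpace ℝ (Fin m) → ℝ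
  lam : ℝ

namespace Game

variable {n h m : ℕ} (G : Game n h m)

/-- The normalizing constant `Z(uL, θ)`. -/
def Z (uL : EuclideanSpace ℝ (Fin n)) (θ : EuclideanSpace ℝ (Fin m)) : ℝ :=
  ∫ uF in G.UF, Real.exp (-G.lam * G.J uF uL θ)

/-- The quantal response density `p(uF ∣ uL, θ)` with respect to Lebesgue measure on `UF`. -/
def p (uF : EuclideanSpace ℝ (Fin h)) (uL : EuclideanSpace ℝ (Fin n))
    (θ : EuclideanSpace ℝ (Fin m)) : ℝ :=
  Real.exp (-G.lam * G.J uF uL θ) / G.Z uL θ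

/-- The law on the follower's action space with density `p(· ∣ uL, θ)` on `UF`. -/
def law (uL : EuclideanSpace ℝ (Fin n)) (θ : EuclideanSpace ℝ (Fin m)) :
    Measure (EuclideanSpace ℝ (Fin h)) :=
  (volume.restrict G.UF).withDensity fun uF => ENNReal.ofReal (G.p uF uL θ)

/-- `Φ(uF; uL, θ) = log p(uF ∣ uL, θ)`. -/
def Φ (uF : EuclideanSpace ℝ (Fin h)) (uL : EuclideanSpace ℝ (Fin n))
    (θ : EuclideanSpace ℝ (Fin m)) : ℝ :=
  Real.log (G.p uF uL θ)

/-- The gradient of `Φ` with respect to `θ ∈ Θ`. -/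
def score (uF : EuclideanSpace ℝ (Fin h)) (uL : EuclideanSpace ℝ (Fin n))
    (θ : EuclideanSpace ℝ (Fin m)) : EuclideanSpace ℝ (Fin m) :=
  gradOn G.Θ (fun θ' => G.Φ uF uL θ') θ

/-- The Hessian of `Φ` with respect to `θ ∈ Θ`. -/
def hessΦ (uF : EuclideanSpace ℝ (Fin h)) (uL : EuclideanSpace ℝ (Fin n))
    (θ : EuclideanSpace ℝ (Fin m)) : Matrix (Fin m) (Fin m) ℝ :=
  hessOn G.Θ (fun θ' => G.Φ uF uL θ') θ

/-- The observation (Fisher) information matrix `F(uL ∣ θ)`. -/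
def info (uL : EuclideanSpace ℝ (Fin n)) (θ : EuclideanSpace ℝ (Fin m)) :
    Matrix (Fin m) (Fin m) ℝ :=
  Matrix.of fun i j => ∫ uF, G.score uF uL θ i * G.score uF uL θ j ∂(G.law uL θ)

/-- The average log-likelihood `l_t(θ)` of the observations in the rounds `0, …, t - 1`. -/
def logLik (uL : ℕ → EuclideanSpace ℝ (Fin n)) (uF : ℕ → EuclideanSpace ℝ (Fin h)) (t : ℕ)
    (θ : EuclideanSpace ℝ (Fin m)) : ℝ :=
  (1 / (t : ℝ)) * ∑ k ∈ Finset.range t, G.Φ (uF k) (uL k) θ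

end Game

/-- The three optimality criteria: trace, `m`-th root of the determinant, smallest eigenvalue. -/
inductive Criterion where
  | A
  | D
  | E

/-- The value of a criterion on a (symmetric) matrix. -/
def Criterion.eval {m : ℕ} : Criterion → Matrix (Fin m) (Fin m) ℝ → ℝ
  | .A, M => M.trace
  | .D, M => M.det ^ (1 / (m : ℝ))
  | .E, M => sInf (spectrum ℝ M)

namespace Game

variable {n h m : ℕ} (G : Game n h m)

/-- The query function `H(uL ∣ θ)` of the chosen criterion. -/
def query (c : Criterion) (uL : EuclideanSpace ℝ (Fin n)) (θ : EuclideanSpace ℝ (Fin m)) : ℝ :=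
  c.eval (G.info uL θ)

/-- Standing conventions: the rationality coefficient is nonnegative, the leader's action set is
compact, and `p(· ∣ uL, θ)` is a genuine probability density on the measurable set `UF`. -/
structure WellPosed : Prop where
  lam_nonneg : 0 ≤ G.lam
  isCompact_UL : IsCompact G.UL
  measurableSet_UF : MeasurableSet G.UF
  measurable_J : ∀ uL ∈ G.UL, ∀ θ ∈ G.Θ, Measurable fun uF => G.J uF uL θ
  integrableOn_exp : ∀ uL ∈ G.UL, ∀ θ ∈ G.Θ,
    IntegrableOn (fun uF => Real.exp (-G.lam * G.J uF uL θ)) G.UF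
  Z_pos : ∀ uL ∈ G.UL, ∀ θ ∈ G.Θ, 0 < G.Z uL θ

/-- The parameter set is compact and convex, with `θ₀` in its interior. -/
structure ParamAssumption (θ₀ : EuclideanSpace ℝ (Fin m)) : Prop where
  isCompact : IsCompact G.Θ
  convex : Convex ℝ G.Θ
  mem_interior : θ₀ ∈ interior G.Θ

/-- For every `uF ∈ UF`, the density is continuously differentiable in `(uL, θ)` and twice
continuously differentiable in `θ`. -/
structure SmoothAssumption : Prop where
  contDiffOn_one : ∀ uF ∈ G.UF, ContDiffOn ℝ 1
    (fun x : EuclideanSpace ℝ (Fin n) × EuclideanSpace ℝ (Fin m) => G.p uF x.1 x.2)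
    (G.UL ×ˢ G.Θ)
  contDiffOn_two : ∀ uF ∈ G.UF, ∀ uL ∈ G.UL, ContDiffOn ℝ 2 (fun θ => G.p uF uL θ) G.Θ

/-- First and second derivatives in `θ` may be interchanged with integration over `UF`. -/
structure InterchangeAssumption : Prop where
  integrableOn_grad : ∀ uL ∈ G.UL, ∀ θ ∈ G.Θ,
    IntegrableOn (fun uF => gradOn G.Θ (fun θ' => G.p uF uL θ') θ) G.UF
  grad_integral : ∀ uL ∈ G.UL, ∀ θ ∈ G.Θ,
    gradOn G.Θ (fun θ' => ∫ uF in G.UF, G.p uF uL θ') θ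
      = ∫ uF in G.UF, gradOn G.Θ (fun θ' => G.p uF uL θ') θ
  integrableOn_hess : ∀ uL ∈ G.UL, ∀ θ ∈ G.Θ, ∀ i j,
    IntegrableOn (fun uF => hessOn G.Θ (fun θ' => G.p uF uL θ') θ i j) G.UF
  hess_integral : ∀ uL ∈ G.UL, ∀ θ ∈ G.Θ, ∀ i j,
    hessOn G.Θ (fun θ' => ∫ uF in G.UF, G.p uF uL θ') θ i j
      = ∫ uF in G.UF, hessOn G.Θ (fun θ' => G.p uF uL θ') θ i j

/-- Identifiability: a parameter in `Θ` differs from `θ₀` iff, for every leader action, the two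
densities differ (as elements of `L¹(UF)`, i.e. not only on a null set). -/
def Identifiable (θ₀ : EuclideanSpace ℝ (Fin m)) : Prop :=
  ∀ θ ∈ G.Θ, θ ≠ θ₀ ↔ ∀ uL ∈ G.UL,
    ¬ ((fun uF => G.p uF uL θ) =ᵐ[volume.restrict G.UF] fun uF => G.p uF uL θ₀)

/-- The boundedness assumptions; bounds are uniform in the leader's action and the parameter. -/
structure BoundedAssumption (θ₀ : EuclideanSpace ℝ (Fin m)) : Prop where
  variance_cost : ∃ C : ℝ≥0, ∀ uL ∈ G.UL, ∀ θ ∈ G.Θ,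
    evariance (fun uF => G.J uF uL θ) (G.law uL θ) ≤ C
  third_moment : ∃ C : ℝ≥0, ∀ uL ∈ G.UL, ∀ θ ∈ G.Θ,
    ∫⁻ uF, ‖G.score uF uL θ‖ₑ ^ 3 ∂(G.law uL θ) ≤ C
  hess_dominated : ∀ uL₀ ∈ G.UL, ∀ i j : Fin m,
    ∃ ε > (0 : ℝ), ∃ δ > (0 : ℝ), ∃ B : EuclideanSpace ℝ (Fin h) → ℝ, Measurable B ∧
      (∀ uF ∈ G.UF, ∀ uL ∈ G.UL, ∀ θ ∈ G.Θ, ‖θ - θ₀‖ ^ 2 + ‖uL - uL₀‖ ^ 2 ≤ ε ^ 2 →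
        |G.hessΦ uF uL θ i j| ≤ B uF) ∧
      ∃ C : ℝ≥0, ∀ uL ∈ G.UL, ‖uL - uL₀‖ ≤ ε →
        ∫⁻ uF, ‖B uF‖ₑ ^ (1 + δ) ∂(G.law uL θ₀) ≤ C
  sup_score : ∃ C : ℝ≥0, ∀ uL ∈ G.UL, ∀ θ ∈ G.Θ, ∀ i j : Fin m,
    ∫⁻ uF, ⨆ θ' ∈ G.Θ, ‖G.score uF uL θ' i * G.score uF uL θ' j‖ₑ ∂(G.law uL θ) ≤ C

/-- A run of the active learning algorithm with criterion `c` when the true parameter is `θ₀`.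
Rounds are numbered from `0`; `ℱ t` is the information available just before the follower acts in
round `t`, and `θhat t` is the estimate after `t` rounds (`θhat 0` is the initial one). In round
`t` the leader plays a maximizer `uL t` of `H(· ∣ θhat t)` over `UL`, the follower's action `uF t`
is drawn from `p(· ∣ uL t, θ₀)`, and `θhat (t + 1)` is a maximizer over `Θ` of the log-likelihood
of the first `t + 1` rounds. Ties may be broken in any (measurable, possibly random) way. -/
structure IsRun {Ω : Type*} {mΩ : MeasurableSpace Ω} (μ : Measure Ω) (ℱ : Filtration ℕ mΩ)
    (c : Criterion) (θ₀ : EuclideanSpace ℝ (Fin m))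
    (uL : ℕ → Ω → EuclideanSpace ℝ (Fin n)) (uF : ℕ → Ω → EuclideanSpace ℝ (Fin h))
    (θhat : ℕ → Ω → EuclideanSpace ℝ (Fin m)) : Prop where
  measurable_uL : ∀ t, Measurable[ℱ t] (uL t)
  measurable_uF : ∀ t, Measurable[ℱ (t + 1)] (uF t)
  measurable_θhat : ∀ t, Measurable[ℱ t] (θhat t)
  initial_mem : ∀ᵐ ω ∂μ, θhat 0 ω ∈ G.Θ
  leader : ∀ t, ∀ᵐ ω ∂μ, uL t ω ∈ G.UL ∧
    IsMaxOn (fun u => G.query c u (θhat t ω)) G.UL (uL t ω)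
  follower : ∀ t, ∀ S : Set (EuclideanSpace ℝ (Fin h)), MeasurableSet S →
    μ⟦uF t ⁻¹' S | ℱ t⟧ =ᵐ[μ] fun ω => (G.law (uL t ω) θ₀).real S
  estimate : ∀ t, ∀ᵐ ω ∂μ, θhat (t + 1) ω ∈ G.Θ ∧
    IsMaxOn (G.logLik (fun k => uL k ω) (fun k => uF k ω) (t + 1)) G.Θ (θhat (t + 1) ω)

end Game

end Stackelberg

end

/-! The follower's responses form a sequential experiment: in each round a design (the leader's
action) is chosen from the past, and an observation is drawn from the law at `θ₀` for that design.
The estimate is a maximum likelihood estimate in this experiment. The proof shows that it is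
consistent whatever the designs are, that the designs therefore converge, and that convergent
designs lead to the classical normal limit.

Consistency. Densities at `θ ≠ θ₀` differ from those at `θ₀` under every action, so the Hellinger
affinity of the two laws is below one. It is continuous in the action and the parameter, and
compactness yields a bound `ρ < 1` over all actions and all `θ` at distance at least `ε` from `θ₀`.
Conditioning round by round, the expected square root of the likelihood ratio after `N` rounds is at
most `ρ ^ N`. A finite net in `Θ`, with the Lipschitz control of the log-likelihood by an envelope
of the score, makes this uniform (`tendsto_measure_exists_far`). The information matrix and the
three criteria are continuous, so an action that maximizes the criterion at an estimate near `θ₀` is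
near the unique maximizer `u₀` (`exists_dist_maximizer_lt`). Hence the designs tend to `u₀` in
probability, and the expected fraction of rounds with a design far from `u₀` tends to zero.

Normality. With probability tending to one the estimate is interior, and the total score vanishes
there. Two facts then suffice. First, the total score at `θ₀` divided by `√N` is asymptotically
normal with covariance the information at `u₀` (`tendsto_integral_cexp_sum`): the characteristic
function is compensated by the exponential of half the accumulated conditional variance, and third
moments make each round change the mean of the product by `O(N ^ (-3/2))`. Secondly, near `θ₀` the
increment of the total score is `-N` times the information applied to `θ - θ₀`, up to a small
multiple of `N (‖θ - θ₀‖ + N ^ (-1/2))`, uniformly in `θ` (`exists_measure_remainder_le`). Its mean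
part comes from an exact formula: as the score at `θ` is centred under `θ`, its mean under `θ₀` is
an integral along the segment of information entries with scores at two parameters
(`integral_s_eq`). Its fluctuation part is controlled by a rescaled finite net at each dyadic
distance from `θ₀`; the law of large numbers has a polynomial rate, which beats the logarithmic
number of scales. Together these make the scaled error equal to the inverse information applied to
the scaled score, up to a term that vanishes in probability, and Slutsky's theorem concludes.

All of this is done for an abstract `RegularModel`; `exists_regularModel` extracts one from the
game. -/

namespace Stackelberg

/-! ### Expectations under varying densities: Scheffé's lemma and truncation. -/

section Vitali

variable {ι X : Type*} [MeasurableSpace X] {ν : Measure X} {l : Filter ι}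

/-- The measure with density `g` (a nonnegative real function) with respect to `ν`. -/
noncomputable def densityLaw (ν : Measure X) (g : X → ℝ) : Measure X :=
  ν.withDensity fun x => ENNReal.ofReal (g x)

lemma lintegral_densityLaw {g : X → ℝ} (hg : Measurable g) {f : X → ℝ≥0∞} (hf : Measurable f) :
    ∫⁻ x, f x ∂(densityLaw ν g) = ∫⁻ x, ENNReal.ofReal (g x) * f x ∂ν := by
  rw [densityLaw, lintegral_withDensity_eq_lintegral_mul _ hg.ennreal_ofReal hf]
  rfl

lemma integral_densityLaw {g : X → ℝ} (hg : Measurable g) (hg0 : ∀ x, 0 ≤ g x) (f : X → ℝ) :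
    ∫ x, f x ∂(densityLaw ν g) = ∫ x, g x * f x ∂ν := by
  rw [densityLaw, integral_withDensity_eq_integral_toReal_smul hg.ennreal_ofReal (by simp)]
  simp [ENNReal.toReal_ofReal (hg0 _)]

lemma integrable_densityLaw_iff {g : X → ℝ} (hg : Measurable g) (hg0 : ∀ x, 0 ≤ g x) {f : X → ℝ} :
    Integrable f (densityLaw ν g) ↔ Integrable (fun x => g x * f x) ν := by
  rw [densityLaw, integrable_withDensity_iff_integrable_smul' hg.ennreal_ofReal (by simp)]
  simp [ENNReal.toReal_ofReal (hg0 _)]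

/-- A density with total mass one gives a probability measure. -/
lemma isProbabilityMeasure_densityLaw {g : X → ℝ} (h : ∫⁻ x, ENNReal.ofReal (g x) ∂ν = 1) :
    IsProbabilityMeasure (densityLaw ν g) :=
  ⟨by rw [densityLaw, withDensity_apply _ .univ, Measure.restrict_univ, h]⟩

lemma integrable_of_lintegral_eq_one {g : X → ℝ} (hg : Measurable g) (hg0 : ∀ x, 0 ≤ g x)
    (h : ∫⁻ x, ENNReal.ofReal (g x) ∂ν = 1) : Integrable g ν := by
  refine ⟨hg.aestronglyMeasurable, ?_⟩
  rw [hasFiniteIntegral_iff_ofReal (ae_of_all _ hg0), h]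
  exact ENNReal.one_lt_top

lemma integral_eq_one_of_lintegral_eq_one {g : X → ℝ} (hg : Measurable g) (hg0 : ∀ x, 0 ≤ g x)
    (h : ∫⁻ x, ENNReal.ofReal (g x) ∂ν = 1) : ∫ x, g x ∂ν = 1 := by
  rw [integral_eq_lintegral_of_nonneg_ae (ae_of_all _ hg0) hg.aestronglyMeasurable, h]
  simp

/-- **Scheffé's lemma** for densities. -/
lemma tendsto_integral_abs_sub_density [l.IsCountablyGenerated] {g : ι → X → ℝ} {g₀ : X → ℝ}
    (hg : ∀ᶠ i in l, Measurable (g i)) (hg₀ : Measurable g₀)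
    (hpos : ∀ i x, 0 ≤ g i x) (hpos₀ : ∀ x, 0 ≤ g₀ x)
    (h1 : ∀ᶠ i in l, ∫⁻ x, ENNReal.ofReal (g i x) ∂ν = 1)
    (h1₀ : ∫⁻ x, ENNReal.ofReal (g₀ x) ∂ν = 1)
    (hlim : ∀ x, Tendsto (fun i => g i x) l (𝓝 (g₀ x))) :
    Tendsto (fun i => ∫ x, |g i x - g₀ x| ∂ν) l (𝓝 0) := by
  have hi₀ := integrable_of_lintegral_eq_one hg₀ hpos₀ h1₀
  -- The minimum is dominated by `g₀`, so dominated convergence applies to it although the `g i`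
  -- have no common bound. Both masses being one, the `L¹` distance equals `2 - 2 ∫ min`.
  have hmin : Tendsto (fun i => ∫ x, min (g i x) (g₀ x) ∂ν) l (𝓝 (∫ x, min (g₀ x) (g₀ x) ∂ν)) := by
    refine tendsto_integral_filter_of_dominated_convergence g₀ ?_ ?_ hi₀ ?_
    · filter_upwards [hg] with i hi using (hi.min hg₀).aestronglyMeasurable
    · refine .of_forall fun i => ae_of_all _ fun x => ?_
      rw [Real.norm_eq_abs, abs_of_nonneg (le_min (hpos i x) (hpos₀ x))]
      exact min_le_right _ _
    · exact ae_of_all _ fun x => (hlim x).min tendsto_const_nhds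
  simp only [min_self, integral_eq_one_of_lintegral_eq_one hg₀ hpos₀ h1₀] at hmin
  have h2 : Tendsto (fun i => 2 - 2 * ∫ x, min (g i x) (g₀ x) ∂ν) l (𝓝 (2 - 2 * 1)) :=
    tendsto_const_nhds.sub (hmin.const_mul 2)
  norm_num at h2
  refine h2.congr' ?_
  filter_upwards [hg, h1] with i hi h1i
  have hint := integrable_of_lintegral_eq_one hi (hpos i) h1i
  have hmi : Integrable (fun x => min (g i x) (g₀ x)) ν := hint.inf hi₀
  have : ∀ x, |g i x - g₀ x| = g i x + g₀ x - 2 * min (g i x) (g₀ x) := fun x => by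
    have := min_add_max (g i x) (g₀ x)
    have := max_sub_min_eq_abs (g₀ x) (g i x)
    rw [min_comm, max_comm] at this
    linarith
  simp_rw [this]
  have hadd : Integrable (fun x => g i x + g₀ x) ν := hint.add hi₀
  rw [integral_sub hadd (hmi.const_mul 2), integral_add hint hi₀,
    integral_eq_one_of_lintegral_eq_one hi (hpos i) h1i,
    integral_eq_one_of_lintegral_eq_one hg₀ hpos₀ h1₀, integral_const_mul]
  norm_num

/-- Truncation of a real number to `[-R, R]`. -/
noncomputable def clip (R x : ℝ) : ℝ := max (-R) (min x R)

lemma continuous_clip (R : ℝ) : Continuous (clip R) := by unfold clip; fun_prop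

lemma abs_clip_le {R : ℝ} (hR : 0 ≤ R) (x : ℝ) : |clip R x| ≤ R := by
  unfold clip
  rw [abs_le]
  exact ⟨le_max_left _ _, max_le (by linarith) (min_le_right _ _)⟩

lemma abs_sub_clip_le {R : ℝ} (hR : 0 < R) {a : ℝ} (ha : 1 ≤ a) (x : ℝ) :
    |x - clip R x| ≤ R ^ (1 - a) * |x| ^ a := by
  unfold clip
  rcases le_or_gt |x| R with h | h
  · obtain ⟨h1, h2⟩ := abs_le.1 h
    rw [min_eq_left h2, max_eq_right h1]
    simp only [sub_self, abs_zero]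
    positivity
  · have hx : |x - max (-R) (min x R)| ≤ |x| := by
      rcases le_total 0 x with h0 | h0
      · rw [abs_of_nonneg h0] at h ⊢
        rw [min_eq_right h.le, max_eq_right (by linarith), abs_of_nonneg (by linarith)]
        linarith
      · rw [abs_of_nonpos h0] at h ⊢
        rw [min_eq_left (by linarith), max_eq_left (by linarith), abs_of_nonpos (by linarith)]
        linarith
    refine hx.trans ?_
    have hx0 : 0 < |x| := hR.trans h
    calc |x| = |x| ^ (1 - a) * |x| ^ a := by
          rw [← Real.rpow_add hx0]; simp
      _ ≤ R ^ (1 - a) * |x| ^ a := by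
          gcongr ?_ * _
          exact Real.rpow_le_rpow_of_nonpos hR h.le (by linarith)

lemma integrable_of_moment {P : Measure X} [IsProbabilityMeasure P] {f : X → ℝ}
    (hf : Measurable f) {a : ℝ} (ha : 1 ≤ a) {C : ℝ≥0}
    (hC : ∫⁻ x, ‖f x‖ₑ ^ a ∂P ≤ C) : Integrable f P := by
  have : MemLp f (ENNReal.ofReal a) P := by
    refine ⟨hf.aestronglyMeasurable, ?_⟩
    rw [eLpNorm_lt_top_iff_lintegral_rpow_enorm_lt_top (by simp; linarith) (by simp)]
    rw [ENNReal.toReal_ofReal (by linarith)]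
    exact hC.trans_lt ENNReal.coe_lt_top
  exact this.integrable (by simpa using ha)

lemma integrable_rpow_of_moment {P : Measure X} {f : X → ℝ}
    (hf : Measurable f) {a : ℝ} (ha : 0 ≤ a) {C : ℝ≥0}
    (hC : ∫⁻ x, ‖f x‖ₑ ^ a ∂P ≤ C) : Integrable (fun x => |f x| ^ a) P := by
  refine ⟨((Real.continuous_rpow_const ha).measurable.comp hf.abs).aestronglyMeasurable, ?_⟩
  refine (lintegral_congr fun x => ?_).trans_lt (hC.trans_lt ENNReal.coe_lt_top)
  rw [Real.enorm_rpow_of_nonneg (abs_nonneg _) ha, Real.enorm_abs]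

lemma integral_rpow_le_of_moment {P : Measure X} {f : X → ℝ}
    (hf : Measurable f) {a : ℝ} (ha : 0 ≤ a) {C : ℝ≥0}
    (hC : ∫⁻ x, ‖f x‖ₑ ^ a ∂P ≤ C) : ∫ x, |f x| ^ a ∂P ≤ C := by
  rw [integral_eq_lintegral_of_nonneg_ae (ae_of_all _ fun x => by positivity)
    (integrable_rpow_of_moment hf ha hC).1]
  refine ENNReal.toReal_le_of_le_ofReal C.2 ?_
  rw [show ENNReal.ofReal ((fun a : ℝ≥0 => (a : ℝ)) C) = C from ENNReal.ofReal_coe_nnreal]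
  refine le_of_eq_of_le (lintegral_congr fun x => ?_) hC
  rw [← Real.enorm_of_nonneg (by positivity), Real.enorm_rpow_of_nonneg (abs_nonneg _) ha,
    Real.enorm_abs]

/-- Truncation error in the mean, under a bound on a moment of order `a`. -/
lemma integral_abs_sub_clip_le {P : Measure X} {f : X → ℝ}
    (hf : Measurable f) {a : ℝ} (ha : 1 ≤ a) {C : ℝ≥0}
    (hC : ∫⁻ x, ‖f x‖ₑ ^ a ∂P ≤ C) {R : ℝ} (hR : 0 < R) :
    ∫ x, |f x - clip R (f x)| ∂P ≤ R ^ (1 - a) * C := by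
  have h0 : 0 ≤ a := by linarith
  calc ∫ x, |f x - clip R (f x)| ∂P ≤ ∫ x, R ^ (1 - a) * |f x| ^ a ∂P := by
        refine integral_mono_of_nonneg (ae_of_all _ fun x => abs_nonneg _)
          ((integrable_rpow_of_moment hf h0 hC).const_mul _)
          (ae_of_all _ fun x => abs_sub_clip_le hR ha _)
    _ ≤ R ^ (1 - a) * C := by
        rw [integral_const_mul]
        gcongr
        exact integral_rpow_le_of_moment hf h0 hC

lemma integrable_clip {P : Measure X} [IsProbabilityMeasure P] {f : X → ℝ} (hf : Measurable f)
    {R : ℝ} (hR : 0 ≤ R) : Integrable (fun x => clip R (f x)) P :=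
  Integrable.of_bound ((continuous_clip R).measurable.comp hf).aestronglyMeasurable R
    (ae_of_all _ fun _ => abs_clip_le hR _)

/-- Convergence of expectations under varying densities, for functions that are bounded in some
`L^a` with `a > 1`. -/
theorem tendsto_integral_densityLaw [l.IsCountablyGenerated] {f g : ι → X → ℝ} {f₀ g₀ : X → ℝ}
    (hf : ∀ᶠ i in l, Measurable (f i)) (hf₀ : Measurable f₀)
    (hg : ∀ᶠ i in l, Measurable (g i)) (hg₀ : Measurable g₀)
    (hpos : ∀ i x, 0 ≤ g i x) (hpos₀ : ∀ x, 0 ≤ g₀ x)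
    (h1 : ∀ᶠ i in l, ∫⁻ x, ENNReal.ofReal (g i x) ∂ν = 1)
    (h1₀ : ∫⁻ x, ENNReal.ofReal (g₀ x) ∂ν = 1)
    {a : ℝ} (ha : 1 < a) {C : ℝ≥0}
    (hC : ∀ᶠ i in l, ∫⁻ x, ‖f i x‖ₑ ^ a ∂(densityLaw ν (g i)) ≤ C)
    (hC₀ : ∫⁻ x, ‖f₀ x‖ₑ ^ a ∂(densityLaw ν g₀) ≤ C)
    (hflim : ∀ x, Tendsto (fun i => f i x) l (𝓝 (f₀ x)))
    (hglim : ∀ x, Tendsto (fun i => g i x) l (𝓝 (g₀ x))) :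
    Tendsto (fun i => ∫ x, f i x ∂(densityLaw ν (g i))) l (𝓝 (∫ x, f₀ x ∂(densityLaw ν g₀))) := by
  have := isProbabilityMeasure_densityLaw h1₀
  have hi₀ := integrable_of_lintegral_eq_one hg₀ hpos₀ h1₀
  have hS := tendsto_integral_abs_sub_density hg hg₀ hpos hpos₀ h1 h1₀ hglim
  rw [Metric.tendsto_nhds]
  intro η hη
  -- Since `a > 1`, clipping at a high level `R` changes either expectation by less than `η / 4`;
  -- the remaining `η / 2` is for the clipped functions.
  obtain ⟨R, hR0, hR⟩ : ∃ R : ℝ, 0 < R ∧ R ^ (1 - a) * C < η / 4 := by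
    have : Tendsto (fun R : ℝ => R ^ (1 - a) * C) atTop (𝓝 (0 * C)) := by
      have := tendsto_rpow_neg_atTop (y := a - 1) (by linarith)
      simp only [neg_sub] at this
      exact this.mul_const _
    rw [zero_mul] at this
    obtain ⟨R, h1, h2⟩ := ((this.eventually_lt_const (show (0 : ℝ) < η / 4 by positivity)).and
      (eventually_gt_atTop 0)).exists
    exact ⟨R, h2, h1⟩
  have hD : Tendsto (fun i => ∫ x, |clip R (f i x) - clip R (f₀ x)| * g₀ x ∂ν) l (𝓝 0) := by
    rw [show (0 : ℝ) = ∫ x, |clip R (f₀ x) - clip R (f₀ x)| * g₀ x ∂ν by simp]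
    refine tendsto_integral_filter_of_dominated_convergence (fun x => (2 * R) * g₀ x) ?_ ?_
      (hi₀.const_mul _) ?_
    · filter_upwards [hf] with i hi
      exact ((((continuous_clip R).measurable.comp hi).sub
        ((continuous_clip R).measurable.comp hf₀)).abs.mul hg₀).aestronglyMeasurable
    · refine .of_forall fun i => ae_of_all _ fun x => ?_
      rw [Real.norm_eq_abs, abs_mul, abs_abs, abs_of_nonneg (hpos₀ x)]
      gcongr
      · exact hpos₀ x
      · refine (abs_sub _ _).trans ?_
        linarith [abs_clip_le hR0.le (f i x), abs_clip_le hR0.le (f₀ x)]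
    · refine ae_of_all _ fun x => ?_
      exact (((((continuous_clip R).tendsto _).comp (hflim x)).sub
        tendsto_const_nhds).abs).mul tendsto_const_nhds
  filter_upwards [hf, hg, h1, hC, hS.eventually_lt_const (show (0 : ℝ) < η / (4 * R) by positivity),
    hD.eventually_lt_const (show (0 : ℝ) < η / 4 by positivity)] with i hfi hgi h1i hCi hSi hDi
  have := isProbabilityMeasure_densityLaw h1i
  have hint := integrable_of_lintegral_eq_one hgi (hpos i) h1i
  have key : ∀ {f : X → ℝ} {g : X → ℝ}, Measurable f → IsProbabilityMeasure (densityLaw ν g) →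
      ∫⁻ x, ‖f x‖ₑ ^ a ∂(densityLaw ν g) ≤ C →
      |∫ x, f x ∂(densityLaw ν g) - ∫ x, clip R (f x) ∂(densityLaw ν g)| ≤ R ^ (1 - a) * C := by
    intro f g hf hP hC
    rw [← integral_sub (integrable_of_moment hf ha.le hC) (integrable_clip hf hR0.le)]
    exact (abs_integral_le_integral_abs).trans (integral_abs_sub_clip_le hf ha.le hC hR0)
  have k1 := key hfi inferInstance hCi
  have k2 := key hf₀ inferInstance hC₀
  -- The clipped expectations differ through the density, at a cost of `R` times an `L¹` distance
  -- (Scheffé), and through the function under the fixed density `g₀` (the limit `hD`).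
  have k3 : |∫ x, clip R (f i x) ∂(densityLaw ν (g i)) - ∫ x, clip R (f₀ x) ∂(densityLaw ν g₀)|
      ≤ R * ∫ x, |g i x - g₀ x| ∂ν + ∫ x, |clip R (f i x) - clip R (f₀ x)| * g₀ x ∂ν := by
    have e1 := (integrable_densityLaw_iff hgi (hpos i)).1 (integrable_clip (P := densityLaw ν (g i)) hfi hR0.le)
    have e2 := (integrable_densityLaw_iff hg₀ hpos₀).1 (integrable_clip (P := densityLaw ν g₀) hf₀ hR0.le)
    have e3 := (integrable_densityLaw_iff hg₀ hpos₀).1 (integrable_clip (P := densityLaw ν g₀) hfi hR0.le)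
    have e4 : Integrable (fun x => |clip R (f i x) - clip R (f₀ x)| * g₀ x) ν := by
      refine (e3.sub e2).abs.congr (ae_of_all _ fun x => ?_)
      simp only [Pi.sub_apply, ← mul_sub, abs_mul, abs_of_nonneg (hpos₀ x)]
      ring
    have e5 : Integrable (fun x => R * |g i x - g₀ x|) ν := (hint.sub hi₀).abs.const_mul R
    rw [integral_densityLaw hgi (hpos i), integral_densityLaw hg₀ hpos₀, ← integral_sub e1 e2,
      ← integral_const_mul, ← integral_add e5 e4]
    refine (abs_integral_le_integral_abs).trans (integral_mono (e1.sub e2).abs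
      (e5.add e4) fun x => ?_)
    have : g i x * clip R (f i x) - g₀ x * clip R (f₀ x) =
      (g i x - g₀ x) * clip R (f i x) + g₀ x * (clip R (f i x) - clip R (f₀ x)) := by ring
    simp only [this]
    refine (abs_add_le _ _).trans ?_
    rw [abs_mul, abs_mul, abs_of_nonneg (hpos₀ x), mul_comm (g₀ x), mul_comm |g i x - g₀ x|]
    gcongr
    exact abs_clip_le hR0.le _
  have k4 : R * ∫ x, |g i x - g₀ x| ∂ν < η / 4 := by
    calc R * ∫ x, |g i x - g₀ x| ∂ν < R * (η / (4 * R)) := by gcongr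
      _ = η / 4 := by field_simp
  rw [Real.dist_eq]
  have t1 := abs_sub_le (∫ x, f i x ∂(densityLaw ν (g i))) (∫ x, clip R (f i x) ∂(densityLaw ν (g i)))
    (∫ x, f₀ x ∂(densityLaw ν g₀))
  have t2 := abs_sub_le (∫ x, clip R (f i x) ∂(densityLaw ν (g i)))
    (∫ x, clip R (f₀ x) ∂(densityLaw ν g₀)) (∫ x, f₀ x ∂(densityLaw ν g₀))
  rw [abs_sub_comm (∫ x, clip R (f₀ x) ∂(densityLaw ν g₀))] at t2
  linarith

end Vitali

end Stackelberg

/-! ### Regular models: continuity of the information, Hellinger affinity. -/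

namespace Stackelberg

/-- A statistical experiment with observations in `X`, controlled by a design variable in the
compact space `U` and parameterized by `θ ∈ Θ`: `φ` is the log-density with respect to `ν`, `s` the
score, `L` a square integrable envelope of the score, and `B` a local Lipschitz constant of the
score near the true parameter `θ₀` having a moment of order `1 + δ`. -/
structure RegularModel (X U : Type*) [MeasurableSpace X] [MetricSpace U] [MeasurableSpace U]
    (m : ℕ) where
  ν : Measure X
  Θ : Set (EuclideanSpace ℝ (Fin m))
  θ₀ : EuclideanSpace ℝ (Fin m)
  φ : X → U → EuclideanSpace ℝ (Fin m) → ℝ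
  s : X → U → EuclideanSpace ℝ (Fin m) → EuclideanSpace ℝ (Fin m)
  L : X → U → ℝ
  B : X → U → ℝ
  r : ℝ
  δ : ℝ
  C : ℝ≥0
  isCompact : IsCompact Θ
  convex : Convex ℝ Θ
  r_pos : 0 < r
  δ_pos : 0 < δ
  ball_subset : Metric.ball θ₀ r ⊆ Θ
  measurable_φ : ∀ u, ∀ θ ∈ Θ, Measurable fun x => φ x u θ
  measurable_s : ∀ u, ∀ θ ∈ Θ, Measurable fun x => s x u θ
  measurable_uncurry_L : Measurable (Function.uncurry L)
  measurable_uncurry_B : Measurable (Function.uncurry B)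
  continuousOn_φ : ∀ x, ContinuousOn
    (fun z : U × EuclideanSpace ℝ (Fin m) => φ x z.1 z.2) (Set.univ ×ˢ Θ)
  continuousOn_s : ∀ x, ContinuousOn
    (fun z : U × EuclideanSpace ℝ (Fin m) => s x z.1 z.2) (Set.univ ×ˢ Θ)
  hasFDerivWithinAt : ∀ x u, ∀ θ ∈ Θ, HasFDerivWithinAt (φ x u) (innerSL ℝ (s x u θ)) Θ θ
  lintegral_exp : ∀ u, ∀ θ ∈ Θ, ∫⁻ x, ENNReal.ofReal (Real.exp (φ x u θ)) ∂ν = 1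
  integral_s : ∀ u, ∀ θ ∈ Θ, ∀ i,
    ∫ x, s x u θ i ∂(densityLaw ν fun x => Real.exp (φ x u θ)) = 0
  third_moment : ∀ u, ∀ θ ∈ Θ,
    ∫⁻ x, ‖s x u θ‖ₑ ^ (3 : ℝ) ∂(densityLaw ν fun x => Real.exp (φ x u θ)) ≤ C
  norm_s_le : ∀ x u, ∀ θ ∈ Θ, ‖s x u θ‖ ≤ L x u
  second_moment : ∀ u, ∀ θ ∈ Θ,
    ∫⁻ x, ‖L x u‖ₑ ^ (2 : ℝ) ∂(densityLaw ν fun x => Real.exp (φ x u θ)) ≤ C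
  identifiable : ∀ θ ∈ Θ, θ ≠ θ₀ → ∀ u, ¬ ((fun x => φ x u θ) =ᵐ[ν] fun x => φ x u θ₀)
  lipschitz : ∀ x u, ∀ θ ∈ Metric.ball θ₀ r, ∀ θ' ∈ Metric.ball θ₀ r,
    ‖s x u θ - s x u θ'‖ ≤ B x u * ‖θ - θ'‖
  moment_B : ∀ u, ∫⁻ x, ‖B x u‖ₑ ^ (1 + δ) ∂(densityLaw ν fun x => Real.exp (φ x u θ₀)) ≤ C

namespace RegularModel

variable {X U : Type*} [MeasurableSpace X] [MetricSpace U] [MeasurableSpace U] {m : ℕ}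
  (M : RegularModel X U m)

/-- The law of the observation. -/
noncomputable def law (u : U) (θ : EuclideanSpace ℝ (Fin m)) : Measure X :=
  densityLaw M.ν fun x => Real.exp (M.φ x u θ)

lemma measurable_L (u : U) : Measurable fun x => M.L x u :=
  M.measurable_uncurry_L.comp (measurable_id.prodMk measurable_const)

lemma measurable_B (u : U) : Measurable fun x => M.B x u :=
  M.measurable_uncurry_B.comp (measurable_id.prodMk measurable_const)

lemma mem_Θ : M.θ₀ ∈ M.Θ := M.ball_subset (Metric.mem_ball_self M.r_pos)

lemma measurable_exp {u : U} {θ : EuclideanSpace ℝ (Fin m)} (hθ : θ ∈ M.Θ) :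
    Measurable fun x => Real.exp (M.φ x u θ) :=
  (M.measurable_φ u θ hθ).exp

lemma isProbabilityMeasure_law (u : U) {θ : EuclideanSpace ℝ (Fin m)} (hθ : θ ∈ M.Θ) :
    IsProbabilityMeasure (M.law u θ) :=
  isProbabilityMeasure_densityLaw (M.lintegral_exp u θ hθ)

instance (u : U) : IsProbabilityMeasure (M.law u M.θ₀) := M.isProbabilityMeasure_law u M.mem_Θ

lemma measurable_s_apply (u : U) {θ : EuclideanSpace ℝ (Fin m)} (hθ : θ ∈ M.Θ) (i : Fin m) :
    Measurable fun x => M.s x u θ i :=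
  (EuclideanSpace.proj (𝕜 := ℝ) i).continuous.measurable.comp (M.measurable_s u θ hθ)

lemma abs_s_le (x : X) (u : U) {θ : EuclideanSpace ℝ (Fin m)} (hθ : θ ∈ M.Θ) (i : Fin m) :
    |M.s x u θ i| ≤ M.L x u :=
  (PiLp.norm_apply_le (M.s x u θ) i).trans (M.norm_s_le x u θ hθ)

lemma L_nonneg (x : X) (u : U) : 0 ≤ M.L x u :=
  (norm_nonneg _).trans (M.norm_s_le x u _ M.mem_Θ)

/-- Information with the two scores taken at different parameters. -/
noncomputable def crossInfo (i j : Fin m) (u : U) (θ θ' : EuclideanSpace ℝ (Fin m)) : ℝ :=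
  ∫ x, M.s x u θ i * M.s x u θ' j ∂(M.law u θ')

/-- Young's inequality with exponents `5/3` and `5/2` turns the power `6/5` of the product into the
square of the envelope plus the cube of the score at `θ'`, and both have bounded means under the law
at `θ'`. An exponent above one is what `tendsto_integral_densityLaw` needs; the square integrable
envelope alone would only give exponent one. -/
lemma moment_mul_le (i j : Fin m) (u : U) {θ θ' : EuclideanSpace ℝ (Fin m)}
    (hθ : θ ∈ M.Θ) (hθ' : θ' ∈ M.Θ) :
    ∫⁻ x, ‖M.s x u θ i * M.s x u θ' j‖ₑ ^ (6 / 5 : ℝ) ∂(M.law u θ') ≤ (M.C + M.C : ℝ≥0) := by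
  have hpt : ∀ x, ‖M.s x u θ i * M.s x u θ' j‖ₑ ^ (6 / 5 : ℝ) ≤
      ‖M.L x u‖ₑ ^ (2 : ℝ) + ‖M.s x u θ'‖ₑ ^ (3 : ℝ) := fun x => by
    have hconj : (5 / 3 : ℝ).HolderConjugate (5 / 2) := by constructor <;> norm_num
    have h1 : ‖M.s x u θ i‖ₑ ≤ ‖M.L x u‖ₑ := by
      rw [← ofReal_norm, ← ofReal_norm]
      refine ENNReal.ofReal_le_ofReal ?_
      rw [Real.norm_of_nonneg (M.L_nonneg x u)]
      exact M.abs_s_le x u hθ i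
    have h2 : ‖M.s x u θ' j‖ₑ ≤ ‖M.s x u θ'‖ₑ := by
      rw [← ofReal_norm, ← ofReal_norm]
      exact ENNReal.ofReal_le_ofReal (PiLp.norm_apply_le _ j)
    rw [enorm_mul, ENNReal.mul_rpow_of_nonneg _ _ (by norm_num)]
    refine (ENNReal.young_inequality _ _ hconj).trans ?_
    rw [← ENNReal.rpow_mul, ← ENNReal.rpow_mul]
    norm_num only
    refine add_le_add ?_ ?_
    · refine (ENNReal.div_le_of_le_mul ?_).trans (ENNReal.rpow_le_rpow h1 (by norm_num))
      refine le_mul_of_one_le_right zero_le ?_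
      rw [ENNReal.one_le_ofReal]; norm_num
    · refine (ENNReal.div_le_of_le_mul ?_).trans (ENNReal.rpow_le_rpow h2 (by norm_num))
      refine le_mul_of_one_le_right zero_le ?_
      rw [ENNReal.one_le_ofReal]; norm_num
  refine (lintegral_mono hpt).trans ?_
  rw [lintegral_add_left ((M.measurable_L u).enorm.pow_const _), ENNReal.coe_add]
  exact add_le_add (M.second_moment u θ' hθ') (M.third_moment u θ' hθ')

lemma integrable_mul_s (i j : Fin m) (u : U) {θ θ' : EuclideanSpace ℝ (Fin m)}
    (hθ : θ ∈ M.Θ) (hθ' : θ' ∈ M.Θ) :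
    Integrable (fun x => M.s x u θ i * M.s x u θ' j) (M.law u θ') :=
  have := M.isProbabilityMeasure_law u hθ'
  integrable_of_moment ((M.measurable_s_apply u hθ i).mul (M.measurable_s_apply u hθ' j))
    (by norm_num) (M.moment_mul_le i j u hθ hθ')

lemma continuousOn_crossInfo (i j : Fin m) :
    ContinuousOn (fun z : U × EuclideanSpace ℝ (Fin m) × EuclideanSpace ℝ (Fin m) =>
      M.crossInfo i j z.1 z.2.1 z.2.2) (Set.univ ×ˢ M.Θ ×ˢ M.Θ) := by
  rintro ⟨u, θ, θ'⟩ ⟨-, (hθ : θ ∈ M.Θ), (hθ' : θ' ∈ M.Θ)⟩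
  have hmem : ∀ᶠ z : U × EuclideanSpace ℝ (Fin m) × EuclideanSpace ℝ (Fin m) in
      𝓝[Set.univ ×ˢ M.Θ ×ˢ M.Θ] (u, θ, θ'), z.2.1 ∈ M.Θ ∧ z.2.2 ∈ M.Θ := by
    filter_upwards [self_mem_nhdsWithin] with z hz using hz.2
  have hs1 : ∀ x, Tendsto (fun z : U × EuclideanSpace ℝ (Fin m) × EuclideanSpace ℝ (Fin m) =>
      M.s x z.1 z.2.1) (𝓝[Set.univ ×ˢ M.Θ ×ˢ M.Θ] (u, θ, θ')) (𝓝 (M.s x u θ)) := fun x =>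
    (M.continuousOn_s x).comp (f := fun z : U × EuclideanSpace ℝ (Fin m) ×
      EuclideanSpace ℝ (Fin m) => (z.1, z.2.1)) (by fun_prop)
      (fun z hz => ⟨trivial, hz.2.1⟩) _ ⟨trivial, hθ, hθ'⟩
  have hs2 : ∀ x, Tendsto (fun z : U × EuclideanSpace ℝ (Fin m) × EuclideanSpace ℝ (Fin m) =>
      M.s x z.1 z.2.2) (𝓝[Set.univ ×ˢ M.Θ ×ˢ M.Θ] (u, θ, θ')) (𝓝 (M.s x u θ')) := fun x =>
    (M.continuousOn_s x).comp (f := fun z : U × EuclideanSpace ℝ (Fin m) ×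
      EuclideanSpace ℝ (Fin m) => (z.1, z.2.2)) (by fun_prop)
      (fun z hz => ⟨trivial, hz.2.2⟩) _ ⟨trivial, hθ, hθ'⟩
  have hφ : ∀ x, Tendsto (fun z : U × EuclideanSpace ℝ (Fin m) × EuclideanSpace ℝ (Fin m) =>
      M.φ x z.1 z.2.2) (𝓝[Set.univ ×ˢ M.Θ ×ˢ M.Θ] (u, θ, θ')) (𝓝 (M.φ x u θ')) := fun x =>
    (M.continuousOn_φ x).comp (f := fun z : U × EuclideanSpace ℝ (Fin m) ×
      EuclideanSpace ℝ (Fin m) => (z.1, z.2.2)) (by fun_prop)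
      (fun z hz => ⟨trivial, hz.2.2⟩) _ ⟨trivial, hθ, hθ'⟩
  have hproj : ∀ i : Fin m, Continuous fun v : EuclideanSpace ℝ (Fin m) => v i := fun i =>
    (EuclideanSpace.proj (𝕜 := ℝ) i).continuous
  have key := tendsto_integral_densityLaw (ν := M.ν) (a := 6 / 5) (C := M.C + M.C)
    (l := 𝓝[Set.univ ×ˢ M.Θ ×ˢ M.Θ] (u, θ, θ'))
    (f := fun z x => M.s x z.1 z.2.1 i * M.s x z.1 z.2.2 j)
    (g := fun z x => Real.exp (M.φ x z.1 z.2.2))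
    (f₀ := fun x => M.s x u θ i * M.s x u θ' j) (g₀ := fun x => Real.exp (M.φ x u θ'))
    (hmem.mono fun z hz => (M.measurable_s_apply _ hz.1 i).mul (M.measurable_s_apply _ hz.2 j))
    ((M.measurable_s_apply u hθ i).mul (M.measurable_s_apply u hθ' j))
    (hmem.mono fun z hz => M.measurable_exp hz.2)
    (M.measurable_exp hθ') (fun _ _ => (Real.exp_pos _).le) (fun _ => (Real.exp_pos _).le)
    (hmem.mono fun z hz => M.lintegral_exp _ _ hz.2)
    (M.lintegral_exp u θ' hθ') (by norm_num)
    (hmem.mono fun z hz => M.moment_mul_le i j _ hz.1 hz.2) (M.moment_mul_le i j u hθ hθ')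
    (fun x => (((hproj i).tendsto _).comp (hs1 x)).mul (((hproj j).tendsto _).comp (hs2 x)))
    (fun x => (Real.continuous_exp.tendsto _).comp (hφ x))
  exact key

/-- The Fisher information matrix. -/
noncomputable def info (u : U) (θ : EuclideanSpace ℝ (Fin m)) : Matrix (Fin m) (Fin m) ℝ :=
  Matrix.of fun i j => M.crossInfo i j u θ θ

lemma continuousOn_info :
    ContinuousOn (fun z : U × EuclideanSpace ℝ (Fin m) => M.info z.1 z.2) (Set.univ ×ˢ M.Θ) := by
  refine continuousOn_pi.2 fun i => continuousOn_pi.2 fun j => ?_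
  exact (M.continuousOn_crossInfo i j).comp (f := fun z : U × EuclideanSpace ℝ (Fin m) =>
    (z.1, z.2, z.2)) (by fun_prop) (fun z hz => ⟨trivial, hz.2, hz.2⟩)

/-- The Hellinger affinity of the laws at `θ` and at `θ₀`. -/
noncomputable def affinity (u : U) (θ : EuclideanSpace ℝ (Fin m)) : ℝ :=
  ∫ x, Real.exp ((M.φ x u θ - M.φ x u M.θ₀) / 2) ∂(M.law u M.θ₀)

/-- The square is the likelihood ratio, whose mean under `θ₀` is the total mass of the density at
`θ`. -/
lemma moment_exp_half (u : U) {θ : EuclideanSpace ℝ (Fin m)} (hθ : θ ∈ M.Θ) :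
    ∫⁻ x, ‖Real.exp ((M.φ x u θ - M.φ x u M.θ₀) / 2)‖ₑ ^ (2 : ℝ) ∂(M.law u M.θ₀)
      ≤ (1 : ℝ≥0) := by
  have h1 := M.measurable_φ u θ hθ
  have h0 := M.measurable_φ u _ M.mem_Θ
  rw [law, lintegral_densityLaw (M.measurable_exp M.mem_Θ) (by fun_prop)]
  refine le_of_eq ?_
  rw [ENNReal.coe_one, ← M.lintegral_exp u θ hθ]
  refine lintegral_congr fun x => ?_
  rw [← Real.enorm_rpow_of_nonneg (Real.exp_pos _).le (by norm_num), Real.enorm_of_nonneg (by positivity),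
    ← ENNReal.ofReal_mul (Real.exp_pos _).le, ← Real.exp_mul, ← Real.exp_add]
  congr 2
  ring

lemma measurable_exp_half (u : U) {θ : EuclideanSpace ℝ (Fin m)} (hθ : θ ∈ M.Θ) :
    Measurable fun x => Real.exp ((M.φ x u θ - M.φ x u M.θ₀) / 2) := by
  have h1 := M.measurable_φ u θ hθ
  have h0 := M.measurable_φ u _ M.mem_Θ
  fun_prop

lemma integrable_exp_half (u : U) {θ : EuclideanSpace ℝ (Fin m)} (hθ : θ ∈ M.Θ) :
    Integrable (fun x => Real.exp ((M.φ x u θ - M.φ x u M.θ₀) / 2)) (M.law u M.θ₀) :=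
  integrable_of_moment (M.measurable_exp_half u hθ) (by norm_num) (M.moment_exp_half u hθ)

lemma continuousOn_affinity :
    ContinuousOn (fun z : U × EuclideanSpace ℝ (Fin m) => M.affinity z.1 z.2)
      (Set.univ ×ˢ M.Θ) := by
  rintro ⟨u, θ⟩ ⟨-, (hθ : θ ∈ M.Θ)⟩
  have hmem : ∀ᶠ z : U × EuclideanSpace ℝ (Fin m) in 𝓝[Set.univ ×ˢ M.Θ] (u, θ), z.2 ∈ M.Θ := by
    filter_upwards [self_mem_nhdsWithin] with z hz using hz.2
  have hφ : ∀ x, Tendsto (fun z : U × EuclideanSpace ℝ (Fin m) => M.φ x z.1 z.2)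
      (𝓝[Set.univ ×ˢ M.Θ] (u, θ)) (𝓝 (M.φ x u θ)) := fun x =>
    M.continuousOn_φ x _ ⟨trivial, hθ⟩
  have hφ₀ : ∀ x, Tendsto (fun z : U × EuclideanSpace ℝ (Fin m) => M.φ x z.1 M.θ₀)
      (𝓝[Set.univ ×ˢ M.Θ] (u, θ)) (𝓝 (M.φ x u M.θ₀)) := fun x =>
    (M.continuousOn_φ x).comp (f := fun z : U × EuclideanSpace ℝ (Fin m) => (z.1, M.θ₀))
      (by fun_prop) (fun z hz => ⟨trivial, M.mem_Θ⟩) _ ⟨trivial, hθ⟩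
  have key := tendsto_integral_densityLaw (ν := M.ν) (a := 2) (C := 1)
    (l := 𝓝[Set.univ ×ˢ M.Θ] (u, θ))
    (f := fun z x => Real.exp ((M.φ x z.1 z.2 - M.φ x z.1 M.θ₀) / 2))
    (g := fun z x => Real.exp (M.φ x z.1 M.θ₀))
    (f₀ := fun x => Real.exp ((M.φ x u θ - M.φ x u M.θ₀) / 2))
    (g₀ := fun x => Real.exp (M.φ x u M.θ₀))
    (hmem.mono fun z hz => M.measurable_exp_half _ hz) (M.measurable_exp_half u hθ)
    (.of_forall fun z => M.measurable_exp M.mem_Θ)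
    (M.measurable_exp M.mem_Θ) (fun _ _ => (Real.exp_pos _).le) (fun _ => (Real.exp_pos _).le)
    (.of_forall fun z => M.lintegral_exp _ _ M.mem_Θ)
    (M.lintegral_exp u _ M.mem_Θ) (by norm_num)
    (hmem.mono fun z hz => M.moment_exp_half _ hz) (M.moment_exp_half u hθ)
    (fun x => (Real.continuous_exp.tendsto _).comp (((hφ x).sub (hφ₀ x)).div_const 2))
    (fun x => (Real.continuous_exp.tendsto _).comp (hφ₀ x))
  exact key

/-- The squared `L²` distance between the square roots of the two densities is `2 - 2 * affinity`.
If the affinity were at least one, the densities would agree almost everywhere, against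
identifiability. -/
lemma affinity_lt_one (u : U) {θ : EuclideanSpace ℝ (Fin m)} (hθ : θ ∈ M.Θ) (hne : θ ≠ M.θ₀) :
    M.affinity u θ < 1 := by
  by_contra! h
  have hi₁ := integrable_of_lintegral_eq_one (M.measurable_exp hθ)
    (fun _ => (Real.exp_pos _).le) (M.lintegral_exp u θ hθ)
  have hi₀ := integrable_of_lintegral_eq_one (M.measurable_exp M.mem_Θ)
    (fun _ => (Real.exp_pos _).le) (M.lintegral_exp u _ M.mem_Θ)
  have he₁ := integral_eq_one_of_lintegral_eq_one (M.measurable_exp hθ)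
    (fun _ => (Real.exp_pos _).le) (M.lintegral_exp u θ hθ)
  have he₀ := integral_eq_one_of_lintegral_eq_one (M.measurable_exp M.mem_Θ)
    (fun _ => (Real.exp_pos _).le) (M.lintegral_exp u _ M.mem_Θ)
  have hi := (integrable_densityLaw_iff (M.measurable_exp M.mem_Θ)
    (fun _ => (Real.exp_pos _).le)).1 (M.integrable_exp_half u hθ)
  rw [affinity, law, integral_densityLaw (M.measurable_exp M.mem_Θ)
    (fun _ => (Real.exp_pos _).le)] at h
  have hsq : ∀ x, (Real.exp (M.φ x u θ / 2) - Real.exp (M.φ x u M.θ₀ / 2)) ^ 2 =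
      Real.exp (M.φ x u θ) + Real.exp (M.φ x u M.θ₀) -
        2 * (Real.exp (M.φ x u M.θ₀) * Real.exp ((M.φ x u θ - M.φ x u M.θ₀) / 2)) := fun x => by
    rw [sub_sq, ← Real.exp_nat_mul, ← Real.exp_nat_mul, mul_assoc, ← Real.exp_add, ← Real.exp_add]
    push_cast
    ring_nf
  have hadd : Integrable (fun x => Real.exp (M.φ x u θ) + Real.exp (M.φ x u M.θ₀)) M.ν :=
    hi₁.add hi₀
  have hint : Integrable (fun x => (Real.exp (M.φ x u θ / 2) - Real.exp (M.φ x u M.θ₀ / 2)) ^ 2)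
      M.ν := by
    simp_rw [hsq]
    exact hadd.sub (hi.const_mul 2)
  have hle : ∫ x, (Real.exp (M.φ x u θ / 2) - Real.exp (M.φ x u M.θ₀ / 2)) ^ 2 ∂M.ν ≤ 0 := by
    simp_rw [hsq]
    rw [integral_sub hadd (hi.const_mul 2), integral_add hi₁ hi₀, he₁, he₀, integral_const_mul]
    linarith
  have hz := (integral_eq_zero_iff_of_nonneg (fun x => sq_nonneg _) hint).1
    (le_antisymm hle (integral_nonneg fun x => sq_nonneg _))
  refine M.identifiable θ hθ hne u ?_
  filter_upwards [hz] with x hx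
  have : Real.exp (M.φ x u θ / 2) = Real.exp (M.φ x u M.θ₀ / 2) := by
    have := pow_eq_zero_iff (two_ne_zero) |>.1 hx
    linarith
  linarith [Real.exp_injective this]

/-- The affinity is bounded away from one, uniformly in the design and for parameters away
from `θ₀`. -/
lemma exists_affinity_le [CompactSpace U] {ε : ℝ} (hε : 0 < ε) :
    ∃ ρ : ℝ, 0 ≤ ρ ∧ ρ < 1 ∧ ∀ u, ∀ θ ∈ M.Θ, ε ≤ ‖θ - M.θ₀‖ → M.affinity u θ ≤ ρ := by
  have hcomp : IsCompact ((Set.univ : Set U) ×ˢ (M.Θ \ Metric.ball M.θ₀ ε)) :=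
    isCompact_univ.prod (M.isCompact.diff Metric.isOpen_ball)
  have hmem : ∀ u : U, ∀ θ ∈ M.Θ, ε ≤ ‖θ - M.θ₀‖ →
      (u, θ) ∈ (Set.univ : Set U) ×ˢ (M.Θ \ Metric.ball M.θ₀ ε) := fun u θ hθ h =>
    ⟨trivial, hθ, by rw [Metric.mem_ball, dist_eq_norm]; linarith⟩
  rcases ((Set.univ : Set U) ×ˢ (M.Θ \ Metric.ball M.θ₀ ε)).eq_empty_or_nonempty with he | hne
  · refine ⟨0, le_rfl, one_pos, fun u θ hθ h => ?_⟩
    have := hmem u θ hθ h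
    rw [he] at this
    exact this.elim
  · obtain ⟨⟨u, θ⟩, ⟨-, (hθ : θ ∈ M.Θ), (hb : θ ∉ Metric.ball M.θ₀ ε)⟩, hmax⟩ := hcomp.exists_isMaxOn hne
      (M.continuousOn_affinity.mono (Set.prod_mono le_rfl Set.sdiff_subset))
    have hne' : θ ≠ M.θ₀ := fun h => hb (h ▸ Metric.mem_ball_self hε)
    have hle : ∀ u' : U, ∀ θ' ∈ M.Θ, ε ≤ ‖θ' - M.θ₀‖ → M.affinity u' θ' ≤ M.affinity u θ :=
      fun u' θ' hθ' h => by
        have h1 := hmem u' θ' hθ' h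
        have h2 := isMaxOn_iff.1 hmax
        have h3 := h2 _ h1
        simpa only using h3
    exact ⟨M.affinity u θ, integral_nonneg fun x => (Real.exp_pos _).le,
      M.affinity_lt_one u hθ hne', hle⟩

end RegularModel

end Stackelberg

/-! ### First-order expansion of the mean score under the true parameter. -/

namespace Stackelberg

lemma exists_pos_forall_le {ι : Type*} [Finite ι] {f : ι → ℝ} (hf : ∀ i, 0 < f i) :
    ∃ e > 0, ∀ i, e ≤ f i := by
  rcases isEmpty_or_nonempty ι with h | h
  · exact ⟨1, one_pos, fun i => h.elim i⟩
  · obtain ⟨i, hi⟩ := Finite.exists_min f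
    exact ⟨f i, hf i, hi⟩

namespace RegularModel

variable {X U : Type*} [MeasurableSpace X] [MetricSpace U] [MeasurableSpace U] {m : ℕ}
  (M : RegularModel X U m)

/-- The point of the segment from `θ₀` to `θ` at time `t`, constant outside `[0, 1]`. -/
noncomputable def seg (θ : EuclideanSpace ℝ (Fin m)) (t : ℝ) : EuclideanSpace ℝ (Fin m) :=
  M.θ₀ + (max 0 (min t 1)) • (θ - M.θ₀)

lemma continuous_seg (θ : EuclideanSpace ℝ (Fin m)) : Continuous (M.seg θ) := by
  unfold seg; fun_prop

lemma seg_of_mem (θ : EuclideanSpace ℝ (Fin m)) {t : ℝ} (ht : t ∈ Set.Icc (0 : ℝ) 1) :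
    M.seg θ t = M.θ₀ + t • (θ - M.θ₀) := by
  rw [seg, min_eq_left ht.2, max_eq_right ht.1]

lemma norm_seg_sub_le (θ : EuclideanSpace ℝ (Fin m)) (t : ℝ) :
    ‖M.seg θ t - M.θ₀‖ ≤ ‖θ - M.θ₀‖ := by
  rw [seg, add_sub_cancel_left, norm_smul]
  refine mul_le_of_le_one_left (norm_nonneg _) ?_
  rw [Real.norm_of_nonneg (le_max_left _ _)]
  exact max_le zero_le_one (min_le_right _ _)

lemma seg_mem_ball {θ : EuclideanSpace ℝ (Fin m)} {ε : ℝ} (hθ : θ ∈ Metric.ball M.θ₀ ε) (t : ℝ) :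
    M.seg θ t ∈ Metric.ball M.θ₀ ε := by
  rw [Metric.mem_ball, dist_eq_norm] at hθ ⊢
  exact (M.norm_seg_sub_le θ t).trans_lt hθ

lemma hasFDerivAt (x : X) (u : U) {θ : EuclideanSpace ℝ (Fin m)}
    (hθ : θ ∈ Metric.ball M.θ₀ M.r) : HasFDerivAt (M.φ x u) (innerSL ℝ (M.s x u θ)) θ :=
  (M.hasFDerivWithinAt x u θ (M.ball_subset hθ)).hasFDerivAt
    (mem_of_superset (Metric.isOpen_ball.mem_nhds hθ) M.ball_subset)

/-- The integrand in the representation of `p(θ) - p(θ₀)` as an integral along the segment. -/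
noncomputable def segIntegrand (u : U) (θ : EuclideanSpace ℝ (Fin m)) (x : X) (t : ℝ) : ℝ :=
  Real.exp (M.φ x u (M.seg θ t)) * ∑ j, M.s x u (M.seg θ t) j * (θ - M.θ₀) j

lemma continuous_seg_s (x : X) (u : U) {θ : EuclideanSpace ℝ (Fin m)}
    (hθ : θ ∈ Metric.ball M.θ₀ M.r) : Continuous fun t => M.s x u (M.seg θ t) := by
  have := (M.continuousOn_s x).comp_continuous (f := fun t : ℝ => (u, M.seg θ t))
    (continuous_const.prodMk (M.continuous_seg θ))
    (fun t => ⟨trivial, M.ball_subset (M.seg_mem_ball hθ t)⟩)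
  exact this

lemma continuous_seg_φ (x : X) (u : U) {θ : EuclideanSpace ℝ (Fin m)}
    (hθ : θ ∈ Metric.ball M.θ₀ M.r) : Continuous fun t => M.φ x u (M.seg θ t) := by
  have := (M.continuousOn_φ x).comp_continuous (f := fun t : ℝ => (u, M.seg θ t))
    (continuous_const.prodMk (M.continuous_seg θ))
    (fun t => ⟨trivial, M.ball_subset (M.seg_mem_ball hθ t)⟩)
  exact this

lemma continuous_segIntegrand (x : X) (u : U) {θ : EuclideanSpace ℝ (Fin m)}
    (hθ : θ ∈ Metric.ball M.θ₀ M.r) : Continuous (M.segIntegrand u θ x) := by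
  have h1 := M.continuous_seg_φ x u hθ
  have h2 := M.continuous_seg_s x u hθ
  unfold segIntegrand
  refine (Real.continuous_exp.comp h1).mul (continuous_finsetSum _ fun j _ => ?_)
  exact ((EuclideanSpace.proj (𝕜 := ℝ) j).continuous.comp h2).mul continuous_const

lemma measurable_segIntegrand (u : U) {θ : EuclideanSpace ℝ (Fin m)}
    (hθ : θ ∈ Metric.ball M.θ₀ M.r) (t : ℝ) : Measurable fun x => M.segIntegrand u θ x t := by
  have hmem := M.ball_subset (M.seg_mem_ball hθ t)
  unfold segIntegrand
  refine (M.measurable_exp hmem).mul (Finset.measurable_sum _ fun j _ => ?_)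
  exact (M.measurable_s_apply u hmem j).mul measurable_const

lemma integral_segIntegrand (x : X) (u : U) {θ : EuclideanSpace ℝ (Fin m)}
    (hθ : θ ∈ Metric.ball M.θ₀ M.r) :
    ∫ t in (0 : ℝ)..1, M.segIntegrand u θ x t = Real.exp (M.φ x u θ) - Real.exp (M.φ x u M.θ₀) := by
  have hcong : ∀ t ∈ Set.uIcc (0 : ℝ) 1, HasDerivAt
      (fun t : ℝ => Real.exp (M.φ x u (M.θ₀ + t • (θ - M.θ₀)))) (M.segIntegrand u θ x t) t := by
    intro t ht
    rw [Set.uIcc_of_le zero_le_one] at ht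
    have hb := M.seg_mem_ball hθ t
    have hd : HasDerivAt (fun t : ℝ => M.θ₀ + t • (θ - M.θ₀)) (θ - M.θ₀) t := by
      simpa using ((hasDerivAt_id t).smul_const (θ - M.θ₀)).const_add M.θ₀
    have hF := M.hasFDerivAt x u hb
    rw [segIntegrand]
    rw [M.seg_of_mem θ ht] at hF ⊢
    have := (hF.comp_hasDerivAt t hd).exp
    convert! this using 1
    simp only [innerSL_apply_apply, PiLp.inner_apply, Function.comp_apply]
    congr 1
    exact Finset.sum_congr rfl fun j _ => by simp [mul_comm]
  rw [intervalIntegral.integral_eq_sub_of_hasDerivAt hcong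
    ((M.continuous_segIntegrand x u hθ).intervalIntegrable _ _)]
  simp

/-- The hypothesis of Fubini's theorem for `integral_s_eq`. Both scores are at most the envelope
`L`, so at time `t` the inner integral is at most the second moment of `L` under the law at `seg θ
t`, times the `ℓ¹` norm of `θ - θ₀`, and that moment is bounded uniformly in `t`. -/
lemma integrable_s_mul_segIntegrand (i : Fin m) (u : U) {θ : EuclideanSpace ℝ (Fin m)}
    (hθ : θ ∈ Metric.ball M.θ₀ M.r) [SFinite M.ν] :
    Integrable (Function.uncurry fun (x : X) (t : ℝ) => M.s x u θ i * M.segIntegrand u θ x t)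
      (M.ν.prod (volume.restrict (Set.uIoc 0 1))) := by
  have hθ' := M.ball_subset hθ
  have hmeas : Measurable (Function.uncurry fun (x : X) (t : ℝ) =>
      M.s x u θ i * M.segIntegrand u θ x t) := by
    have h1 : Measurable (Function.uncurry fun (t : ℝ) (x : X) => M.segIntegrand u θ x t) :=
      measurable_uncurry_of_continuous_of_measurable
        (fun x => M.continuous_segIntegrand x u hθ) (M.measurable_segIntegrand u hθ)
    exact ((M.measurable_s_apply u hθ' i).comp measurable_fst).mul (h1.comp measurable_swap)
  refine ⟨hmeas.aestronglyMeasurable, ?_⟩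
  rw [HasFiniteIntegral, lintegral_prod_symm _ hmeas.enorm.aemeasurable]
  set K : ℝ≥0∞ := M.C * ENNReal.ofReal (∑ j, |(θ - M.θ₀) j|)
  have hK : K < ∞ := ENNReal.mul_lt_top ENNReal.coe_lt_top ENNReal.ofReal_lt_top
  have hbound : ∀ t : ℝ, ∫⁻ x, ‖M.s x u θ i * M.segIntegrand u θ x t‖ₑ ∂M.ν ≤ K := by
    intro t
    have hmem := M.ball_subset (M.seg_mem_ball hθ t)
    calc ∫⁻ x, ‖M.s x u θ i * M.segIntegrand u θ x t‖ₑ ∂M.ν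
        ≤ ∫⁻ x, (ENNReal.ofReal (Real.exp (M.φ x u (M.seg θ t))) * ‖M.L x u‖ₑ ^ (2 : ℝ)) *
            ENNReal.ofReal (∑ j, |(θ - M.θ₀) j|) ∂M.ν := by
          refine lintegral_mono fun x => ?_
          rw [← Real.enorm_rpow_of_nonneg (M.L_nonneg x u) (by norm_num),
            Real.enorm_of_nonneg (r := M.L x u ^ (2 : ℝ))
              (Real.rpow_nonneg (M.L_nonneg x u) _),
            ← ENNReal.ofReal_mul (Real.exp_pos _).le, ← ENNReal.ofReal_mul
              (mul_nonneg (Real.exp_pos _).le (Real.rpow_nonneg (M.L_nonneg x u) _)),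
            ← ofReal_norm]
          refine ENNReal.ofReal_le_ofReal ?_
          have hL := M.L_nonneg x u
          have hsum : |∑ j, M.s x u (M.seg θ t) j * (θ - M.θ₀) j| ≤
              M.L x u * ∑ j, |(θ - M.θ₀) j| := by
            refine (Finset.abs_sum_le_sum_abs _ _).trans ?_
            rw [Finset.mul_sum]
            refine Finset.sum_le_sum fun j _ => ?_
            rw [abs_mul]
            gcongr
            exact M.abs_s_le x u hmem j
          rw [Real.norm_eq_abs, segIntegrand, abs_mul, abs_mul, abs_of_pos (Real.exp_pos _)]
          calc _ ≤ M.L x u * (Real.exp (M.φ x u (M.seg θ t)) *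
                (M.L x u * ∑ j, |(θ - M.θ₀) j|)) := by
                gcongr
                exact M.abs_s_le x u hθ' i
            _ = _ := by norm_num; ring
      _ = (∫⁻ x, ‖M.L x u‖ₑ ^ (2 : ℝ) ∂(M.law u (M.seg θ t))) *
            ENNReal.ofReal (∑ j, |(θ - M.θ₀) j|) := by
          have hL := M.measurable_L u
          have he := M.measurable_exp (u := u) hmem
          rw [lintegral_mul_const _ (by fun_prop), law, lintegral_densityLaw he (by fun_prop)]
      _ ≤ K := mul_le_mul' (M.second_moment u _ hmem) le_rfl
  calc ∫⁻ t in Set.uIoc 0 1, ∫⁻ x, ‖M.s x u θ i * M.segIntegrand u θ x t‖ₑ ∂M.ν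
      ≤ ∫⁻ t in Set.uIoc (0 : ℝ) 1, K := lintegral_mono fun t => hbound t
    _ < ∞ := by simpa using hK

/-- The mean under `θ₀` of the score at `θ`, in terms of the information. -/
lemma integral_s_eq (i : Fin m) (u : U) {θ : EuclideanSpace ℝ (Fin m)}
    (hθ : θ ∈ Metric.ball M.θ₀ M.r) [SFinite M.ν] :
    ∫ x, M.s x u θ i ∂(M.law u M.θ₀) =
      - ∫ t in (0 : ℝ)..1, ∑ j, (θ - M.θ₀) j * M.crossInfo i j u θ (M.seg θ t) := by
  have hθ' := M.ball_subset hθ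
  have hsq : ∀ {θ'}, θ' ∈ M.Θ →
      Integrable (fun x => Real.exp (M.φ x u θ') * M.s x u θ i) M.ν := fun {θ'} h' => by
    rw [← integrable_densityLaw_iff (M.measurable_exp h') fun _ => (Real.exp_pos _).le]
    have := M.isProbabilityMeasure_law u h'
    refine integrable_of_moment (P := M.law u θ') (a := 2) (C := M.C)
      (M.measurable_s_apply u hθ' i) (by norm_num) (le_trans (lintegral_mono fun x => ?_)
        (M.second_moment u θ' h'))
    refine ENNReal.rpow_le_rpow ?_ (by norm_num)
    rw [← ofReal_norm, ← ofReal_norm]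
    refine ENNReal.ofReal_le_ofReal ?_
    rw [Real.norm_of_nonneg (M.L_nonneg x u)]
    exact M.abs_s_le x u hθ' i
  -- The score at `θ` is centred under the law at `θ`, so its mean under `θ₀` is minus its integral
  -- against the difference of densities, which is an integral along the segment. The score itself
  -- need not be differentiated.
  have h0 : ∫ x, Real.exp (M.φ x u θ) * M.s x u θ i ∂M.ν = 0 := by
    rw [← integral_densityLaw (M.measurable_exp hθ') fun _ => (Real.exp_pos _).le]
    exact M.integral_s u θ hθ' i
  have h1 : ∫ x, M.s x u θ i ∂(M.law u M.θ₀) =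
      - ∫ x, (∫ t in (0 : ℝ)..1, M.s x u θ i * M.segIntegrand u θ x t) ∂M.ν := by
    rw [law, integral_densityLaw (M.measurable_exp M.mem_Θ) fun _ => (Real.exp_pos _).le]
    have : ∀ x, ∫ t in (0 : ℝ)..1, M.s x u θ i * M.segIntegrand u θ x t =
        Real.exp (M.φ x u θ) * M.s x u θ i - Real.exp (M.φ x u M.θ₀) * M.s x u θ i := fun x => by
      rw [intervalIntegral.integral_const_mul, M.integral_segIntegrand x u hθ]
      ring
    simp_rw [this]
    rw [integral_sub (hsq hθ') (hsq M.mem_Θ), h0]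
    ring
  rw [h1, ← intervalIntegral_integral_swap]
  · congr 1
    refine intervalIntegral.integral_congr fun t _ => ?_
    have hmem := M.ball_subset (M.seg_mem_ball hθ t)
    have he : ∀ x, M.s x u θ i * M.segIntegrand u θ x t = ∑ j, (θ - M.θ₀) j *
        (Real.exp (M.φ x u (M.seg θ t)) * (M.s x u θ i * M.s x u (M.seg θ t) j)) := fun x => by
      rw [segIntegrand, Finset.mul_sum, Finset.mul_sum]
      exact Finset.sum_congr rfl fun j _ => by ring
    simp_rw [he]
    rw [integral_finsetSum]
    · refine Finset.sum_congr rfl fun j _ => ?_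
      rw [integral_const_mul, crossInfo, law,
        integral_densityLaw (M.measurable_exp hmem) fun _ => (Real.exp_pos _).le]
    · intro j _
      refine Integrable.const_mul ?_ _
      rw [← integrable_densityLaw_iff (M.measurable_exp hmem) fun _ => (Real.exp_pos _).le]
      exact M.integrable_mul_s i j u hθ' hmem
  · have := (M.integrable_s_mul_segIntegrand i u hθ).swap
    exact this

/-- First-order expansion of the mean score, uniformly near a design `u₀`. -/
lemma exists_abs_integral_s_add_le [SFinite M.ν] (u₀ : U) {η : ℝ} (hη : 0 < η) :
    ∃ ε > 0, ε ≤ M.r ∧ ∀ u, dist u u₀ < ε → ∀ θ ∈ Metric.ball M.θ₀ ε, ∀ i,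
      |∫ x, M.s x u θ i ∂(M.law u M.θ₀) + ∑ j, M.info u₀ M.θ₀ i j * (θ - M.θ₀) j|
        ≤ η * ‖θ - M.θ₀‖ := by
  -- The `m` entries of a row of the information each contribute an error `η'`.
  obtain ⟨η', hη', hmη⟩ : ∃ η' > 0, m * η' ≤ η :=
    ⟨η / (m + 1), by positivity, by rw [mul_div_assoc', div_le_iff₀ (by positivity)]; nlinarith⟩
  have hK : ∀ i j, ∃ ε > 0, ∀ u, dist u u₀ < ε → ∀ θ ∈ M.Θ, ∀ θ' ∈ M.Θ,
      θ ∈ Metric.ball M.θ₀ ε → θ' ∈ Metric.ball M.θ₀ ε →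
      |M.crossInfo i j u θ θ' - M.info u₀ M.θ₀ i j| ≤ η' := fun i j => by
    obtain ⟨ε, hε, h⟩ := Metric.continuousWithinAt_iff.1
      (M.continuousOn_crossInfo i j (u₀, M.θ₀, M.θ₀) ⟨trivial, M.mem_Θ, M.mem_Θ⟩) η' hη'
    refine ⟨ε, hε, fun u hu θ hθ θ' hθ' hb hb' => ?_⟩
    have := h (x := (u, θ, θ')) ⟨trivial, hθ, hθ'⟩ (by
      simp only [Prod.dist_eq]
      exact max_lt hu (max_lt hb hb'))
    rw [Real.dist_eq] at this
    exact this.le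
  choose ε hε hεK using hK
  obtain ⟨ε₀, hε₀, hle⟩ : ∃ ε₀ > 0, ∀ i j, ε₀ ≤ ε i j := by
    obtain ⟨e, he, h⟩ := exists_pos_forall_le (f := fun p : Fin m × Fin m => ε p.1 p.2)
      (fun p => hε _ _)
    exact ⟨e, he, fun i j => h (i, j)⟩
  refine ⟨min ε₀ M.r, lt_min hε₀ M.r_pos, min_le_right _ _, fun u hu θ hθ i => ?_⟩
  have hθr : θ ∈ Metric.ball M.θ₀ M.r := Metric.ball_subset_ball (min_le_right _ _) hθ
  rw [M.integral_s_eq i u hθr]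
  -- The limit is written as the integral of a constant, so that it can be compared under one
  -- integral sign with the formula of `integral_s_eq`.
  have hc : ∫ t in (0 : ℝ)..1, ∑ j, M.info u₀ M.θ₀ i j * (θ - M.θ₀) j =
      ∑ j, M.info u₀ M.θ₀ i j * (θ - M.θ₀) j := by simp
  have hcont : ContinuousOn (fun t => ∑ j, (θ - M.θ₀) j * M.crossInfo i j u θ (M.seg θ t))
      (Set.uIcc 0 1) := by
    refine continuousOn_finsetSum _ fun j _ => continuousOn_const.mul ?_
    refine (M.continuousOn_crossInfo i j).comp (f := fun t : ℝ => (u, θ, M.seg θ t)) ?_ ?_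
    · exact (continuous_const.prodMk (continuous_const.prodMk (M.continuous_seg θ))).continuousOn
    · exact fun t _ => ⟨trivial, M.ball_subset hθr, M.ball_subset (M.seg_mem_ball hθr t)⟩
  rw [← hc, neg_add_eq_sub, ← intervalIntegral.integral_sub (by simp)
    hcont.intervalIntegrable]
  have := intervalIntegral.norm_integral_le_of_norm_le_const (a := 0) (b := 1)
    (C := η * ‖θ - M.θ₀‖) (f := fun t => ∑ j, M.info u₀ M.θ₀ i j * (θ - M.θ₀) j -
      ∑ j, (θ - M.θ₀) j * M.crossInfo i j u θ (M.seg θ t)) ?_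
  · simpa using this
  intro t _
  rw [← Finset.sum_sub_distrib, Real.norm_eq_abs]
  calc _ ≤ ∑ j : Fin m, η' * ‖θ - M.θ₀‖ := by
        refine (Finset.abs_sum_le_sum_abs _ _).trans (Finset.sum_le_sum fun j _ => ?_)
        rw [mul_comm ((θ - M.θ₀) j), ← sub_mul, abs_mul, abs_sub_comm]
        gcongr
        · refine hεK i j u (hu.trans_le ((min_le_left _ _).trans (hle i j))) θ (M.ball_subset hθr)
            _ (M.ball_subset (M.seg_mem_ball hθr t)) ?_ ?_
          · exact Metric.ball_subset_ball ((min_le_left _ _).trans (hle i j)) hθ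
          · exact Metric.ball_subset_ball ((min_le_left _ _).trans (hle i j)) (M.seg_mem_ball hθ t)
        · exact PiLp.norm_apply_le (θ - M.θ₀) j
    _ = (m * η') * ‖θ - M.θ₀‖ := by simp; ring
    _ ≤ _ := by gcongr

end RegularModel
end Stackelberg

/-! ### Sequential designs and conditioning on the past. -/

namespace Stackelberg
namespace RegularModel

variable {X U : Type*} [MeasurableSpace X] [MetricSpace U] [MeasurableSpace U] [BorelSpace U]
  [SecondCountableTopology U] {m : ℕ} (M : RegularModel X U m) [SFinite M.ν]

-- A Carathéodory function: continuity in the design and measurability in the observation give joint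
-- measurability, as the design space is second countable. The kernel and all sums over rounds
-- depend on it.
omit [SFinite M.ν] in
lemma measurable_uncurry_φ {θ : EuclideanSpace ℝ (Fin m)} (hθ : θ ∈ M.Θ) :
    Measurable (Function.uncurry fun x u => M.φ x u θ) := by
  have h : Measurable (Function.uncurry fun u x => M.φ x u θ) :=
    measurable_uncurry_of_continuous_of_measurable (fun x => by
      exact (M.continuousOn_φ x).comp_continuous (f := fun u : U => (u, θ)) (by fun_prop)
        (fun u => ⟨trivial, hθ⟩)) (fun u => M.measurable_φ u θ hθ)
  exact h.comp measurable_swap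

omit [SFinite M.ν] in
lemma measurable_uncurry_s {θ : EuclideanSpace ℝ (Fin m)} (hθ : θ ∈ M.Θ) :
    Measurable (Function.uncurry fun x u => M.s x u θ) := by
  have h : Measurable (Function.uncurry fun u x => M.s x u θ) :=
    measurable_uncurry_of_continuous_of_measurable (fun x => by
      exact (M.continuousOn_s x).comp_continuous (f := fun u : U => (u, θ)) (by fun_prop)
        (fun u => ⟨trivial, hθ⟩)) (fun u => M.measurable_s u θ hθ)
  exact h.comp measurable_swap

/-- The law of the observation under the true parameter, as a kernel. -/
noncomputable def kernel : Kernel U X where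
  toFun u := M.law u M.θ₀
  measurable' := by
    refine Measure.measurable_of_measurable_coe _ fun S hS => ?_
    have : ∀ u, M.law u M.θ₀ S = ∫⁻ x in S, ENNReal.ofReal (Real.exp (M.φ x u M.θ₀)) ∂M.ν :=
      fun u => withDensity_apply _ hS
    simp_rw [this]
    have hm := (M.measurable_uncurry_φ M.mem_Θ).comp (measurable_swap (α := U))
    exact Measurable.lintegral_prod_right' (ν := M.ν.restrict S)
      (f := fun z : U × X => ENNReal.ofReal (Real.exp (M.φ z.2 z.1 M.θ₀))) hm.exp.ennreal_ofReal

lemma kernel_apply (u : U) : M.kernel u = M.law u M.θ₀ := rfl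

instance : IsMarkovKernel M.kernel := ⟨fun u => by rw [kernel_apply]; infer_instance⟩

/-- The conditional mean of `f` given the design. -/
noncomputable def mean {E : Type*} [NormedAddCommGroup E] [NormedSpace ℝ E] (f : X → U → E) (u : U) :
    E :=
  ∫ x, f x u ∂(M.law u M.θ₀)

lemma measurable_mean {E : Type*} [NormedAddCommGroup E] [NormedSpace ℝ E] [MeasurableSpace E]
    [BorelSpace E] [SecondCountableTopology E] {f : X → U → E}
    (hf : Measurable (Function.uncurry f)) : Measurable (M.mean f) := by
  have := StronglyMeasurable.integral_kernel_prod_right' (κ := M.kernel)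
    (hf.comp measurable_swap).stronglyMeasurable
  exact this.measurable

/-- The sequential experiment: in round `t` the design `v t` is chosen on the basis of the past, and
the observation `y t` is drawn from the corresponding law under the true parameter. -/
structure IsDesign {Ω : Type*} {mΩ : MeasurableSpace Ω} (μ : Measure Ω) (ℱ : Filtration ℕ mΩ)
    (v : ℕ → Ω → U) (y : ℕ → Ω → X) : Prop where
  measurable_v : ∀ t, Measurable[ℱ t] (v t)
  measurable_y : ∀ t, Measurable[ℱ (t + 1)] (y t)
  measure_inter : ∀ t A, MeasurableSet[ℱ t] A → ∀ S, MeasurableSet S →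
    μ (A ∩ y t ⁻¹' S) = ∫⁻ ω in A, M.law (v t ω) M.θ₀ S ∂μ

namespace IsDesign

variable {M} {Ω : Type*} {mΩ : MeasurableSpace Ω} {μ : Measure Ω} [IsProbabilityMeasure μ]
  {ℱ : Filtration ℕ mΩ} {v : ℕ → Ω → U} {y : ℕ → Ω → X} (h : M.IsDesign μ ℱ v y)

include h

omit [BorelSpace U] [SecondCountableTopology U] [SFinite M.ν] [IsProbabilityMeasure μ] in
lemma measurable_v' (t : ℕ) : Measurable (v t) := (h.measurable_v t).mono (ℱ.le t) le_rfl

omit [BorelSpace U] [SecondCountableTopology U] [SFinite M.ν] [IsProbabilityMeasure μ] in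
lemma measurable_y' (t : ℕ) : Measurable (y t) := (h.measurable_y t).mono (ℱ.le _) le_rfl

omit [BorelSpace U] [SecondCountableTopology U] [SFinite M.ν] [IsProbabilityMeasure μ] in
lemma measurable_obs {β : Type*} [MeasurableSpace β] {f : X → U → β}
    (hf : Measurable (Function.uncurry f)) (t : ℕ) :
    Measurable[ℱ (t + 1)] fun ω => f (y t ω) (v t ω) :=
  hf.comp ((h.measurable_y t).prodMk ((h.measurable_v t).mono (ℱ.mono t.le_succ) le_rfl))

omit [BorelSpace U] [SecondCountableTopology U] [SFinite M.ν] [IsProbabilityMeasure μ] in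
lemma measurable_obs' {β : Type*} [MeasurableSpace β] {f : X → U → β}
    (hf : Measurable (Function.uncurry f)) (t : ℕ) :
    Measurable fun ω => f (y t ω) (v t ω) :=
  (h.measurable_obs hf t).mono (ℱ.le _) le_rfl

/-- The joint law of a past variable, the design and the observation. -/
lemma map_eq_compProd {V : Type*} [MeasurableSpace V] {t : ℕ} {W : Ω → V}
    (hW : Measurable[ℱ t] W) :
    μ.map (fun ω => ((W ω, v t ω), y t ω)) =
      (μ.map fun ω => (W ω, v t ω)) ⊗ₘ (M.kernel.comap Prod.snd measurable_snd) := by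
  have hWv : Measurable[ℱ t] fun ω => (W ω, v t ω) := hW.prodMk (h.measurable_v t)
  have hWv' : Measurable fun ω => (W ω, v t ω) := hWv.mono (ℱ.le t) le_rfl
  have hall : Measurable fun ω => ((W ω, v t ω), y t ω) := hWv'.prodMk (h.measurable_y' t)
  have : IsProbabilityMeasure (μ.map fun ω => ((W ω, v t ω), y t ω)) :=
    Measure.isProbabilityMeasure_map hall.aemeasurable
  refine Measure.ext_prod fun {A S} hA hS => ?_
  rw [Measure.map_apply hall (hA.prod hS), Measure.compProd_apply_prod hA hS,
    setLIntegral_map hA (Kernel.measurable_coe _ hS) hWv']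
  exact h.measure_inter t _ (hWv hA) S hS

/-- The tower property in disintegrated form: `W` carries whatever the integrand knows of the past,
and only the newest observation is integrated out. -/
lemma lintegral_eq {V : Type*} [MeasurableSpace V] {t : ℕ} {W : Ω → V} (hW : Measurable[ℱ t] W)
    {F : (V × U) × X → ℝ≥0∞} (hF : Measurable F) :
    ∫⁻ ω, F ((W ω, v t ω), y t ω) ∂μ =
      ∫⁻ ω, ∫⁻ x, F ((W ω, v t ω), x) ∂(M.law (v t ω) M.θ₀) ∂μ := by
  have hWv' : Measurable fun ω => (W ω, v t ω) :=
    (hW.prodMk (h.measurable_v t)).mono (ℱ.le t) le_rfl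
  rw [← lintegral_map (f := F) (g := fun ω => ((W ω, v t ω), y t ω)) hF
    (hWv'.prodMk (h.measurable_y' t)), h.map_eq_compProd hW, Measure.lintegral_compProd hF,
    lintegral_map (Measurable.lintegral_kernel_prod_right' hF) hWv']
  rfl

lemma integral_eq {E : Type*} [NormedAddCommGroup E] [NormedSpace ℝ E] [MeasurableSpace E]
    [BorelSpace E] [SecondCountableTopology E]
    {V : Type*} [MeasurableSpace V] {t : ℕ} {W : Ω → V} (hW : Measurable[ℱ t] W)
    {F : (V × U) × X → E} (hF : Measurable F)
    (hint : Integrable (fun ω => F ((W ω, v t ω), y t ω)) μ) :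
    ∫ ω, F ((W ω, v t ω), y t ω) ∂μ =
      ∫ ω, ∫ x, F ((W ω, v t ω), x) ∂(M.law (v t ω) M.θ₀) ∂μ := by
  have hWv' : Measurable fun ω => (W ω, v t ω) :=
    (hW.prodMk (h.measurable_v t)).mono (ℱ.le t) le_rfl
  have hall : Measurable fun ω => ((W ω, v t ω), y t ω) := hWv'.prodMk (h.measurable_y' t)
  have hint' := (integrable_map_measure hF.aestronglyMeasurable hall.aemeasurable).2 hint
  rw [← integral_map (f := F) (φ := fun ω => ((W ω, v t ω), y t ω)) hall.aemeasurable
    hF.aestronglyMeasurable]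
  rw [h.map_eq_compProd hW] at hint' ⊢
  rw [Measure.integral_compProd hint', integral_map hWv'.aemeasurable
    (hF.stronglyMeasurable.integral_kernel_prod_right').aestronglyMeasurable]
  rfl

/-- Peels the last round off a product, given a bound on its conditional mean that holds for every
design; how the design was chosen is then irrelevant. -/
lemma lintegral_mul_obs_le {t : ℕ} {W : Ω → ℝ≥0∞} (hW : Measurable[ℱ t] W) {f : X → U → ℝ≥0∞}
    (hf : Measurable (Function.uncurry f)) {c : ℝ≥0∞}
    (hc : ∀ u, ∫⁻ x, f x u ∂(M.law u M.θ₀) ≤ c) :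
    ∫⁻ ω, W ω * f (y t ω) (v t ω) ∂μ ≤ (∫⁻ ω, W ω ∂μ) * c := by
  have hF : Measurable fun z : (ℝ≥0∞ × U) × X => z.1.1 * f z.2 z.1.2 := by
    have : Measurable fun z : (ℝ≥0∞ × U) × X => f z.2 z.1.2 :=
      hf.comp (measurable_snd.prodMk (measurable_snd.comp measurable_fst))
    fun_prop
  rw [h.lintegral_eq hW hF, ← lintegral_mul_const _ (hW.mono (ℱ.le t) le_rfl)]
  refine lintegral_mono fun ω => ?_
  have hm : Measurable fun x => f x (v t ω) := hf.comp (measurable_id.prodMk measurable_const)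
  simp only
  rw [lintegral_const_mul _ hm]
  gcongr
  exact hc _

lemma lintegral_obs_le (t : ℕ) {f : X → U → ℝ≥0∞}
    (hf : Measurable (Function.uncurry f)) {c : ℝ≥0∞}
    (hc : ∀ u, ∫⁻ x, f x u ∂(M.law u M.θ₀) ≤ c) :
    ∫⁻ ω, f (y t ω) (v t ω) ∂μ ≤ c := by
  simpa using h.lintegral_mul_obs_le (t := t) (W := fun _ => 1) measurable_const hf hc

/-- Markov's inequality for the average of a nonnegative function of the observations. -/
lemma measure_le_sum_obs {f : X → U → ℝ} (hf : Measurable (Function.uncurry f)) {c : ℝ≥0}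
    (hc : ∀ u, ∫⁻ x, ‖f x u‖ₑ ∂(M.law u M.θ₀) ≤ c) {N : ℕ} (hN : 0 < N) {K : ℝ} (hK : 0 < K) :
    μ {ω | K * N ≤ ∑ k ∈ Finset.range N, |f (y k ω) (v k ω)|} ≤ ENNReal.ofReal (c / K) := by
  have hf' : Measurable (Function.uncurry fun x u => ‖f x u‖ₑ) := hf.enorm
  have hsum : ∫⁻ ω, ∑ k ∈ Finset.range N, ‖f (y k ω) (v k ω)‖ₑ ∂μ ≤ N * c := by
    rw [lintegral_finsetSum _ fun k _ => h.measurable_obs' hf' k]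
    calc _ ≤ ∑ k ∈ Finset.range N, (c : ℝ≥0∞) :=
          Finset.sum_le_sum fun k _ => h.lintegral_obs_le k hf' hc
      _ = _ := by simp
  have hmeas : Measurable fun ω => ∑ k ∈ Finset.range N, ‖f (y k ω) (v k ω)‖ₑ :=
    Finset.measurable_sum (Finset.range N) fun k _ => h.measurable_obs' hf' k
  have hKN : 0 < K * N := by positivity
  have hset : {ω | K * N ≤ ∑ k ∈ Finset.range N, |f (y k ω) (v k ω)|} ⊆
      {ω | ENNReal.ofReal (K * N) ≤ ∑ k ∈ Finset.range N, ‖f (y k ω) (v k ω)‖ₑ} := by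
    intro ω hω
    simp only [Set.mem_ofPred_eq] at hω ⊢
    refine (ENNReal.ofReal_le_ofReal hω).trans ?_
    rw [ENNReal.ofReal_sum_of_nonneg fun _ _ => abs_nonneg _]
    exact le_of_eq (Finset.sum_congr rfl fun k _ => by rw [← Real.norm_eq_abs, ofReal_norm])
  refine (measure_mono hset).trans ((meas_ge_le_lintegral_div hmeas.aemeasurable
    (by simpa using hKN) (by simp)).trans ?_)
  refine (ENNReal.div_le_div_right hsum _).trans ?_
  rw [← ENNReal.ofReal_natCast, ← ENNReal.ofReal_coe_nnreal, ← ENNReal.ofReal_mul (by positivity),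
    ← ENNReal.ofReal_div_of_pos hKN]
  refine ENNReal.ofReal_le_ofReal (le_of_eq ?_)
  field_simp

end IsDesign
end RegularModel
end Stackelberg

/-! ### Weak laws of large numbers and the expected root likelihood ratio. -/

namespace Stackelberg
namespace RegularModel

variable {X U : Type*} [MeasurableSpace X] [MetricSpace U] [MeasurableSpace U] [BorelSpace U]
  [SecondCountableTopology U] {m : ℕ} {M : RegularModel X U m} [SFinite M.ν]

namespace IsDesign

variable {Ω : Type*} {mΩ : MeasurableSpace Ω} {μ : Measure Ω} [IsProbabilityMeasure μ]
  {ℱ : Filtration ℕ mΩ} {v : ℕ → Ω → U} {y : ℕ → Ω → X} (h : M.IsDesign μ ℱ v y)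

omit [SFinite M.ν] [BorelSpace U] [SecondCountableTopology U] in
lemma abs_mean_le {g : X → U → ℝ} {K : ℝ} (hK : ∀ x u, |g x u| ≤ K) (u : U) :
    |M.mean g u| ≤ K := by
  have := norm_integral_le_of_norm_le_const (μ := M.law u M.θ₀) (C := K) (f := fun x => g x u)
    (ae_of_all _ fun x => hK x u)
  simpa [mean] using this

include h

/-- A bound on the second moment of a sum of bounded centered observations. -/
lemma integral_sq_sum_le {g : X → U → ℝ} (hg : Measurable (Function.uncurry g)) {K : ℝ}
    (hK : ∀ x u, |g x u| ≤ K) (N : ℕ) :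
    ∫ ω, (∑ k ∈ Finset.range N, (g (y k ω) (v k ω) - M.mean g (v k ω))) ^ 2 ∂μ
      ≤ N * (2 * K) ^ 2 := by
  have hgm := M.measurable_mean hg
  have hmeas : ∀ n, Measurable[ℱ n] fun ω =>
      ∑ k ∈ Finset.range n, (g (y k ω) (v k ω) - M.mean g (v k ω)) := fun n =>
    Finset.measurable_sum _ fun k hk => by
      have hkn : k + 1 ≤ n := Finset.mem_range.1 hk
      exact ((h.measurable_obs hg k).mono (ℱ.mono hkn) le_rfl).sub
        (hgm.comp ((h.measurable_v k).mono (ℱ.mono (k.le_succ.trans hkn)) le_rfl))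
  have hdiff : ∀ x u, |g x u - M.mean g u| ≤ 2 * K := fun x u =>
    (abs_sub _ _).trans (by linarith [hK x u, abs_mean_le (M := M) hK u])
  have hS : ∀ n ω, |∑ k ∈ Finset.range n, (g (y k ω) (v k ω) - M.mean g (v k ω))| ≤ n * (2 * K) :=
    fun n ω => (Finset.abs_sum_le_sum_abs _ _).trans
      ((Finset.sum_le_sum fun k _ => hdiff _ _).trans (by simp))
  have hY : ∀ n, Measurable fun ω => g (y n ω) (v n ω) - M.mean g (v n ω) := fun n =>
    (h.measurable_obs' hg n).sub (hgm.comp (h.measurable_v' n))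
  induction N with
  | zero => simp
  | succ n ih =>
    have hSm := (hmeas n).mono (ℱ.le n) le_rfl
    have i1 : Integrable (fun ω =>
        (∑ k ∈ Finset.range n, (g (y k ω) (v k ω) - M.mean g (v k ω))) ^ 2) μ := by
      refine Integrable.of_bound (hSm.pow_const 2).aestronglyMeasurable ((n * (2 * K)) ^ 2)
        (ae_of_all _ fun ω => ?_)
      rw [norm_pow, Real.norm_eq_abs]
      exact pow_le_pow_left₀ (abs_nonneg _) (hS n ω) 2
    have i2 : Integrable (fun ω =>
        (∑ k ∈ Finset.range n, (g (y k ω) (v k ω) - M.mean g (v k ω))) *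
          (g (y n ω) (v n ω) - M.mean g (v n ω))) μ := by
      refine Integrable.of_bound (hSm.mul (hY n)).aestronglyMeasurable ((n * (2 * K)) * (2 * K))
        (ae_of_all _ fun ω => ?_)
      rw [norm_mul, Real.norm_eq_abs, Real.norm_eq_abs]
      exact mul_le_mul (hS n ω) (hdiff _ _) (abs_nonneg _) ((abs_nonneg _).trans (hS n ω))
    have i3 : Integrable (fun ω => (g (y n ω) (v n ω) - M.mean g (v n ω)) ^ 2) μ := by
      refine Integrable.of_bound ((hY n).pow_const 2).aestronglyMeasurable ((2 * K) ^ 2)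
        (ae_of_all _ fun ω => ?_)
      rw [norm_pow, Real.norm_eq_abs]
      exact pow_le_pow_left₀ (abs_nonneg _) (hdiff _ _) 2
    -- Orthogonality of martingale differences: given the past and the design, the new centred term
    -- has mean zero while the earlier sum is fixed.
    have hcross : ∫ ω, (∑ k ∈ Finset.range n, (g (y k ω) (v k ω) - M.mean g (v k ω))) *
          (g (y n ω) (v n ω) - M.mean g (v n ω)) ∂μ = 0 := by
      have hF : Measurable fun z : (ℝ × U) × X => z.1.1 * (g z.2 z.1.2 - M.mean g z.1.2) := by
        have h1 : Measurable fun z : (ℝ × U) × X => g z.2 z.1.2 :=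
          hg.comp (measurable_snd.prodMk (measurable_snd.comp measurable_fst))
        have h2 : Measurable fun z : (ℝ × U) × X => M.mean g z.1.2 :=
          hgm.comp (measurable_snd.comp measurable_fst)
        fun_prop
      rw [h.integral_eq (hmeas n) hF i2]
      refine integral_eq_zero_of_ae (ae_of_all _ fun ω => ?_)
      have hgi : Integrable (fun x => g x (v n ω)) (M.law (v n ω) M.θ₀) :=
        Integrable.of_bound (hg.comp (measurable_id.prodMk measurable_const)).aestronglyMeasurable K
          (ae_of_all _ fun x => hK _ _)
      simp only [integral_const_mul, integral_sub hgi (integrable_const _), integral_const,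
        probReal_univ, one_smul, mean, sub_self, mul_zero, Pi.zero_apply]
    have hsq : ∫ ω, (g (y n ω) (v n ω) - M.mean g (v n ω)) ^ 2 ∂μ ≤ (2 * K) ^ 2 := by
      have := integral_mono i3 (integrable_const ((2 * K) ^ 2)) fun ω => by
        rw [← sq_abs]
        exact pow_le_pow_left₀ (abs_nonneg _) (hdiff _ _) 2
      simpa using this
    have hexp : ∀ ω, (∑ k ∈ Finset.range (n + 1), (g (y k ω) (v k ω) - M.mean g (v k ω))) ^ 2 =
        (∑ k ∈ Finset.range n, (g (y k ω) (v k ω) - M.mean g (v k ω))) ^ 2 +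
        2 * ((∑ k ∈ Finset.range n, (g (y k ω) (v k ω) - M.mean g (v k ω))) *
          (g (y n ω) (v n ω) - M.mean g (v n ω))) +
        (g (y n ω) (v n ω) - M.mean g (v n ω)) ^ 2 := fun ω => by
      rw [Finset.sum_range_succ]; ring
    simp_rw [hexp]
    rw [integral_add (by exact i1.add (i2.const_mul 2)) i3, integral_add i1 (i2.const_mul 2),
      integral_const_mul, hcross]
    push_cast
    linarith

/-- Chebyshev's inequality; each centred term is at most `2 * K`, hence the second moment `N * (2 *
K) ^ 2` and the factor `4`. -/
lemma measure_le_abs_sum_le_of_bounded {g : X → U → ℝ} (hg : Measurable (Function.uncurry g))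
    {K : ℝ} (hK : ∀ x u, |g x u| ≤ K) {N : ℕ} (hN : 0 < N) {η : ℝ} (hη : 0 < η) :
    μ {ω | η * N ≤ |∑ k ∈ Finset.range N, (g (y k ω) (v k ω) - M.mean g (v k ω))|}
      ≤ ENNReal.ofReal (4 * K ^ 2 / (η ^ 2 * N)) := by
  have hgm := M.measurable_mean hg
  have hm : Measurable fun ω => ∑ k ∈ Finset.range N, (g (y k ω) (v k ω) - M.mean g (v k ω)) :=
    Finset.measurable_sum _ fun k _ =>
      (h.measurable_obs' hg k).sub (hgm.comp (h.measurable_v' k))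
  have hηN : 0 < (η * N) ^ 2 := by positivity
  have hset : {ω | η * N ≤ |∑ k ∈ Finset.range N, (g (y k ω) (v k ω) - M.mean g (v k ω))|} ⊆
      {ω | ENNReal.ofReal ((η * N) ^ 2) ≤ ENNReal.ofReal
        ((∑ k ∈ Finset.range N, (g (y k ω) (v k ω) - M.mean g (v k ω))) ^ 2)} := by
    intro ω hω
    refine ENNReal.ofReal_le_ofReal ?_
    rw [← sq_abs (∑ k ∈ Finset.range N, (g (y k ω) (v k ω) - M.mean g (v k ω)))]
    exact pow_le_pow_left₀ (by positivity) hω 2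
  refine (measure_mono hset).trans ((meas_ge_le_lintegral_div
    (hm.pow_const 2).ennreal_ofReal.aemeasurable (ENNReal.ofReal_pos.2 hηN).ne' (by simp)).trans ?_)
  have hdiff : ∀ x u, |g x u - M.mean g u| ≤ 2 * K := fun x u =>
    (abs_sub _ _).trans (by linarith [hK x u, abs_mean_le (M := M) hK u])
  have hint : Integrable (fun ω =>
      (∑ k ∈ Finset.range N, (g (y k ω) (v k ω) - M.mean g (v k ω))) ^ 2) μ := by
    refine Integrable.of_bound (hm.pow_const 2).aestronglyMeasurable ((N * (2 * K)) ^ 2)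
      (ae_of_all _ fun ω => ?_)
    rw [norm_pow, Real.norm_eq_abs]
    refine pow_le_pow_left₀ (abs_nonneg _) ((Finset.abs_sum_le_sum_abs _ _).trans
      ((Finset.sum_le_sum fun k _ => hdiff _ _).trans (by simp))) 2
  rw [← ofReal_integral_eq_lintegral_ofReal hint (ae_of_all _ fun ω => sq_nonneg _),
    ← ENNReal.ofReal_div_of_pos hηN]
  refine ENNReal.ofReal_le_ofReal ?_
  refine (div_le_div_of_nonneg_right (h.integral_sq_sum_le hg hK N) hηN.le).trans (le_of_eq ?_)
  field_simp
  ring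

/-- Markov's inequality without any cancellation, meant for the small part left by truncation.
Centring at most doubles the `L¹` norm, hence `2 * c`. -/
lemma measure_le_abs_sum_le_of_integral {f : X → U → ℝ} (hf : Measurable (Function.uncurry f))
    {c : ℝ} (hint : ∀ u, Integrable (fun x => f x u) (M.law u M.θ₀))
    (hc : ∀ u, ∫ x, |f x u| ∂(M.law u M.θ₀) ≤ c) {N : ℕ} (hN : 0 < N) {η : ℝ} (hη : 0 < η) :
    μ {ω | η * N ≤ |∑ k ∈ Finset.range N, (f (y k ω) (v k ω) - M.mean f (v k ω))|}
      ≤ ENNReal.ofReal (2 * c / η) := by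
  -- A sample point supplies some design at which `0 ≤ c` can be read off.
  obtain ⟨ω₀⟩ : Nonempty Ω := nonempty_of_isProbabilityMeasure μ
  have hc0 : 0 ≤ c := (integral_nonneg fun x => abs_nonneg _).trans (hc (v 0 ω₀))
  have hmean : ∀ u, |M.mean f u| ≤ c := fun u => (abs_integral_le_integral_abs).trans (hc u)
  have hfm := M.measurable_mean hf
  have hg : Measurable (Function.uncurry fun x u => f x u - M.mean f u) :=
    hf.sub (hfm.comp measurable_snd)
  have hb : ∀ u, ∫⁻ x, ‖f x u - M.mean f u‖ₑ ∂(M.law u M.θ₀) ≤ ((2 * c).toNNReal : ℝ≥0∞) := by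
    intro u
    have hi : Integrable (fun x => f x u - M.mean f u) (M.law u M.θ₀) :=
      (hint u).sub (integrable_const _)
    rw [← ofReal_integral_norm_eq_lintegral_enorm hi]
    refine ENNReal.ofReal_le_ofReal ?_
    calc ∫ x, ‖f x u - M.mean f u‖ ∂(M.law u M.θ₀)
        ≤ ∫ x, (|f x u| + c) ∂(M.law u M.θ₀) := by
          refine integral_mono hi.norm ((hint u).abs.add (integrable_const c)) fun x => ?_
          exact (abs_sub _ _).trans (by gcongr; exact hmean u)
      _ ≤ 2 * c := by
          rw [integral_add (hint u).abs (integrable_const c)]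
          simp only [integral_const, probReal_univ, smul_eq_mul, one_mul]
          linarith [hc u]
  refine le_trans (measure_mono ?_) ((h.measure_le_sum_obs hg hb hN hη).trans (le_of_eq ?_))
  · intro ω hω
    exact le_trans (Set.mem_ofPred_eq ▸ hω) (Finset.abs_sum_le_sum_abs _ _)
  · rw [Real.coe_toNNReal _ (by positivity)]

/-- **Weak law of large numbers** with a rate, for functions with a bounded moment of order
`a ≥ 1`. -/
theorem measure_le_abs_sum_le {f : X → U → ℝ} (hf : Measurable (Function.uncurry f)) {a : ℝ}
    (ha : 1 ≤ a) {C : ℝ≥0} (hC : ∀ u, ∫⁻ x, ‖f x u‖ₑ ^ a ∂(M.law u M.θ₀) ≤ C)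
    {N : ℕ} (hN : 0 < N) {η : ℝ} (hη : 0 < η) {K : ℝ} (hK : 0 < K) :
    μ {ω | η * N ≤ |∑ k ∈ Finset.range N, (f (y k ω) (v k ω) - M.mean f (v k ω))|}
      ≤ ENNReal.ofReal (16 * K ^ 2 / (η ^ 2 * N) + 4 * C * K ^ (1 - a) / η) := by
  have hfu : ∀ u, Measurable fun x => f x u := fun u =>
    hf.comp (measurable_id.prodMk measurable_const)
  have hg : Measurable (Function.uncurry fun x u => clip K (f x u)) :=
    (continuous_clip K).measurable.comp hf
  have hr : Measurable (Function.uncurry fun x u => f x u - clip K (f x u)) := hf.sub hg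
  have hi := fun u => integrable_of_moment (hfu u) ha (hC u)
  have hgi := fun u => integrable_clip (P := M.law u M.θ₀) (hfu u) hK.le
  -- The clipped part and the excess over level `K` are each allowed `η / 2`; this is the source of
  -- the constants `16` and `4`.
  have h1 := h.measure_le_abs_sum_le_of_bounded hg (K := K) (fun x u => abs_clip_le hK.le _) hN
    (half_pos hη)
  have h2 := h.measure_le_abs_sum_le_of_integral hr (fun u => (hi u).sub (hgi u))
    (fun u => integral_abs_sub_clip_le (hfu u) ha (hC u) hK) hN (half_pos hη)
  refine le_trans (measure_mono ?_) ((measure_union_le _ _).trans ((add_le_add h1 h2).trans ?_))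
  · intro ω hω
    by_contra hcon
    simp only [Set.mem_union, Set.mem_ofPred_eq, not_or, not_le] at hcon
    have hω' : η * N ≤ |∑ k ∈ Finset.range N, (f (y k ω) (v k ω) - M.mean f (v k ω))| := hω
    have hsplit : ∑ k ∈ Finset.range N, (f (y k ω) (v k ω) - M.mean f (v k ω)) =
        ∑ k ∈ Finset.range N, (clip K (f (y k ω) (v k ω)) -
          M.mean (fun x u => clip K (f x u)) (v k ω)) +
        ∑ k ∈ Finset.range N, (f (y k ω) (v k ω) - clip K (f (y k ω) (v k ω)) -
          M.mean (fun x u => f x u - clip K (f x u)) (v k ω)) := by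
      rw [← Finset.sum_add_distrib]
      refine Finset.sum_congr rfl fun k _ => ?_
      simp only [mean]
      rw [integral_sub (hi _) (hgi _)]
      ring
    rw [hsplit] at hω'
    linarith [abs_add_le (∑ k ∈ Finset.range N, (clip K (f (y k ω) (v k ω)) -
          M.mean (fun x u => clip K (f x u)) (v k ω)))
        (∑ k ∈ Finset.range N, (f (y k ω) (v k ω) - clip K (f (y k ω) (v k ω)) -
          M.mean (fun x u => f x u - clip K (f x u)) (v k ω)))]
  · rw [← ENNReal.ofReal_add (by positivity) (by positivity)]
    refine ENNReal.ofReal_le_ofReal (le_of_eq ?_)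
    field_simp
    ring

/-- The expected square root of the likelihood ratio is at most the product of the affinities. -/
lemma lintegral_exp_half_sum_le {θ : EuclideanSpace ℝ (Fin m)} (hθ : θ ∈ M.Θ) {ρ : ℝ}
    (hρ : ∀ u, M.affinity u θ ≤ ρ) (N : ℕ) :
    ∫⁻ ω, ENNReal.ofReal (Real.exp ((∑ k ∈ Finset.range N,
      (M.φ (y k ω) (v k ω) θ - M.φ (y k ω) (v k ω) M.θ₀)) / 2)) ∂μ ≤ ENNReal.ofReal ρ ^ N := by
  have hφ : Measurable (Function.uncurry fun x u => M.φ x u θ - M.φ x u M.θ₀) :=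
    (M.measurable_uncurry_φ hθ).sub (M.measurable_uncurry_φ M.mem_Θ)
  induction N with
  | zero => simp
  | succ n ih =>
    have hW : Measurable[ℱ n] fun ω => ENNReal.ofReal (Real.exp ((∑ k ∈ Finset.range n,
      (M.φ (y k ω) (v k ω) θ - M.φ (y k ω) (v k ω) M.θ₀)) / 2)) := by
      refine ((Finset.measurable_sum _ fun k hk => ?_).div_const 2).exp.ennreal_ofReal
      exact (h.measurable_obs hφ k).mono (ℱ.mono (Finset.mem_range.1 hk)) le_rfl
    have hf : Measurable (Function.uncurry fun x u =>
        ENNReal.ofReal (Real.exp ((M.φ x u θ - M.φ x u M.θ₀) / 2))) :=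
      (hφ.div_const 2).exp.ennreal_ofReal
    -- Given the past, the factor of the newest round has as mean the affinity at the chosen design.
    have := h.lintegral_mul_obs_le hW hf (c := ENNReal.ofReal ρ) fun u => by
      rw [← ofReal_integral_eq_lintegral_ofReal (M.integrable_exp_half u hθ)
        (ae_of_all _ fun x => (Real.exp_pos _).le)]
      exact ENNReal.ofReal_le_ofReal (hρ u)
    rw [pow_succ]
    refine le_trans (le_of_eq (lintegral_congr fun ω => ?_)) (this.trans (mul_le_mul_left ih _))
    rw [← ENNReal.ofReal_mul (Real.exp_pos _).le, ← Real.exp_add, Finset.sum_range_succ, add_div]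

end IsDesign
end RegularModel
end Stackelberg

/-! ### Stability of maximizers and consistency of the likelihood estimate. -/

namespace Stackelberg

lemma tendsto_zero_of_forall_le_ofReal {ι : Type*} {l : Filter ι} {f : ι → ℝ≥0∞}
    (hf : ∀ e : ℝ, 0 < e → ∀ᶠ i in l, f i ≤ ENNReal.ofReal e) : Tendsto f l (𝓝 0) := by
  refine ENNReal.tendsto_nhds_zero.2 fun e he => ?_
  obtain ⟨r, hr0, hr⟩ := ENNReal.lt_iff_exists_nnreal_btwn.1 he
  filter_upwards [hf r (by simpa using hr0)] with i hi
  rw [ENNReal.ofReal_coe_nnreal] at hi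
  exact hi.trans hr.le

/-- Maximizers of a continuous function depend continuously on the parameter at points where the
maximizer is unique. -/
lemma exists_dist_maximizer_lt {U E : Type*} [MetricSpace U] [CompactSpace U] [PseudoMetricSpace E]
    {Θ : Set E} (hΘ : IsCompact Θ) {θ₀ : E} (hθ₀ : θ₀ ∈ Θ) {H : U → E → ℝ}
    (hH : ContinuousOn (fun z : U × E => H z.1 z.2) (Set.univ ×ˢ Θ)) {u₀ : U}
    (huniq : ∀ u, u ≠ u₀ → H u θ₀ < H u₀ θ₀) {ε : ℝ} (hε : 0 < ε) :
    ∃ δ > 0, ∀ θ ∈ Θ, dist θ θ₀ < δ → ∀ u, H u₀ θ ≤ H u θ → dist u u₀ < ε := by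
  -- By compactness the values at `θ₀` away from `u₀` stay `2 * γ` below the maximum. Uniform
  -- continuity changes each value by less than `γ`, so no such point can reach the value at `u₀`
  -- when `θ` is close to `θ₀`.
  have hgap : ∃ γ > 0, ∀ u, ε ≤ dist u u₀ → H u θ₀ + 2 * γ ≤ H u₀ θ₀ := by
    rcases {u : U | ε ≤ dist u u₀}.eq_empty_or_nonempty with he | hne
    · refine ⟨1, one_pos, fun u hu => ?_⟩
      have : u ∈ {u : U | ε ≤ dist u u₀} := hu
      rw [he] at this
      exact this.elim
    · have hc : IsCompact {u : U | ε ≤ dist u u₀} :=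
        (isClosed_le continuous_const (by fun_prop)).isCompact
      have hcont : Continuous fun u => H u θ₀ := by
        have := hH.comp_continuous (f := fun u : U => (u, θ₀)) (by fun_prop)
          (fun u => ⟨trivial, hθ₀⟩)
        exact this
      obtain ⟨u₁, hu₁, hmax⟩ := hc.exists_isMaxOn hne hcont.continuousOn
      have hne1 : u₁ ≠ u₀ := by
        rintro rfl
        have : ε ≤ dist u₁ u₁ := hu₁
        rw [dist_self] at this
        linarith
      refine ⟨(H u₀ θ₀ - H u₁ θ₀) / 2, by linarith [huniq u₁ hne1], fun u hu => ?_⟩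
      have := isMaxOn_iff.1 hmax u hu
      linarith
  obtain ⟨γ, hγ, hgap⟩ := hgap
  have hunif := (isCompact_univ.prod hΘ).uniformContinuousOn_of_continuous hH
  obtain ⟨δ, hδ, hclose⟩ := Metric.uniformContinuousOn_iff.1 hunif γ hγ
  refine ⟨δ, hδ, fun θ hθ hd u hu => ?_⟩
  by_contra! hcon
  have hcl : ∀ u', |H u' θ - H u' θ₀| < γ := fun u' => by
    have := hclose (u', θ) ⟨trivial, hθ⟩ (u', θ₀) ⟨trivial, hθ₀⟩ (by
      simpa [Prod.dist_eq] using hd)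
    rwa [Real.dist_eq] at this
  have h1 := abs_lt.1 (hcl u)
  have h2 := abs_lt.1 (hcl u₀)
  linarith [hgap u hcon]

namespace RegularModel

variable {X U : Type*} [MeasurableSpace X] [MetricSpace U] [MeasurableSpace U] {m : ℕ}
  (M : RegularModel X U m)

lemma abs_φ_sub_le (x : X) (u : U) {θ θ' : EuclideanSpace ℝ (Fin m)} (hθ : θ ∈ M.Θ)
    (hθ' : θ' ∈ M.Θ) : |M.φ x u θ - M.φ x u θ'| ≤ M.L x u * ‖θ - θ'‖ :=
  M.convex.norm_image_sub_le_of_norm_hasFDerivWithin_le (f := M.φ x u)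
    (fun z hz => M.hasFDerivWithinAt x u z hz)
    (fun z hz => by rw [innerSL_apply_norm]; exact M.norm_s_le x u z hz) hθ' hθ

lemma lintegral_L_le (u : U) : ∫⁻ x, ‖M.L x u‖ₑ ∂(M.law u M.θ₀) ≤ (1 + M.C : ℝ≥0) := by
  calc ∫⁻ x, ‖M.L x u‖ₑ ∂(M.law u M.θ₀)
      ≤ ∫⁻ x, (1 + ‖M.L x u‖ₑ ^ (2 : ℝ)) ∂(M.law u M.θ₀) := by
        refine lintegral_mono fun x => ?_
        rcases le_total ‖M.L x u‖ₑ 1 with h | h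
        · exact h.trans le_self_add
        · refine le_trans ?_ le_add_self
          conv_lhs => rw [← ENNReal.rpow_one ‖M.L x u‖ₑ]
          exact ENNReal.rpow_le_rpow_of_exponent_le h (by norm_num)
    _ ≤ _ := by
        rw [lintegral_add_left measurable_const, lintegral_one, measure_univ, ENNReal.coe_add,
          ENNReal.coe_one]
        exact add_le_add le_rfl (M.second_moment u _ M.mem_Θ)

lemma lintegral_B_le (u : U) : ∫⁻ x, ‖M.B x u‖ₑ ∂(M.law u M.θ₀) ≤ (1 + M.C : ℝ≥0) := by
  calc ∫⁻ x, ‖M.B x u‖ₑ ∂(M.law u M.θ₀)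
      ≤ ∫⁻ x, (1 + ‖M.B x u‖ₑ ^ (1 + M.δ)) ∂(M.law u M.θ₀) := by
        refine lintegral_mono fun x => ?_
        rcases le_total ‖M.B x u‖ₑ 1 with h | h
        · exact h.trans le_self_add
        · refine le_trans ?_ le_add_self
          conv_lhs => rw [← ENNReal.rpow_one ‖M.B x u‖ₑ]
          exact ENNReal.rpow_le_rpow_of_exponent_le h (by linarith [M.δ_pos])
    _ ≤ _ := by
        rw [lintegral_add_left measurable_const, lintegral_one, measure_univ, ENNReal.coe_add,
          ENNReal.coe_one]
        exact add_le_add le_rfl (M.moment_B u)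

namespace IsDesign

variable {M} [BorelSpace U] [SecondCountableTopology U] [SFinite M.ν]
  {Ω : Type*} {mΩ : MeasurableSpace Ω} {μ : Measure Ω} [IsProbabilityMeasure μ]
  {ℱ : Filtration ℕ mΩ} {v : ℕ → Ω → U} {y : ℕ → Ω → X} (h : M.IsDesign μ ℱ v y)

include h

/-- Markov's inequality for the square root of the likelihood ratio. The slack `η` per round, which
costs the factor `exp (η / 2)`, is what passing from a net point to its neighbours consumes. -/
lemma measure_likelihood_ge_le {θ : EuclideanSpace ℝ (Fin m)} (hθ : θ ∈ M.Θ) {ρ : ℝ} (hρ0 : 0 ≤ ρ)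
    (hρ : ∀ u, M.affinity u θ ≤ ρ) (η : ℝ) (N : ℕ) :
    μ {ω | -(η * N) ≤ ∑ k ∈ Finset.range N,
      (M.φ (y k ω) (v k ω) θ - M.φ (y k ω) (v k ω) M.θ₀)} ≤
      ENNReal.ofReal ((ρ * Real.exp (η / 2)) ^ N) := by
  have hφ : Measurable (Function.uncurry fun x u => M.φ x u θ - M.φ x u M.θ₀) :=
    (M.measurable_uncurry_φ hθ).sub (M.measurable_uncurry_φ M.mem_Θ)
  have hm : Measurable fun ω => ENNReal.ofReal (Real.exp ((∑ k ∈ Finset.range N,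
      (M.φ (y k ω) (v k ω) θ - M.φ (y k ω) (v k ω) M.θ₀)) / 2)) :=
    ((Finset.measurable_sum _ fun k _ => h.measurable_obs' hφ k).div_const 2).exp.ennreal_ofReal
  have hpos : 0 < Real.exp (-(η * N) / 2) := Real.exp_pos _
  calc _ ≤ μ {ω | ENNReal.ofReal (Real.exp (-(η * N) / 2)) ≤ ENNReal.ofReal (Real.exp
        ((∑ k ∈ Finset.range N, (M.φ (y k ω) (v k ω) θ - M.φ (y k ω) (v k ω) M.θ₀)) / 2))} := by
        refine measure_mono fun ω hω => ENNReal.ofReal_le_ofReal (Real.exp_le_exp.2 ?_)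
        have hω' := Set.mem_ofPred_eq ▸ hω
        linarith
    _ ≤ _ := (meas_ge_le_lintegral_div hm.aemeasurable (ENNReal.ofReal_pos.2 hpos).ne' (by simp))
    _ ≤ ENNReal.ofReal ρ ^ N / ENNReal.ofReal (Real.exp (-(η * N) / 2)) :=
        ENNReal.div_le_div_right (h.lintegral_exp_half_sum_le hθ hρ N) _
    _ = _ := by
        rw [← ENNReal.ofReal_pow hρ0, ← ENNReal.ofReal_div_of_pos hpos, mul_pow, div_eq_mul_inv,
          ← Real.exp_neg, ← Real.exp_nat_mul]
        congr 3
        ring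

/-- With probability tending to one, no parameter away from `θ₀` has a likelihood as large
as `θ₀`. -/
theorem tendsto_measure_exists_far [CompactSpace U] {ε : ℝ} (hε : 0 < ε) :
    Tendsto (fun N : ℕ => μ {ω | ∃ θ ∈ M.Θ, ε ≤ ‖θ - M.θ₀‖ ∧
      ∑ k ∈ Finset.range N, M.φ (y k ω) (v k ω) M.θ₀ ≤
        ∑ k ∈ Finset.range N, M.φ (y k ω) (v k ω) θ}) atTop (𝓝 0) := by
  obtain ⟨ρ, hρ0, hρ1, hρ⟩ := M.exists_affinity_le hε
  -- With this slack each net point still has a geometrically small probability of a competitive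
  -- likelihood.
  obtain ⟨η, hη, hκ⟩ : ∃ η : ℝ, 0 < η ∧ ρ * Real.exp (η / 2) < 1 := by
    have ht : Tendsto (fun η : ℝ => ρ * Real.exp (η / 2)) (𝓝[>] 0) (𝓝 (ρ * Real.exp (0 / 2))) :=
      (Continuous.tendsto (by fun_prop) 0).mono_left nhdsWithin_le_nhds
    rw [zero_div, Real.exp_zero, mul_one] at ht
    obtain ⟨η, h1, h2⟩ := ((ht.eventually_lt_const hρ1).and self_mem_nhdsWithin).exists
    exact ⟨η, h2, h1⟩
  refine tendsto_zero_of_forall_le_ofReal fun e he => ?_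
  set c : ℝ≥0 := 1 + M.C
  have hc : 0 < (c : ℝ) := by positivity
  -- Markov's inequality gives the event that the envelopes sum to at least `K * N` a probability of
  -- at most `c / K = e / 2`. Off that event, moving by less than `η / K` changes the log-likelihood
  -- by at most `η * N`, which dictates the mesh of the net.
  set K : ℝ := 2 * c / e
  have hK : 0 < K := by positivity
  obtain ⟨t, htsub, htfin, hcover⟩ := (M.isCompact.diff
    (Metric.isOpen_ball (x := M.θ₀) (ε := ε))).finite_cover_balls (e := η / K) (by positivity)
  have hlim : Tendsto (fun N : ℕ => htfin.toFinset.card * (ρ * Real.exp (η / 2)) ^ N) atTop (𝓝 0) := by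
    have := (tendsto_pow_atTop_nhds_zero_of_lt_one (by positivity) hκ).const_mul
      (htfin.toFinset.card : ℝ)
    simpa using this
  filter_upwards [hlim.eventually_le_const (half_pos he), eventually_gt_atTop 0] with N hN hN0
  have hsub : {ω | ∃ θ ∈ M.Θ, ε ≤ ‖θ - M.θ₀‖ ∧ ∑ k ∈ Finset.range N, M.φ (y k ω) (v k ω) M.θ₀ ≤
        ∑ k ∈ Finset.range N, M.φ (y k ω) (v k ω) θ} ⊆
      {ω | K * N ≤ ∑ k ∈ Finset.range N, |M.L (y k ω) (v k ω)|} ∪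
      ⋃ θ ∈ htfin.toFinset, {ω | -(η * N) ≤ ∑ k ∈ Finset.range N,
        (M.φ (y k ω) (v k ω) θ - M.φ (y k ω) (v k ω) M.θ₀)} := by
    rintro ω ⟨θ, hθ, hfar, hle⟩
    by_cases hL : K * N ≤ ∑ k ∈ Finset.range N, |M.L (y k ω) (v k ω)|
    · exact Or.inl hL
    · right
      obtain ⟨θ', hθ't, hball⟩ := Set.mem_iUnion₂.1 (hcover ⟨hθ, by
        rw [Metric.mem_ball, dist_eq_norm]; linarith⟩)
      refine Set.mem_iUnion₂.2 ⟨θ', by simpa using hθ't, ?_⟩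
      rw [Metric.mem_ball, dist_eq_norm] at hball
      have hd : ∑ k ∈ Finset.range N, (M.φ (y k ω) (v k ω) θ - M.φ (y k ω) (v k ω) θ') ≤ η * N := by
        calc _ ≤ ∑ k ∈ Finset.range N, |M.L (y k ω) (v k ω)| * (η / K) := by
              refine Finset.sum_le_sum fun k _ => (le_abs_self _).trans
                ((M.abs_φ_sub_le _ _ hθ (htsub hθ't).1).trans ?_)
              exact mul_le_mul (le_abs_self _) hball.le (norm_nonneg _) (abs_nonneg _)
          _ ≤ (K * N) * (η / K) := by
              rw [← Finset.sum_mul]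
              gcongr
              exact (not_le.1 hL).le
          _ = η * N := by field_simp
      simp only [Set.mem_ofPred_eq]
      rw [Finset.sum_sub_distrib] at hd ⊢
      linarith
  have h1 : μ {ω | K * N ≤ ∑ k ∈ Finset.range N, |M.L (y k ω) (v k ω)|} ≤
      ENNReal.ofReal (e / 2) := by
    refine (h.measure_le_sum_obs M.measurable_uncurry_L M.lintegral_L_le hN0 hK).trans
      (ENNReal.ofReal_le_ofReal (le_of_eq ?_))
    simp only [K, c]
    field_simp
  have h2 : μ (⋃ θ ∈ htfin.toFinset, {ω | -(η * N) ≤ ∑ k ∈ Finset.range N,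
        (M.φ (y k ω) (v k ω) θ - M.φ (y k ω) (v k ω) M.θ₀)}) ≤ ENNReal.ofReal (e / 2) := by
    calc _ ≤ ∑ θ ∈ htfin.toFinset, ENNReal.ofReal ((ρ * Real.exp (η / 2)) ^ N) := by
          refine (measure_biUnion_finset_le _ _).trans (Finset.sum_le_sum fun θ hθ => ?_)
          have hθ' : θ ∈ M.Θ \ Metric.ball M.θ₀ ε := htsub (by simpa using hθ)
          refine h.measure_likelihood_ge_le hθ'.1 hρ0 (fun u => hρ u θ hθ'.1 ?_) η N
          have := hθ'.2
          rw [Metric.mem_ball, dist_eq_norm] at this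
          linarith
      _ ≤ _ := by
          rw [Finset.sum_const, nsmul_eq_mul, ← ENNReal.ofReal_natCast, ← ENNReal.ofReal_mul (by positivity)]
          exact ENNReal.ofReal_le_ofReal hN
  calc _ ≤ _ := measure_mono hsub
    _ ≤ _ := measure_union_le _ _
    _ ≤ _ := add_le_add h1 h2
    _ = _ := by rw [← ENNReal.ofReal_add (by positivity) (by positivity), add_halves]

end IsDesign
end RegularModel
end Stackelberg

/-! ### Martingale central limit theorem by characteristic functions. -/

namespace Stackelberg

section Taylor

open Complex

/-- The Taylor remainder gives this for `|x| ≤ 1`, with `exp |x| ≤ 4`. For `|x| > 1` the terms are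
bounded separately, every lower power being at most `|x| ^ 3`. -/
lemma norm_cexp_sub_taylor_le (x : ℝ) :
    ‖cexp (x * I) - (1 + x * I - x ^ 2 / 2)‖ ≤ 4 * |x| ^ 3 := by
  rcases le_or_gt |x| 1 with h | h
  · have := Complex.norm_exp_sub_sum_le_norm_mul_exp (x * I) 3
    have hs : ∑ k ∈ Finset.range 3, (x * I : ℂ) ^ k / (k.factorial : ℂ) = 1 + x * I - x ^ 2 / 2 := by
      simp [Finset.sum_range_succ, mul_pow, Nat.factorial]
      ring
    rw [hs] at this
    refine this.trans ?_
    simp only [norm_mul, norm_real, Real.norm_eq_abs, norm_I, mul_one]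
    have he : Real.exp |x| ≤ 4 := by
      have := Real.exp_le_exp.2 h
      linarith [Real.exp_one_lt_d9]
    rw [mul_comm]
    gcongr
  · have h1 : ‖cexp (x * I)‖ = 1 := norm_exp_ofReal_mul_I x
    have h2 : ‖(1 + x * I - x ^ 2 / 2 : ℂ)‖ ≤ 1 + |x| + |x| ^ 2 / 2 := by
      refine (norm_sub_le _ _).trans (add_le_add ((norm_add_le _ _).trans ?_) ?_)
      · simp
      · simp
    have h3 := norm_sub_le (cexp (x * I)) (1 + x * I - x ^ 2 / 2)
    have h4 : 1 ≤ |x| ^ 2 := one_le_pow₀ h.le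
    have h5 : |x| ^ 2 ≤ |x| ^ 3 := pow_le_pow_right₀ h.le (by norm_num)
    have h6 : |x| ≤ |x| ^ 2 := by nlinarith
    linarith

/-- Second-order expansion of the characteristic function of a centered variable, compensated by
the exponential of half the variance. -/
lemma norm_integral_cexp_mul_sub_one_le {X : Type*} [MeasurableSpace X] {P : Measure X}
    [IsProbabilityMeasure P] {g : X → ℝ} (hg : Measurable g) {C : ℝ≥0}
    (hC : ∫⁻ x, ‖g x‖ₑ ^ (3 : ℝ) ∂P ≤ C) (hmean : ∫ x, g x ∂P = 0) {c : ℝ}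
    (hvar : ∫ x, g x ^ 2 ∂P ≤ c) {τ : ℝ} (hτ0 : 0 ≤ τ) (hτ1 : τ ≤ 1) :
    ‖(∫ x, cexp ((τ * g x : ℝ) * I) ∂P) * (Real.exp (τ ^ 2 * (∫ x, g x ^ 2 ∂P) / 2) : ℝ) - 1‖
      ≤ Real.exp (c / 2) * (4 * C + c ^ 2) * τ ^ 3 := by
  set σ := ∫ x, g x ^ 2 ∂P with hσ
  have hσ0 : 0 ≤ σ := integral_nonneg fun x => sq_nonneg _
  have hi3 : Integrable (fun x => |g x| ^ (3 : ℝ)) P :=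
    integrable_rpow_of_moment hg (by norm_num) hC
  have hb3 : ∫ x, |g x| ^ (3 : ℝ) ∂P ≤ C := integral_rpow_le_of_moment hg (by norm_num) hC
  have h33 : ∀ x, |g x| ^ (3 : ℝ) = |g x| ^ 3 := fun x => by
    rw [← Real.rpow_natCast]; norm_num
  simp_rw [h33] at hi3 hb3
  have hi1 : Integrable g P := integrable_of_moment hg (by norm_num) hC
  have hi2 : Integrable (fun x => g x ^ 2) P := by
    refine ((integrable_const (1 : ℝ)).add hi3).mono' (hg.pow_const 2).aestronglyMeasurable
      (ae_of_all _ fun x => ?_)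
    rw [norm_pow, Real.norm_eq_abs]
    simp only [Pi.add_apply]
    rcases le_total |g x| 1 with h | h
    · have := pow_le_one₀ (abs_nonneg (g x)) h (n := 2)
      have : 0 ≤ |g x| ^ 3 := by positivity
      linarith
    · have := pow_le_pow_right₀ h (show 2 ≤ 3 by norm_num)
      linarith
  have hexpi : Integrable (fun x => cexp ((τ * g x : ℝ) * I)) P := by
    refine Integrable.of_bound (by fun_prop) 1 (ae_of_all _ fun x => ?_)
    rw [norm_exp_ofReal_mul_I]
  have hpoly : Integrable (fun x => (1 + (τ * g x : ℝ) * I - ((τ * g x : ℝ) : ℂ) ^ 2 / 2 : ℂ)) P := by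
    refine ((integrable_const _).add ((hi1.const_mul τ).ofReal.mul_const I)).sub ?_
    have : Integrable (fun x => (((τ * g x) ^ 2 : ℝ) : ℂ)) P := by
      simp_rw [mul_pow]
      exact (hi2.const_mul _).ofReal
    simpa using this.div_const 2
  have hpi : ∫ x, (1 + (τ * g x : ℝ) * I - ((τ * g x : ℝ) : ℂ) ^ 2 / 2 : ℂ) ∂P =
      ((1 - τ ^ 2 * σ / 2 : ℝ) : ℂ) := by
    have e1 : Integrable (fun x => (1 + (τ * g x : ℝ) * I : ℂ)) P :=
      (integrable_const _).add ((hi1.const_mul τ).ofReal.mul_const I)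
    have e2 : Integrable (fun x => (((τ * g x : ℝ) : ℂ) ^ 2 / 2 : ℂ)) P := by
      have : Integrable (fun x => (((τ * g x) ^ 2 : ℝ) : ℂ)) P := by
        simp_rw [mul_pow]
        exact (hi2.const_mul _).ofReal
      simpa using this.div_const 2
    have e3 : ∀ x, (((τ * g x : ℝ) : ℂ) ^ 2 / 2 : ℂ) = ((τ ^ 2 / 2 * g x ^ 2 : ℝ) : ℂ) := fun x => by
      push_cast; ring
    have e0 : Integrable (fun x => ((τ * g x : ℝ) * I : ℂ)) P :=
      (hi1.const_mul τ).ofReal.mul_const I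
    rw [integral_sub e1 e2, integral_add (integrable_const (1 : ℂ)) e0,
      integral_mul_const, integral_complex_ofReal, integral_const_mul, hmean]
    simp_rw [e3]
    rw [integral_complex_ofReal, integral_const_mul]
    simp only [integral_const, probReal_univ, one_smul, mul_zero, ofReal_zero, zero_mul, add_zero]
    push_cast
    ring
  -- Centring removes the linear term, so only the variance term and the cubic remainder survive.
  have hT : ‖(∫ x, cexp ((τ * g x : ℝ) * I) ∂P) - ((1 - τ ^ 2 * σ / 2 : ℝ) : ℂ)‖ ≤
      4 * C * τ ^ 3 := by
    rw [← hpi, ← integral_sub hexpi hpoly]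
    calc _ ≤ ∫ x, 4 * τ ^ 3 * |g x| ^ 3 ∂P := by
          refine norm_integral_le_of_norm_le (hi3.const_mul _) (ae_of_all _ fun x => ?_)
          refine (norm_cexp_sub_taylor_le _).trans (le_of_eq ?_)
          rw [abs_mul, abs_of_nonneg hτ0]; ring
      _ ≤ _ := by
          rw [integral_const_mul]
          nlinarith [pow_nonneg hτ0 3]
  set z := τ ^ 2 * σ / 2 with hz
  have hz0 : 0 ≤ z := by positivity
  have hc0 : 0 ≤ c := hσ0.trans hvar
  have hzc : z ≤ c / 2 := by
    have : τ ^ 2 ≤ 1 := pow_le_one₀ hτ0 hτ1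
    rw [hz]; nlinarith
  have hzτ : z ≤ c * τ ^ 2 / 2 := by rw [hz]; nlinarith [sq_nonneg τ]
  have hexp : Real.exp z ≤ Real.exp (c / 2) := Real.exp_le_exp.2 hzc
  -- The upper estimate uses `1 - z ≤ exp (-z)`; the lower one uses `1 + z ≤ exp z` and `(1 + z) *
  -- (1 - z + z ^ 2) = 1 + z ^ 3`.
  have hz2 : |(1 - z) * Real.exp z - 1| ≤ z ^ 2 * Real.exp z := by
    have h1 := Real.add_one_le_exp z
    have h2 := Real.add_one_le_exp (-z)
    have h3 : Real.exp (-z) * Real.exp z = 1 := by rw [← Real.exp_add]; simp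
    rw [abs_le]
    constructor
    · nlinarith [sq_nonneg z, pow_nonneg hz0 3, mul_nonneg hz0 hz0, sq_nonneg (z - 1 / 2)]
    · have : (1 - z) * Real.exp z ≤ Real.exp (-z) * Real.exp z := by gcongr; linarith
      have : 0 ≤ z ^ 2 * Real.exp z := by positivity
      linarith
  have hsplit : (∫ x, cexp ((τ * g x : ℝ) * I) ∂P) * (Real.exp z : ℝ) - 1 =
      ((∫ x, cexp ((τ * g x : ℝ) * I) ∂P) - ((1 - z : ℝ) : ℂ)) * (Real.exp z : ℝ) +
        (((1 - z) * Real.exp z - 1 : ℝ) : ℂ) := by push_cast; ring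
  rw [hsplit]
  refine (norm_add_le _ _).trans ?_
  rw [norm_mul, norm_real, norm_real, Real.norm_of_nonneg (Real.exp_pos z).le, Real.norm_eq_abs]
  have hτ43 : τ ^ 4 ≤ τ ^ 3 := pow_le_pow_of_le_one hτ0 hτ1 (by norm_num)
  have hzz : z ^ 2 ≤ c ^ 2 * τ ^ 3 := by
    have : z ^ 2 ≤ (c * τ ^ 2 / 2) ^ 2 := pow_le_pow_left₀ hz0 hzτ 2
    nlinarith [sq_nonneg c, pow_nonneg hτ0 4, pow_nonneg hτ0 3, mul_le_mul_of_nonneg_left hτ43 (sq_nonneg c)]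
  calc _ ≤ 4 * C * τ ^ 3 * Real.exp (c / 2) + (c ^ 2 * τ ^ 3) * Real.exp (c / 2) := by
        gcongr
        exact hz2.trans (by gcongr)
    _ = _ := by ring

end Taylor

namespace RegularModel
namespace IsDesign

variable {X U : Type*} [MeasurableSpace X] [MetricSpace U] [MeasurableSpace U] {m : ℕ}
  {M : RegularModel X U m} [BorelSpace U] [SecondCountableTopology U] [SFinite M.ν]
  {Ω : Type*} {mΩ : MeasurableSpace Ω} {μ : Measure Ω} [IsProbabilityMeasure μ]
  {ℱ : Filtration ℕ mΩ} {v : ℕ → Ω → U} {y : ℕ → Ω → X} (h : M.IsDesign μ ℱ v y)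

open Complex

/-- The fraction of the first `N` rounds in which the design is at distance at least `ε`
from `u₀`. -/
noncomputable def farFraction (v : ℕ → Ω → U) (u₀ : U) (ε : ℝ) (N : ℕ) (ω : Ω) : ℝ :=
  (N : ℝ)⁻¹ * ∑ k ∈ Finset.range N, Set.indicator {ω | ε ≤ dist (v k ω) u₀} (fun _ => (1 : ℝ)) ω

omit [MeasurableSpace U] [BorelSpace U] [SecondCountableTopology U] in
lemma farFraction_nonneg (u₀ : U) (ε : ℝ) (N : ℕ) (ω : Ω) : 0 ≤ farFraction v u₀ ε N ω :=
  mul_nonneg (by positivity) (Finset.sum_nonneg fun k _ => Set.indicator_nonneg (by simp) _)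

omit [MeasurableSpace U] [BorelSpace U] [SecondCountableTopology U] in
/-- Averages over the designs of a bounded function continuous at `u₀`. -/
lemma abs_average_sub_le {ψ : U → ℝ} {u₀ : U} {c η ε : ℝ} (hη0 : 0 ≤ η)
    (hψ : ∀ u, |ψ u - ψ u₀| ≤ c) (hη : ∀ u, dist u u₀ < ε → |ψ u - ψ u₀| ≤ η)
    {N : ℕ} (hN : 0 < N) (ω : Ω) :
    |(N : ℝ)⁻¹ * ∑ k ∈ Finset.range N, ψ (v k ω) - ψ u₀| ≤ η + c * farFraction v u₀ ε N ω := by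
  have hN' : (0 : ℝ) < N := by exact_mod_cast hN
  have hc : 0 ≤ c := (abs_nonneg _).trans (hψ u₀)
  have hterm : ∀ k, |ψ (v k ω) - ψ u₀| ≤
      η + c * Set.indicator {ω | ε ≤ dist (v k ω) u₀} (fun _ => (1 : ℝ)) ω := fun k => by
    by_cases hk : ε ≤ dist (v k ω) u₀
    · rw [Set.indicator_of_mem (by exact hk)]
      linarith [hψ (v k ω)]
    · rw [Set.indicator_of_notMem (by exact hk)]
      simpa using hη _ (not_le.1 hk)
  have heq : (N : ℝ)⁻¹ * ∑ k ∈ Finset.range N, ψ (v k ω) - ψ u₀ =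
      (N : ℝ)⁻¹ * ∑ k ∈ Finset.range N, (ψ (v k ω) - ψ u₀) := by
    rw [Finset.sum_sub_distrib, Finset.sum_const, Finset.card_range, nsmul_eq_mul, mul_sub,
      inv_mul_cancel_left₀ hN'.ne']
  rw [heq, abs_mul, abs_of_pos (inv_pos.2 hN')]
  calc _ ≤ (N : ℝ)⁻¹ * ∑ k ∈ Finset.range N,
        (η + c * Set.indicator {ω | ε ≤ dist (v k ω) u₀} (fun _ => (1 : ℝ)) ω) := by
        gcongr
        exact (Finset.abs_sum_le_sum_abs _ _).trans (Finset.sum_le_sum fun k _ => hterm k)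
    _ = _ := by
        rw [Finset.sum_add_distrib, ← Finset.mul_sum, farFraction, Finset.sum_const,
          Finset.card_range, nsmul_eq_mul, mul_add, inv_mul_cancel_left₀ hN'.ne']
        ring

include h in
omit [SecondCountableTopology U] [SFinite M.ν] [IsProbabilityMeasure μ] in
lemma measurableSet_far (u₀ : U) (ε : ℝ) (k : ℕ) : MeasurableSet {ω | ε ≤ dist (v k ω) u₀} :=
  (isClosed_le continuous_const (by fun_prop : Continuous fun u : U => dist u u₀)).measurableSet.preimage
    (h.measurable_v' k)

include h in
omit [SecondCountableTopology U] [SFinite M.ν] in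
lemma integrable_farFraction (u₀ : U) (ε : ℝ) (N : ℕ) : Integrable (farFraction v u₀ ε N) μ :=
  (integrable_finsetSum _ fun k _ =>
    (integrable_const (1 : ℝ)).indicator (h.measurableSet_far u₀ ε k)).const_mul _

-- The expectation is the Cesàro mean of the probabilities that the design of round `k` is far from
-- `u₀`.
include h in
omit [SecondCountableTopology U] [SFinite M.ν] in
lemma tendsto_integral_farFraction {u₀ : U} {ε : ℝ}
    (hv : Tendsto (fun k => μ {ω | ε ≤ dist (v k ω) u₀}) atTop (𝓝 0)) :
    Tendsto (fun N => ∫ ω, farFraction v u₀ ε N ω ∂μ) atTop (𝓝 0) := by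
  have h1 : Tendsto (fun k => μ.real {ω | ε ≤ dist (v k ω) u₀}) atTop (𝓝 0) := by
    have := (ENNReal.tendsto_toReal ENNReal.zero_ne_top).comp hv
    simpa [Function.comp_def, Measure.real] using this
  refine h1.cesaro.congr fun N => ?_
  unfold farFraction
  rw [integral_const_mul, integral_finsetSum _ fun k _ =>
    (integrable_const (1 : ℝ)).indicator (h.measurableSet_far u₀ ε k)]
  congr 1
  refine Finset.sum_congr rfl fun k _ => ?_
  rw [integral_indicator_const _ (h.measurableSet_far u₀ ε k)]
  simp

include h in
omit [SecondCountableTopology U] [SFinite M.ν] in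
lemma tendsto_measure_farFraction {u₀ : U} {ε : ℝ}
    (hv : Tendsto (fun k => μ {ω | ε ≤ dist (v k ω) u₀}) atTop (𝓝 0)) {κ : ℝ} (hκ : 0 < κ) :
    Tendsto (fun N => μ {ω | κ ≤ farFraction v u₀ ε N ω}) atTop (𝓝 0) := by
  have h1 := (h.tendsto_integral_farFraction hv).div_const κ
  rw [zero_div] at h1
  have h2 := ENNReal.tendsto_ofReal h1
  rw [ENNReal.ofReal_zero] at h2
  refine tendsto_of_tendsto_of_tendsto_of_le_of_le tendsto_const_nhds h2 (fun _ => zero_le)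
    fun N => ?_
  have := mul_meas_ge_le_integral_of_nonneg (μ := μ)
    (ae_of_all _ fun ω => farFraction_nonneg (v := v) u₀ ε N ω)
    (h.integrable_farFraction u₀ ε N) κ
  rw [ENNReal.le_ofReal_iff_toReal_le (measure_ne_top _ _) (by
    have := integral_nonneg (μ := μ) (f := farFraction v u₀ ε N)
      fun ω => farFraction_nonneg (v := v) u₀ ε N ω
    positivity), le_div_iff₀ hκ, mul_comm]
  exact this

include h in
/-- One step of the martingale argument for the central limit theorem. -/
lemma norm_integral_cexp_sum_sub_one_le {f : X → U → ℝ} (hf : Measurable (Function.uncurry f))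
    {C : ℝ≥0} (hC : ∀ u, ∫⁻ x, ‖f x u‖ₑ ^ (3 : ℝ) ∂(M.law u M.θ₀) ≤ C)
    (hmean : ∀ u, ∫ x, f x u ∂(M.law u M.θ₀) = 0) {c : ℝ}
    (hvar : ∀ u, M.mean (fun x u => f x u ^ 2) u ≤ c) {N : ℕ} (hN : 0 < N) (n : ℕ) (hn : n ≤ N) :
    ‖∫ ω, cexp (((√N)⁻¹ * ∑ k ∈ Finset.range n, f (y k ω) (v k ω) : ℝ) * I) *
      (Real.exp ((N : ℝ)⁻¹ * (∑ k ∈ Finset.range n, M.mean (fun x u => f x u ^ 2) (v k ω)) / 2) : ℝ)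
        ∂μ - 1‖ ≤ n * (Real.exp (c / 2) * (Real.exp (c / 2) * (4 * C + c ^ 2) * (√N)⁻¹ ^ 3)) := by
  have hN' : (0 : ℝ) < N := by exact_mod_cast hN
  have hN1 : (1 : ℝ) ≤ N := by exact_mod_cast hN
  set τ := (√N : ℝ)⁻¹ with hτ
  have hτ0 : 0 ≤ τ := by positivity
  have hτ1 : τ ≤ 1 := inv_le_one_of_one_le₀ (Real.one_le_sqrt.2 hN1)
  have hτ2 : (N : ℝ)⁻¹ = τ ^ 2 := by rw [hτ, inv_pow, Real.sq_sqrt hN'.le]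
  rw [hτ2]
  set V := M.mean (fun x u => f x u ^ 2) with hV
  have hVm : Measurable V := M.measurable_mean (hf.pow_const 2)
  have hV0 : ∀ u, 0 ≤ V u := fun u => integral_nonneg fun x => sq_nonneg _
  obtain ⟨ω₀⟩ : Nonempty Ω := nonempty_of_isProbabilityMeasure μ
  have hc0 : 0 ≤ c := (hV0 _).trans (hvar (v 0 ω₀))
  -- At most `N` conditional variances, each at most `c` and weighted by `1 / N`, enter the
  -- compensator, so it stays below `exp (c / 2)`.
  have hexpV : ∀ n ≤ N, ∀ ω, Real.exp (τ ^ 2 * (∑ k ∈ Finset.range n, V (v k ω)) / 2) ≤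
      Real.exp (c / 2) := fun n hn ω => by
    refine Real.exp_le_exp.2 (div_le_div_of_nonneg_right ?_ (by norm_num))
    have h1 : ∑ k ∈ Finset.range n, V (v k ω) ≤ n * c :=
      (Finset.sum_le_sum fun k _ => hvar _).trans (by simp)
    have h2 : (n : ℝ) * c ≤ N * c := by gcongr
    rw [← hτ2, inv_mul_le_iff₀ hN']
    linarith
  have hWm : ∀ n, Measurable[ℱ n] fun ω =>
      cexp ((τ * ∑ k ∈ Finset.range n, f (y k ω) (v k ω) : ℝ) * I) *
      (Real.exp (τ ^ 2 * (∑ k ∈ Finset.range n, V (v k ω)) / 2) : ℝ) := fun n => by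
    have h1 : Measurable[ℱ n] fun ω => ∑ k ∈ Finset.range n, f (y k ω) (v k ω) :=
      Finset.measurable_sum _ fun k hk =>
        (h.measurable_obs hf k).mono (ℱ.mono (Finset.mem_range.1 hk)) le_rfl
    have h2 : Measurable[ℱ n] fun ω => ∑ k ∈ Finset.range n, V (v k ω) :=
      Finset.measurable_sum _ fun k hk =>
        hVm.comp ((h.measurable_v k).mono (ℱ.mono (Finset.mem_range.1 hk).le) le_rfl)
    have g1 : Measurable fun r : ℝ => cexp ((τ * r : ℝ) * I) := by fun_prop
    have g2 : Measurable fun r : ℝ => ((Real.exp (τ ^ 2 * r / 2) : ℝ) : ℂ) := by fun_prop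
    exact (g1.comp h1).mul (g2.comp h2)
  have hWb : ∀ n ≤ N, ∀ ω, ‖cexp ((τ * ∑ k ∈ Finset.range n, f (y k ω) (v k ω) : ℝ) * I) *
      (Real.exp (τ ^ 2 * (∑ k ∈ Finset.range n, V (v k ω)) / 2) : ℝ)‖ ≤ Real.exp (c / 2) :=
    fun n hn ω => by
      rw [norm_mul, norm_exp_ofReal_mul_I, one_mul, norm_real,
        Real.norm_of_nonneg (Real.exp_pos _).le]
      exact hexpV n hn ω
  have hWi : ∀ n ≤ N, Integrable (fun ω =>
      cexp ((τ * ∑ k ∈ Finset.range n, f (y k ω) (v k ω) : ℝ) * I) *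
      (Real.exp (τ ^ 2 * (∑ k ∈ Finset.range n, V (v k ω)) / 2) : ℝ)) μ := fun n hn =>
    Integrable.of_bound ((hWm n).mono (ℱ.le n) le_rfl).aestronglyMeasurable _
      (ae_of_all _ (hWb n hn))
  induction n with
  | zero => simp
  | succ n ih =>
    have hnN : n ≤ N := n.le_succ.trans hn
    have hF : Measurable fun z : (ℂ × U) × X => z.1.1 *
        (cexp ((τ * f z.2 z.1.2 : ℝ) * I) * (Real.exp (τ ^ 2 * V z.1.2 / 2) : ℝ) - 1) := by
      have h1 : Measurable fun z : (ℂ × U) × X => f z.2 z.1.2 :=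
        hf.comp (measurable_snd.prodMk (measurable_snd.comp measurable_fst))
      have h2 : Measurable fun z : (ℂ × U) × X => V z.1.2 :=
        hVm.comp (measurable_snd.comp measurable_fst)
      fun_prop
    -- The increment is the product over the earlier rounds, known from the past, times a
    -- compensated one-step factor minus one. The conditional mean of the latter is of order `τ ^ 3`
    -- by `norm_integral_cexp_mul_sub_one_le`.
    have hstep : ∀ ω, cexp ((τ * ∑ k ∈ Finset.range (n + 1), f (y k ω) (v k ω) : ℝ) * I) *
        (Real.exp (τ ^ 2 * (∑ k ∈ Finset.range (n + 1), V (v k ω)) / 2) : ℝ) -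
        cexp ((τ * ∑ k ∈ Finset.range n, f (y k ω) (v k ω) : ℝ) * I) *
        (Real.exp (τ ^ 2 * (∑ k ∈ Finset.range n, V (v k ω)) / 2) : ℝ) =
        cexp ((τ * ∑ k ∈ Finset.range n, f (y k ω) (v k ω) : ℝ) * I) *
        (Real.exp (τ ^ 2 * (∑ k ∈ Finset.range n, V (v k ω)) / 2) : ℝ) *
        (cexp ((τ * f (y n ω) (v n ω) : ℝ) * I) *
          (Real.exp (τ ^ 2 * V (v n ω) / 2) : ℝ) - 1) := fun ω => by
      have e1 : cexp ((τ * ∑ k ∈ Finset.range (n + 1), f (y k ω) (v k ω) : ℝ) * I) =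
          cexp ((τ * ∑ k ∈ Finset.range n, f (y k ω) (v k ω) : ℝ) * I) *
          cexp ((τ * f (y n ω) (v n ω) : ℝ) * I) := by
        rw [← Complex.exp_add, Finset.sum_range_succ]
        congr 1
        push_cast
        ring
      have e2 : Real.exp (τ ^ 2 * (∑ k ∈ Finset.range (n + 1), V (v k ω)) / 2) =
          Real.exp (τ ^ 2 * (∑ k ∈ Finset.range n, V (v k ω)) / 2) *
          Real.exp (τ ^ 2 * V (v n ω) / 2) := by
        rw [← Real.exp_add, Finset.sum_range_succ]
        congr 1
        ring
      rw [e1, e2]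
      push_cast
      ring
    have hdiff : ‖(∫ ω, cexp ((τ * ∑ k ∈ Finset.range (n + 1), f (y k ω) (v k ω) : ℝ) * I) *
        (Real.exp (τ ^ 2 * (∑ k ∈ Finset.range (n + 1), V (v k ω)) / 2) : ℝ) ∂μ) -
        ∫ ω, cexp ((τ * ∑ k ∈ Finset.range n, f (y k ω) (v k ω) : ℝ) * I) *
        (Real.exp (τ ^ 2 * (∑ k ∈ Finset.range n, V (v k ω)) / 2) : ℝ) ∂μ‖ ≤
        Real.exp (c / 2) * (Real.exp (c / 2) * (4 * C + c ^ 2) * τ ^ 3) := by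
      have hi := (hWi (n + 1) hn).sub (hWi n hnN)
      rw [← integral_sub (hWi (n + 1) hn) (hWi n hnN)]
      simp only [Pi.sub_def] at hi
      simp_rw [hstep] at hi ⊢
      rw [h.integral_eq (hWm n) hF hi]
      have := norm_integral_le_of_norm_le_const (μ := μ)
        (C := Real.exp (c / 2) * (Real.exp (c / 2) * (4 * C + c ^ 2) * τ ^ 3))
        (f := fun ω => ∫ x, cexp ((τ * ∑ k ∈ Finset.range n, f (y k ω) (v k ω) : ℝ) * I) *
        (Real.exp (τ ^ 2 * (∑ k ∈ Finset.range n, V (v k ω)) / 2) : ℝ) *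
        (cexp ((τ * f x (v n ω) : ℝ) * I) *
          (Real.exp (τ ^ 2 * V (v n ω) / 2) : ℝ) - 1) ∂(M.law (v n ω) M.θ₀))
        (ae_of_all _ fun ω => ?_)
      · simpa using this
      have hfm : Measurable fun x => f x (v n ω) :=
        hf.comp (measurable_id.prodMk measurable_const)
      have hexpi : Integrable (fun x => cexp ((τ * f x (v n ω) : ℝ) * I))
          (M.law (v n ω) M.θ₀) := by
        refine Integrable.of_bound (by fun_prop) 1 (ae_of_all _ fun x => ?_)
        rw [norm_exp_ofReal_mul_I]
      rw [integral_const_mul, integral_sub (hexpi.mul_const _) (integrable_const _),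
        integral_mul_const, integral_const, probReal_univ, one_smul, norm_mul]
      exact mul_le_mul (hWb n hnN ω) (norm_integral_cexp_mul_sub_one_le hfm (hC _) (hmean _)
        (hvar _) hτ0 hτ1) (norm_nonneg _) (Real.exp_pos _).le
    calc _ ≤ _ := norm_sub_le_norm_sub_add_norm_sub _
          (∫ ω, cexp ((τ * ∑ k ∈ Finset.range n, f (y k ω) (v k ω) : ℝ) * I) *
            (Real.exp (τ ^ 2 * (∑ k ∈ Finset.range n, V (v k ω)) / 2) : ℝ) ∂μ) _
      _ ≤ _ := add_le_add hdiff (ih hnN)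
      _ = _ := by push_cast; ring

include h in
/-- **Martingale central limit theorem** for the observations, in terms of characteristic
functions. -/
theorem tendsto_integral_cexp_sum {f : X → U → ℝ} (hf : Measurable (Function.uncurry f))
    {C : ℝ≥0} (hC : ∀ u, ∫⁻ x, ‖f x u‖ₑ ^ (3 : ℝ) ∂(M.law u M.θ₀) ≤ C)
    (hmean : ∀ u, ∫ x, f x u ∂(M.law u M.θ₀) = 0) {c : ℝ}
    (hvar : ∀ u, M.mean (fun x u => f x u ^ 2) u ≤ c) {u₀ : U}
    (hcont : ContinuousAt (M.mean (fun x u => f x u ^ 2)) u₀)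
    (hv : ∀ ε > 0, Tendsto (fun k => μ {ω | ε ≤ dist (v k ω) u₀}) atTop (𝓝 0)) :
    Tendsto (fun N : ℕ => ∫ ω, cexp (((√N)⁻¹ * ∑ k ∈ Finset.range N, f (y k ω) (v k ω) : ℝ) * I) ∂μ)
      atTop (𝓝 (Real.exp (-(M.mean (fun x u => f x u ^ 2) u₀) / 2) : ℝ)) := by
  set V := M.mean (fun x u => f x u ^ 2) with hV
  have hVm : Measurable V := M.measurable_mean (hf.pow_const 2)
  have hV0 : ∀ u, 0 ≤ V u := fun u => integral_nonneg fun x => sq_nonneg _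
  have hVc : ∀ u, |V u - V u₀| ≤ c := fun u => by
    rw [abs_le]
    constructor <;> linarith [hV0 u, hV0 u₀, hvar u, hvar u₀]
  have hc0 : 0 ≤ c := (hV0 u₀).trans (hvar u₀)
  set Q : ℕ → Ω → ℝ := fun N ω => (N : ℝ)⁻¹ * ∑ k ∈ Finset.range N, V (v k ω) with hQ
  have hQm : ∀ N, Measurable (Q N) := fun N =>
    (Finset.measurable_sum _ fun k _ => hVm.comp (h.measurable_v' k)).const_mul _
  have hQc : ∀ N ω, Q N ω ≤ c := fun N ω => by
    rcases N.eq_zero_or_pos with rfl | hN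
    · simpa [hQ] using hc0
    have hN' : (0 : ℝ) < N := by exact_mod_cast hN
    simp only [hQ]
    rw [inv_mul_le_iff₀ hN']
    exact (Finset.sum_le_sum fun k _ => hvar _).trans (by simp)
  have hQ0 : ∀ N ω, 0 ≤ Q N ω := fun N ω =>
    mul_nonneg (by positivity) (Finset.sum_nonneg fun k _ => hV0 _)
  have hQi : ∀ N, Integrable (fun ω => |Q N ω - V u₀|) μ := fun N => by
    refine Integrable.of_bound (((hQm N).sub_const _).abs).aestronglyMeasurable c
      (ae_of_all _ fun ω => ?_)
    rw [Real.norm_eq_abs, abs_abs, abs_le]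
    constructor <;> linarith [hQ0 N ω, hQc N ω, hV0 u₀, hvar u₀]
  -- The averaged conditional variance converges in mean: rounds with design near `u₀` contribute
  -- little by continuity of `V`, and the other rounds are an asymptotically negligible fraction.
  have hQlim : Tendsto (fun N => ∫ ω, |Q N ω - V u₀| ∂μ) atTop (𝓝 0) := by
    rw [Metric.tendsto_nhds]
    intro η hη
    obtain ⟨ε, hε, hclose⟩ := Metric.continuousAt_iff.1 hcont (η / 2) (half_pos hη)
    have hfar := ((h.tendsto_integral_farFraction (hv ε hε)).const_mul c).const_add (η / 2)
    rw [mul_zero, add_zero] at hfar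
    filter_upwards [hfar.eventually_lt_const (half_lt_self hη), eventually_gt_atTop 0]
      with N hN hN0
    rw [Real.dist_eq, sub_zero, abs_of_nonneg (integral_nonneg fun ω => abs_nonneg _)]
    refine lt_of_le_of_lt ?_ hN
    have hi := (h.integrable_farFraction u₀ ε N).const_mul c
    have := integral_mono (hQi N) ((integrable_const (η / 2)).add hi) fun ω =>
      abs_average_sub_le (half_pos hη).le hVc (fun u hu => (hclose hu).le) hN0 ω
    refine this.trans (le_of_eq ?_)
    rw [integral_add' (integrable_const _) hi, integral_const_mul]
    simp
  have hSm : ∀ N, Measurable fun ω => ∑ k ∈ Finset.range N, f (y k ω) (v k ω) := fun N =>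
    Finset.measurable_sum _ fun k _ => h.measurable_obs' hf k
  -- The `N` steps each cost `O(N ^ (-3/2))`, in total `O(N ^ (-1/2))`.
  have hA : Tendsto (fun N : ℕ =>
      ∫ ω, cexp (((√N)⁻¹ * ∑ k ∈ Finset.range N, f (y k ω) (v k ω) : ℝ) * I) *
      (Real.exp (Q N ω / 2) : ℝ) ∂μ) atTop (𝓝 1) := by
    rw [tendsto_iff_norm_sub_tendsto_zero]
    have hlim : Tendsto (fun N : ℕ => Real.exp (c / 2) * (Real.exp (c / 2) * (4 * C + c ^ 2)) *
        (√N)⁻¹) atTop (𝓝 0) := by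
      have : Tendsto (fun N : ℕ => (√(N : ℝ))⁻¹) atTop (𝓝 0) :=
        tendsto_inv_atTop_zero.comp (Real.tendsto_sqrt_atTop.comp tendsto_natCast_atTop_atTop)
      simpa using this.const_mul (Real.exp (c / 2) * (Real.exp (c / 2) * (4 * C + c ^ 2)))
    refine squeeze_zero' (.of_forall fun N => norm_nonneg _) ?_ hlim
    filter_upwards [eventually_gt_atTop 0] with N hN
    have hN' : (0 : ℝ) < N := by exact_mod_cast hN
    refine (h.norm_integral_cexp_sum_sub_one_le hf hC hmean hvar hN N le_rfl).trans (le_of_eq ?_)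
    have : (N : ℝ) * (√N)⁻¹ ^ 2 = 1 := by
      rw [inv_pow, Real.sq_sqrt hN'.le, mul_inv_cancel₀ hN'.ne']
    linear_combination (Real.exp (c / 2) * (Real.exp (c / 2) * (4 * C + c ^ 2)) * (√N)⁻¹) * this
  have hEm : ∀ N : ℕ, Measurable fun ω =>
      cexp (((√N)⁻¹ * ∑ k ∈ Finset.range N, f (y k ω) (v k ω) : ℝ) * I) := fun N =>
    (by fun_prop : Measurable fun r : ℝ => cexp (((√N)⁻¹ * r : ℝ) * I)).comp (hSm N)
  have hE : ∀ N : ℕ, Integrable (fun ω =>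
      cexp (((√N)⁻¹ * ∑ k ∈ Finset.range N, f (y k ω) (v k ω) : ℝ) * I)) μ := fun N => by
    refine Integrable.of_bound (hEm N).aestronglyMeasurable 1 (ae_of_all _ fun ω => ?_)
    rw [norm_exp_ofReal_mul_I]
  have hEQ : ∀ N : ℕ, Integrable (fun ω =>
      cexp (((√N)⁻¹ * ∑ k ∈ Finset.range N, f (y k ω) (v k ω) : ℝ) * I) *
      (Real.exp (Q N ω / 2) : ℝ)) μ := fun N => by
    refine Integrable.of_bound ((hEm N).mul ((by fun_prop : Measurable fun r : ℝ =>
      ((Real.exp (r / 2) : ℝ) : ℂ)).comp (hQm N))).aestronglyMeasurable (Real.exp (c / 2)) (ae_of_all _ fun ω => ?_)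
    rw [norm_mul, norm_exp_ofReal_mul_I, one_mul, norm_real, Real.norm_of_nonneg (Real.exp_pos _).le]
    exact Real.exp_le_exp.2 (div_le_div_of_nonneg_right (hQc N ω) (by norm_num))
  have hexp : ∀ a b : ℝ, a ≤ c → b ≤ c →
      |Real.exp (a / 2) - Real.exp (b / 2)| ≤ Real.exp (c / 2) * |a - b| := by
    have hone : ∀ a b : ℝ, a ≤ c → b ≤ c → b ≤ a →
        Real.exp (a / 2) - Real.exp (b / 2) ≤ Real.exp (c / 2) * |a - b| := fun a b ha _ hab => by
      have h1 := Real.add_one_le_exp (b / 2 - a / 2)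
      have h2 : Real.exp (b / 2) = Real.exp (a / 2) * Real.exp (b / 2 - a / 2) := by
        rw [← Real.exp_add]; congr 1; ring
      have h3 : Real.exp (a / 2) ≤ Real.exp (c / 2) := Real.exp_le_exp.2 (by linarith)
      have h4 := Real.exp_pos (a / 2)
      rw [abs_of_nonneg (sub_nonneg.2 hab), h2]
      have h5 : Real.exp (a / 2) * (a - b) ≤ Real.exp (c / 2) * (a - b) := by
        gcongr
      nlinarith
    intro a b ha hb
    rcases le_total b a with hab | hab
    · rw [abs_of_nonneg (sub_nonneg.2 (Real.exp_le_exp.2 (by linarith)))]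
      exact hone a b ha hb hab
    · rw [abs_sub_comm, abs_sub_comm a b,
        abs_of_nonneg (sub_nonneg.2 (Real.exp_le_exp.2 (by linarith)))]
      exact hone b a hb ha hab
  -- The random compensator is replaced by its deterministic limit. The exponential is Lipschitz on
  -- the bounded range of `Q N`, so the error is controlled by the mean distance of `Q N` from `V
  -- u₀`.
  have hD : Tendsto (fun N : ℕ =>
      (∫ ω, cexp (((√N)⁻¹ * ∑ k ∈ Finset.range N, f (y k ω) (v k ω) : ℝ) * I) ∂μ) *
      (Real.exp (V u₀ / 2) : ℝ)) atTop (𝓝 1) := by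
    have hz := (hQlim.const_mul (Real.exp (c / 2)))
    rw [mul_zero] at hz
    have : Tendsto (fun N : ℕ =>
      (∫ ω, cexp (((√N)⁻¹ * ∑ k ∈ Finset.range N, f (y k ω) (v k ω) : ℝ) * I) *
        (Real.exp (Q N ω / 2) : ℝ) ∂μ) -
      (∫ ω, cexp (((√N)⁻¹ * ∑ k ∈ Finset.range N, f (y k ω) (v k ω) : ℝ) * I) ∂μ) *
      (Real.exp (V u₀ / 2) : ℝ)) atTop (𝓝 0) := by
      rw [tendsto_zero_iff_norm_tendsto_zero]
      refine squeeze_zero (fun N => norm_nonneg _) (fun N => ?_) hz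
      rw [← integral_mul_const, ← integral_sub (hEQ N) ((hE N).mul_const _), ← integral_const_mul]
      refine norm_integral_le_of_norm_le ((hQi N).const_mul _) (ae_of_all _ fun ω => ?_)
      rw [← mul_sub, norm_mul, norm_exp_ofReal_mul_I, one_mul, ← ofReal_sub, norm_real,
        Real.norm_eq_abs]
      exact hexp _ _ (hQc N ω) (hvar u₀)
    have h2 := hA.sub this
    simpa using h2
  have hfin := hD.mul_const ((Real.exp (-(V u₀) / 2) : ℝ) : ℂ)
  rw [one_mul] at hfin
  refine hfin.congr fun N => ?_
  rw [mul_assoc, ← ofReal_mul, ← Real.exp_add]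
  have : V u₀ / 2 + -V u₀ / 2 = 0 := by ring
  rw [this]
  simp

end IsDesign
end RegularModel
end Stackelberg

/-! ### Uniform linearization of the total score near the true parameter. -/

namespace Stackelberg

/-- A dyadic multiple of `c` comparable to `x`. -/
lemma exists_dyadic_scale {c x : ℝ} (hc : 0 < c) (hx : 0 ≤ x) {N : ℕ} (hN : x ≤ c * N) :
    ∃ j < Nat.log 2 N + 2, x ≤ 2 ^ j * c ∧ 2 ^ j * c ≤ 2 * x + c ∧ 2 ^ j * c ≤ max c (2 * x) := by
  rcases le_total x c with h | h
  · exact ⟨0, by omega, by simpa using h, by simp; linarith, by simp⟩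
  · obtain ⟨n, hn1, hn2⟩ := exists_nat_pow_near (x := x / c) (y := 2)
      ((one_le_div hc).2 h) (by norm_num)
    rw [le_div_iff₀ hc] at hn1
    rw [div_lt_iff₀ hc] at hn2
    have hle : 2 ^ (n + 1) * c ≤ 2 * x := by rw [pow_succ]; linarith
    refine ⟨n + 1, ?_, hn2.le, by linarith, hle.trans (le_max_right _ _)⟩
    have : (2 : ℝ) ^ n ≤ N := by
      have := hn1.trans hN
      rw [mul_comm] at this
      exact le_of_mul_le_mul_left this hc
    have h2 : 2 ^ n ≤ N := by exact_mod_cast this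
    have := Nat.le_log_of_pow_le (by norm_num) h2
    omega

/-- The union bound over dyadic scales costs a logarithmic factor, which any polynomial decay
absorbs. -/
lemma tendsto_log_mul_rpow_neg {c : ℝ} (hc : 0 < c) :
    Tendsto (fun N : ℕ => ((Nat.log 2 N + 2 : ℕ) : ℝ) * (N : ℝ) ^ (-c)) atTop (𝓝 0) := by
  have h1 : Tendsto (fun x : ℝ => Real.log x / x ^ c) atTop (𝓝 0) :=
    (isLittleO_log_rpow_atTop hc).tendsto_div_nhds_zero
  have h2 := tendsto_rpow_neg_atTop hc
  have h3 : Tendsto (fun x : ℝ => (Real.log 2)⁻¹ * (Real.log x / x ^ c) + 2 * x ^ (-c)) atTop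
      (𝓝 0) := by
    simpa using (h1.const_mul (Real.log 2)⁻¹).add (h2.const_mul 2)
  refine squeeze_zero (fun N => by positivity) (fun N => ?_)
    (h3.comp tendsto_natCast_atTop_atTop)
  have h4 : (Nat.log 2 N : ℝ) ≤ (Real.log 2)⁻¹ * Real.log N := by
    have := Real.natLog_le_logb N 2
    rw [Real.logb, div_eq_inv_mul] at this
    exact_mod_cast this
  simp only [Function.comp_apply]
  rw [div_eq_mul_inv, ← Real.rpow_neg (Nat.cast_nonneg N)]
  push_cast
  have h5 : (0 : ℝ) ≤ (N : ℝ) ^ (-c) := by positivity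
  nlinarith

namespace RegularModel

variable {X U : Type*} [MeasurableSpace X] [MetricSpace U] [MeasurableSpace U] {m : ℕ}
  (M : RegularModel X U m)

/-- The total absolute size of the information matrix. -/
noncomputable def infoSize (u₀ : U) : ℝ := ∑ i, ∑ j, |M.info u₀ M.θ₀ i j|

lemma infoSize_nonneg (u₀ : U) : 0 ≤ M.infoSize u₀ :=
  Finset.sum_nonneg fun _ _ => Finset.sum_nonneg fun _ _ => abs_nonneg _

lemma abs_info_mul_le (u₀ : U) (i : Fin m) (w : EuclideanSpace ℝ (Fin m)) :
    |∑ j, M.info u₀ M.θ₀ i j * w j| ≤ M.infoSize u₀ * ‖w‖ := by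
  calc _ ≤ ∑ j, |M.info u₀ M.θ₀ i j| * ‖w‖ := by
        refine (Finset.abs_sum_le_sum_abs _ _).trans (Finset.sum_le_sum fun j _ => ?_)
        rw [abs_mul]
        gcongr
        exact PiLp.norm_apply_le w j
    _ ≤ _ := by
        rw [← Finset.sum_mul]
        gcongr
        exact Finset.single_le_sum (f := fun i => ∑ j, |M.info u₀ M.θ₀ i j|)
          (fun _ _ => Finset.sum_nonneg fun _ _ => abs_nonneg _) (Finset.mem_univ i)

lemma abs_s_sub_le (x : X) (u : U) (i : Fin m) {θ θ' : EuclideanSpace ℝ (Fin m)}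
    (hθ : θ ∈ Metric.ball M.θ₀ M.r) (hθ' : θ' ∈ Metric.ball M.θ₀ M.r) :
    |M.s x u θ i - M.s x u θ' i| ≤ M.B x u * ‖θ - θ'‖ :=
  (PiLp.norm_apply_le (M.s x u θ - M.s x u θ') i).trans (M.lipschitz x u θ hθ θ' hθ')

lemma integrable_s_apply (u : U) (i : Fin m) {θ : EuclideanSpace ℝ (Fin m)} (hθ : θ ∈ M.Θ) :
    Integrable (fun x => M.s x u θ i) (M.law u M.θ₀) := by
  refine integrable_of_moment (a := 2) (C := M.C) (M.measurable_s_apply u hθ i) (by norm_num)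
    (le_trans (lintegral_mono fun x => ?_) (M.second_moment u _ M.mem_Θ))
  refine ENNReal.rpow_le_rpow ?_ (by norm_num)
  rw [← ofReal_norm, ← ofReal_norm]
  refine ENNReal.ofReal_le_ofReal ?_
  rw [Real.norm_of_nonneg (M.L_nonneg x u)]
  exact M.abs_s_le x u hθ i

lemma integrable_B (u : U) : Integrable (fun x => M.B x u) (M.law u M.θ₀) :=
  integrable_of_moment (M.measurable_B u) (by linarith [M.δ_pos]) (M.moment_B u)

lemma integral_abs_B_le (u : U) : ∫ x, |M.B x u| ∂(M.law u M.θ₀) ≤ 1 + M.C := by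
  rw [integral_eq_lintegral_of_nonneg_ae (ae_of_all _ fun _ => abs_nonneg _)
    (M.measurable_B u).abs.aestronglyMeasurable]
  have h := M.lintegral_B_le u
  have h2 := ENNReal.toReal_mono ENNReal.coe_ne_top h
  refine le_of_eq_of_le ?_ (h2.trans (le_of_eq
    (by rw [ENNReal.coe_toReal]; simp)))
  congr 1
  exact lintegral_congr fun x => by rw [← Real.norm_eq_abs, ofReal_norm]

/-- The score is centred at `θ₀` and Lipschitz with the integrable constant `B`. This crude bound
serves the rounds whose design is far from `u₀`, where the expansion of
`exists_abs_integral_s_add_le` is not available. -/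
lemma abs_mean_s_le (u : U) (i : Fin m) {θ : EuclideanSpace ℝ (Fin m)}
    (hθ : θ ∈ Metric.ball M.θ₀ M.r) :
    |∫ x, M.s x u θ i ∂(M.law u M.θ₀)| ≤ (1 + M.C) * ‖θ - M.θ₀‖ := by
  have hz : ∫ x, M.s x u M.θ₀ i ∂(M.law u M.θ₀) = 0 := M.integral_s u _ M.mem_Θ i
  rw [← sub_zero (∫ x, M.s x u θ i ∂(M.law u M.θ₀)), ← hz,
    ← integral_sub (M.integrable_s_apply u i (M.ball_subset hθ)) (M.integrable_s_apply u i M.mem_Θ)]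
  calc _ ≤ ∫ x, |M.B x u| * ‖θ - M.θ₀‖ ∂(M.law u M.θ₀) := by
        rw [← Real.norm_eq_abs]
        refine norm_integral_le_of_norm_le ((M.integrable_B u).abs.mul_const _)
          (ae_of_all _ fun x => ?_)
        refine (M.abs_s_sub_le x u i hθ (Metric.mem_ball_self M.r_pos)).trans ?_
        gcongr
        exact le_abs_self _
    _ ≤ _ := by
        rw [integral_mul_const]
        gcongr
        exact M.integral_abs_B_le u

/-- The remainder in the linearization at `θ₀` of the `i`-th component of the total score. -/
noncomputable def remainder {Ω : Type*} (v : ℕ → Ω → U) (y : ℕ → Ω → X) (u₀ : U) (N : ℕ)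
    (θ : EuclideanSpace ℝ (Fin m)) (i : Fin m) (ω : Ω) : ℝ :=
  ∑ k ∈ Finset.range N, (M.s (y k ω) (v k ω) θ i - M.s (y k ω) (v k ω) M.θ₀ i) +
    N * ∑ j, M.info u₀ M.θ₀ i j * (θ - M.θ₀) j

/-- The random Lipschitz constant that carries a bound from a net point to its neighbours. -/
lemma abs_remainder_sub_le {Ω : Type*} (v : ℕ → Ω → U) (y : ℕ → Ω → X) (u₀ : U) (N : ℕ)
    {θ θ' : EuclideanSpace ℝ (Fin m)} (hθ : θ ∈ Metric.ball M.θ₀ M.r)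
    (hθ' : θ' ∈ Metric.ball M.θ₀ M.r) (i : Fin m) (ω : Ω) :
    |M.remainder v y u₀ N θ i ω - M.remainder v y u₀ N θ' i ω| ≤
      (∑ k ∈ Finset.range N, |M.B (y k ω) (v k ω)| + N * M.infoSize u₀) * ‖θ - θ'‖ := by
  have heq : M.remainder v y u₀ N θ i ω - M.remainder v y u₀ N θ' i ω =
      ∑ k ∈ Finset.range N, (M.s (y k ω) (v k ω) θ i - M.s (y k ω) (v k ω) θ' i) +
        N * ∑ j, M.info u₀ M.θ₀ i j * (θ - θ') j := by
    have : ∑ j, M.info u₀ M.θ₀ i j * (θ - θ') j = ∑ j, M.info u₀ M.θ₀ i j * (θ - M.θ₀) j -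
        ∑ j, M.info u₀ M.θ₀ i j * (θ' - M.θ₀) j := by
      rw [← Finset.sum_sub_distrib]
      exact Finset.sum_congr rfl fun j _ => by simp; ring
    rw [this]
    simp only [remainder, Finset.sum_sub_distrib]
    ring
  rw [heq, add_mul]
  refine (abs_add_le _ _).trans (add_le_add ?_ ?_)
  · rw [Finset.sum_mul]
    refine (Finset.abs_sum_le_sum_abs _ _).trans (Finset.sum_le_sum fun k _ => ?_)
    refine (M.abs_s_sub_le _ _ i hθ hθ').trans ?_
    gcongr
    exact le_abs_self _
  · rw [abs_mul, Nat.abs_cast, mul_assoc]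
    gcongr
    exact M.abs_info_mul_le u₀ i _

namespace IsDesign

variable {M} [BorelSpace U] [SecondCountableTopology U] [SFinite M.ν]
  {Ω : Type*} {mΩ : MeasurableSpace Ω} {μ : Measure Ω} [IsProbabilityMeasure μ]
  {ℱ : Filtration ℕ mΩ} {v : ℕ → Ω → U} {y : ℕ → Ω → X} (h : M.IsDesign μ ℱ v y)

include h in
/-- Fluctuations of the score increments at a single parameter. -/
lemma measure_fluctuation_le {θ : EuclideanSpace ℝ (Fin m)} (hθ : θ ∈ Metric.ball M.θ₀ M.r)
    (i : Fin m) {ρ : ℝ} (hρ : 0 < ρ) (hθρ : ‖θ - M.θ₀‖ ≤ ρ) {η : ℝ} (hη : 0 < η) {N : ℕ}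
    (hN : 0 < N) :
    μ {ω | η * N * ρ ≤ |∑ k ∈ Finset.range N, (M.s (y k ω) (v k ω) θ i -
        M.s (y k ω) (v k ω) M.θ₀ i - ∫ x, M.s x (v k ω) θ i ∂(M.law (v k ω) M.θ₀))|} ≤
      ENNReal.ofReal (16 / η ^ 2 * (N : ℝ) ^ (-(1 / 2) : ℝ) +
        4 * M.C / η * (N : ℝ) ^ (-(M.δ / 4))) := by
  have hN' : (0 : ℝ) < N := by exact_mod_cast hN
  have hθΘ := M.ball_subset hθ
  have hm : ∀ {θ}, θ ∈ M.Θ → Measurable (Function.uncurry fun x u => M.s x u θ i) := fun h =>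
    (EuclideanSpace.proj (𝕜 := ℝ) i).continuous.measurable.comp (M.measurable_uncurry_s h)
  -- Divided by the scale `ρ`, the increment is dominated by `B`, so the moment bound does not
  -- depend on the scale.
  have hf : Measurable (Function.uncurry fun x u => ρ⁻¹ * (M.s x u θ i - M.s x u M.θ₀ i)) :=
    ((hm hθΘ).sub (hm M.mem_Θ)).const_mul _
  have hmom : ∀ u, ∫⁻ x, ‖ρ⁻¹ * (M.s x u θ i - M.s x u M.θ₀ i)‖ₑ ^ (1 + M.δ) ∂(M.law u M.θ₀)
      ≤ M.C := fun u => by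
    refine (lintegral_mono fun x => ?_).trans (M.moment_B u)
    refine ENNReal.rpow_le_rpow ?_ (by linarith [M.δ_pos])
    rw [← ofReal_norm, ← ofReal_norm]
    refine ENNReal.ofReal_le_ofReal ?_
    rw [norm_mul, Real.norm_eq_abs, Real.norm_eq_abs, Real.norm_eq_abs,
      abs_of_pos (inv_pos.2 hρ), inv_mul_le_iff₀ hρ]
    refine (M.abs_s_sub_le x u i hθ (Metric.mem_ball_self M.r_pos)).trans ?_
    rw [mul_comm ρ]
    exact mul_le_mul (le_abs_self _) hθρ (norm_nonneg _) (abs_nonneg _)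
  -- Truncation at `N ^ (1/4)` makes both errors polynomially small: `N ^ (-1/2)` for the bounded
  -- part, `N ^ (-δ/4)` for the tail.
  have hK : (0 : ℝ) < (N : ℝ) ^ (1 / 4 : ℝ) := by positivity
  have := h.measure_le_abs_sum_le hf (by linarith [M.δ_pos]) hmom hN hη hK
  refine le_trans (measure_mono ?_) (this.trans (ENNReal.ofReal_le_ofReal (le_of_eq ?_)))
  · intro ω hω
    simp only [Set.mem_ofPred_eq] at hω ⊢
    have hmean : ∀ u, M.mean (fun x u => ρ⁻¹ * (M.s x u θ i - M.s x u M.θ₀ i)) u =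
        ρ⁻¹ * ∫ x, M.s x u θ i ∂(M.law u M.θ₀) := fun u => by
      have hz : ∫ x, M.s x u M.θ₀ i ∂(M.law u M.θ₀) = 0 := M.integral_s u _ M.mem_Θ i
      rw [mean, integral_const_mul, integral_sub (M.integrable_s_apply u i hθΘ)
        (M.integrable_s_apply u i M.mem_Θ), hz, sub_zero]
    simp_rw [hmean, ← mul_sub]
    rw [← Finset.mul_sum, abs_mul, abs_of_pos (inv_pos.2 hρ), le_inv_mul_iff₀ hρ]
    linarith
  · have e1 : ((N : ℝ) ^ (1 / 4 : ℝ)) ^ 2 = (N : ℝ) ^ (-(1 / 2) : ℝ) * N := by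
      rw [← Real.rpow_natCast, ← Real.rpow_mul hN'.le]
      nth_rewrite 3 [← Real.rpow_one (N : ℝ)]
      rw [← Real.rpow_add hN']
      norm_num
    have e2 : ((N : ℝ) ^ (1 / 4 : ℝ)) ^ (1 - (1 + M.δ)) = (N : ℝ) ^ (-(M.δ / 4)) := by
      rw [← Real.rpow_mul hN'.le]
      congr 1
      ring
    rw [e1, e2]
    field_simp

omit [BorelSpace U] [SecondCountableTopology U] [SFinite M.ν] in
/-- The averaged conditional mean of the remainder. -/
lemma abs_sum_mean_add_le {u₀ : U} {ε η : ℝ} (hη : 0 ≤ η) (hε : ε ≤ M.r)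
    (hmean : ∀ u, dist u u₀ < ε → ∀ θ ∈ Metric.ball M.θ₀ ε, ∀ i,
      |∫ x, M.s x u θ i ∂(M.law u M.θ₀) + ∑ j, M.info u₀ M.θ₀ i j * (θ - M.θ₀) j|
        ≤ η * ‖θ - M.θ₀‖) {θ : EuclideanSpace ℝ (Fin m)} (hθ : θ ∈ Metric.ball M.θ₀ ε)
    (i : Fin m) {N : ℕ} (hN : 0 < N) (ω : Ω) :
    |∑ k ∈ Finset.range N, (∫ x, M.s x (v k ω) θ i ∂(M.law (v k ω) M.θ₀)) +
      N * ∑ j, M.info u₀ M.θ₀ i j * (θ - M.θ₀) j| ≤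
      N * ((η + (1 + M.C + M.infoSize u₀) * farFraction v u₀ ε N ω) * ‖θ - M.θ₀‖) := by
  have hN' : (0 : ℝ) < N := by exact_mod_cast hN
  have hθr := Metric.ball_subset_ball hε hθ
  have hterm : ∀ k, |(∫ x, M.s x (v k ω) θ i ∂(M.law (v k ω) M.θ₀)) +
      ∑ j, M.info u₀ M.θ₀ i j * (θ - M.θ₀) j| ≤ (η + (1 + M.C + M.infoSize u₀) *
        Set.indicator {ω | ε ≤ dist (v k ω) u₀} (fun _ => (1 : ℝ)) ω) * ‖θ - M.θ₀‖ := fun k => by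
    by_cases hk : ε ≤ dist (v k ω) u₀
    · rw [Set.indicator_of_mem (by exact hk)]
      have h1 := M.abs_mean_s_le (v k ω) i hθr
      have h2 := M.abs_info_mul_le u₀ i (θ - M.θ₀)
      have h3 := abs_add_le (∫ x, M.s x (v k ω) θ i ∂(M.law (v k ω) M.θ₀))
        (∑ j, M.info u₀ M.θ₀ i j * (θ - M.θ₀) j)
      have h4 := mul_nonneg hη (norm_nonneg (θ - M.θ₀))
      nlinarith
    · rw [Set.indicator_of_notMem (by exact hk)]
      simpa using hmean _ (not_le.1 hk) θ hθ i
  have hsum : ∑ k ∈ Finset.range N, (∫ x, M.s x (v k ω) θ i ∂(M.law (v k ω) M.θ₀)) +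
      N * ∑ j, M.info u₀ M.θ₀ i j * (θ - M.θ₀) j =
      ∑ k ∈ Finset.range N, ((∫ x, M.s x (v k ω) θ i ∂(M.law (v k ω) M.θ₀)) +
        ∑ j, M.info u₀ M.θ₀ i j * (θ - M.θ₀) j) := by
    rw [Finset.sum_add_distrib, Finset.sum_const, Finset.card_range, nsmul_eq_mul]
  rw [hsum]
  refine (Finset.abs_sum_le_sum_abs _ _).trans ((Finset.sum_le_sum fun k _ => hterm k).trans
    (le_of_eq ?_))
  rw [← Finset.sum_mul, Finset.sum_add_distrib, ← Finset.mul_sum, Finset.sum_const,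
    Finset.card_range, nsmul_eq_mul, farFraction]
  field_simp

include h in
/-- Uniform linearization of the total score near `θ₀`. -/
theorem exists_measure_remainder_le {u₀ : U}
    (hv : ∀ ε > 0, Tendsto (fun k => μ {ω | ε ≤ dist (v k ω) u₀}) atTop (𝓝 0))
    {η e : ℝ} (hη : 0 < η) (he : 0 < e) :
    ∃ r > 0, r ≤ M.r ∧ ∀ᶠ N : ℕ in atTop, μ {ω | ∃ θ ∈ Metric.ball M.θ₀ r, ∃ i,
      η * (‖θ - M.θ₀‖ + (√N)⁻¹) * N < |M.remainder v y u₀ N θ i ω|} ≤ ENNReal.ofReal e := by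
  -- At scale `ρ` the errors are `η₁ * ρ` for passing to the net point, `η₁ * ρ` for the fluctuation
  -- and `2 * η₁ * ρ` for the mean. Since `ρ ≤ 2 * ‖θ - θ₀‖ + N ^ (-1/2)`, their sum fits into the
  -- claimed bound.
  set η₁ := η / 8 with hη₁
  have hη₁0 : 0 < η₁ := by positivity
  set A := M.infoSize u₀
  have hA : 0 ≤ A := M.infoSize_nonneg u₀
  set c : ℝ≥0 := 1 + M.C
  have hc : 0 < (c : ℝ) := by positivity
  set K : ℝ := 3 * c / e
  have hK : 0 < K := by positivity
  obtain ⟨ε, hε0, hεr, hmean⟩ := M.exists_abs_integral_s_add_le u₀ hη₁0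
  -- One net of the unit ball serves every scale after dilation, so its cardinality does not depend
  -- on `N`. The mesh is the inverse of the Lipschitz constant `K + A` per round, times `η₁`.
  obtain ⟨t, htsub, htfin, hcover⟩ := (isCompact_closedBall (0 : EuclideanSpace ℝ (Fin m))
    1).finite_cover_balls (e := η₁ / (K + A)) (by positivity)
  set κ : ℝ := η₁ / (1 + M.C + A)
  have hκ : 0 < κ := by positivity
  set R : ℕ → ℝ := fun N => 16 / η₁ ^ 2 * (N : ℝ) ^ (-(1 / 2) : ℝ) +
    4 * M.C / η₁ * (N : ℝ) ^ (-(M.δ / 4)) with hR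
  have hRlim : Tendsto (fun N : ℕ => (htfin.toFinset.card * m : ℝ) *
      (((Nat.log 2 N + 2 : ℕ) : ℝ) * R N)) atTop (𝓝 0) := by
    have h1 := (tendsto_log_mul_rpow_neg (c := 1 / 2) (by norm_num)).const_mul (16 / η₁ ^ 2)
    have h2 := (tendsto_log_mul_rpow_neg (c := M.δ / 4) (by linarith [M.δ_pos])).const_mul
      (4 * M.C / η₁)
    have h3 := (h1.add h2).const_mul (htfin.toFinset.card * m : ℝ)
    simp only [mul_zero, add_zero] at h3
    refine h3.congr fun N => ?_
    simp only [hR]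
    ring
  have hfar := h.tendsto_measure_farFraction (hv ε hε0) hκ
  have hsq : Tendsto (fun N : ℕ => (√(N : ℝ))⁻¹) atTop (𝓝 0) :=
    tendsto_inv_atTop_zero.comp (Real.tendsto_sqrt_atTop.comp tendsto_natCast_atTop_atTop)
  -- The bound `ε / 4` keeps the dyadic scale, at most `max (N ^ (-1/2)) (2 * ‖θ - θ₀‖)`, below `ε`,
  -- hence net points inside the ball of the expansion. The bound `1` gives `‖θ - θ₀‖ ≤ √N`, so that
  -- `Nat.log 2 N + 2` scales suffice.
  have hr0 : 0 < min (ε / 4) 1 := by positivity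
  refine ⟨min (ε / 4) 1, hr0, (min_le_left _ _).trans (by linarith), ?_⟩
  filter_upwards [eventually_gt_atTop 0, hsq.eventually_lt_const hε0,
    hRlim.eventually_le_const (show (0 : ℝ) < e / 3 by positivity),
    hfar.eventually_le_const (show (0 : ℝ≥0∞) < ENNReal.ofReal (e / 3) by
      rw [ENNReal.ofReal_pos]; positivity)] with N hN hNε hNR hNfar
  have hN' : (0 : ℝ) < N := by exact_mod_cast hN
  have hsqN : 0 < (√(N : ℝ))⁻¹ := by positivity
  set E1 : Set Ω := {ω | K * N ≤ ∑ k ∈ Finset.range N, |M.B (y k ω) (v k ω)|}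
  set E2 : Set Ω := {ω | κ ≤ farFraction v u₀ ε N ω}
  -- Scales of size `ε` or more are excluded inside the event, which makes it empty there and lets
  -- the union run over all `j`.
  set E3 : ℕ → EuclideanSpace ℝ (Fin m) → Fin m → Set Ω := fun j b i =>
    {ω | 2 ^ j * (√(N : ℝ))⁻¹ < ε ∧ η₁ * N * (2 ^ j * (√(N : ℝ))⁻¹) ≤
      |∑ k ∈ Finset.range N, (M.s (y k ω) (v k ω) (M.θ₀ + (2 ^ j * (√(N : ℝ))⁻¹) • b) i -
        M.s (y k ω) (v k ω) M.θ₀ i -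
        ∫ x, M.s x (v k ω) (M.θ₀ + (2 ^ j * (√(N : ℝ))⁻¹) • b) i ∂(M.law (v k ω) M.θ₀))|}
  have hE1 : μ E1 ≤ ENNReal.ofReal (e / 3) := by
    refine (h.measure_le_sum_obs M.measurable_uncurry_B M.lintegral_B_le hN hK).trans
      (ENNReal.ofReal_le_ofReal (le_of_eq ?_))
    simp only [K, c]
    field_simp
  have hball : ∀ (j : ℕ) (b : EuclideanSpace ℝ (Fin m)), ‖b‖ ≤ 1 →
      ‖M.θ₀ + (2 ^ j * (√(N : ℝ))⁻¹) • b - M.θ₀‖ ≤ 2 ^ j * (√(N : ℝ))⁻¹ := fun j b hb => by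
    rw [add_sub_cancel_left, norm_smul, Real.norm_of_nonneg (by positivity)]
    exact mul_le_of_le_one_right (by positivity) hb
  have hE3 : ∀ j, ∀ b ∈ t, ∀ i, μ (E3 j b i) ≤ ENNReal.ofReal (R N) := fun j b hb i => by
    by_cases hj : 2 ^ j * (√(N : ℝ))⁻¹ < ε
    · have hb1 : ‖b‖ ≤ 1 := by simpa using htsub hb
      have hθ : M.θ₀ + (2 ^ j * (√(N : ℝ))⁻¹) • b ∈ Metric.ball M.θ₀ M.r := by
        rw [Metric.mem_ball, dist_eq_norm]
        exact (hball j b hb1).trans_lt (hj.trans_le hεr)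
      refine (measure_mono fun ω hω => ?_).trans (h.measure_fluctuation_le hθ i
        (show 0 < 2 ^ j * (√(N : ℝ))⁻¹ by positivity) (hball j b hb1) hη₁0 hN)
      exact hω.2
    · have : E3 j b i = ∅ := Set.eq_empty_of_forall_notMem fun ω hω => hj hω.1
      rw [this, measure_empty]
      exact zero_le
  have hsub : {ω | ∃ θ ∈ Metric.ball M.θ₀ (min (ε / 4) 1), ∃ i,
      η * (‖θ - M.θ₀‖ + (√N)⁻¹) * N < |M.remainder v y u₀ N θ i ω|} ⊆
      (E1 ∪ E2) ∪ ⋃ j ∈ Finset.range (Nat.log 2 N + 2), ⋃ b ∈ htfin.toFinset,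
        ⋃ i ∈ (Finset.univ : Finset (Fin m)), E3 j b i := by
    rintro ω ⟨θ, hθ, i, hlt⟩
    by_contra hcon
    simp only [Set.mem_union, Set.mem_iUnion, Finset.mem_range, Set.Finite.mem_toFinset,
      Finset.mem_univ, not_or, not_exists] at hcon
    obtain ⟨⟨hω1, hω2⟩, hω3⟩ := hcon
    have hω1' : ∑ k ∈ Finset.range N, |M.B (y k ω) (v k ω)| ≤ K * N := (not_le.1 hω1).le
    have hω2' : farFraction v u₀ ε N ω ≤ κ := (not_le.1 hω2).le
    rw [Metric.mem_ball, dist_eq_norm, lt_min_iff] at hθ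
    have hxN : ‖θ - M.θ₀‖ ≤ (√(N : ℝ))⁻¹ * N := by
      have h1 : (√(N : ℝ))⁻¹ * N = √(N : ℝ) := by
        rw [inv_mul_eq_div, Real.div_sqrt]
      rw [h1]
      exact hθ.2.le.trans (Real.one_le_sqrt.2 (by exact_mod_cast hN))
    obtain ⟨j, hj, hj1, hj2, hj3⟩ := exists_dyadic_scale hsqN (norm_nonneg (θ - M.θ₀)) hxN
    set ρ := 2 ^ j * (√(N : ℝ))⁻¹ with hρ
    have hρ0 : 0 < ρ := by positivity
    have hρε : ρ < ε := hj3.trans_lt (max_lt hNε (by linarith))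
    have hmem : ρ⁻¹ • (θ - M.θ₀) ∈ Metric.closedBall (0 : EuclideanSpace ℝ (Fin m)) 1 := by
      rw [mem_closedBall_zero_iff, norm_smul, Real.norm_of_nonneg (by positivity),
        inv_mul_le_iff₀ hρ0]
      linarith
    obtain ⟨b, hbt, hb⟩ := Set.mem_iUnion₂.1 (hcover hmem)
    have hb1 : ‖b‖ ≤ 1 := by simpa using htsub hbt
    set θ' := M.θ₀ + ρ • b with hθ'
    have hθ'ρ : ‖θ' - M.θ₀‖ ≤ ρ := hball j b hb1
    have hθ'ε : θ' ∈ Metric.ball M.θ₀ ε := by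
      rw [Metric.mem_ball, dist_eq_norm]; exact hθ'ρ.trans_lt hρε
    have hθr : θ ∈ Metric.ball M.θ₀ M.r := by
      rw [Metric.mem_ball, dist_eq_norm]; linarith [hθ.1]
    have hdist : ‖θ - θ'‖ ≤ ρ * (η₁ / (K + A)) := by
      have : θ - θ' = ρ • (ρ⁻¹ • (θ - M.θ₀) - b) := by
        rw [smul_sub, smul_inv_smul₀ hρ0.ne', hθ']
        abel
      rw [this, norm_smul, Real.norm_of_nonneg hρ0.le]
      rw [Metric.mem_ball, dist_eq_norm] at hb
      gcongr
    have h1 : |M.remainder v y u₀ N θ i ω - M.remainder v y u₀ N θ' i ω| ≤ N * (η₁ * ρ) := by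
      refine (M.abs_remainder_sub_le v y u₀ N hθr (Metric.ball_subset_ball hεr hθ'ε) i ω).trans ?_
      calc _ ≤ (K * N + N * A) * (ρ * (η₁ / (K + A))) := by gcongr
        _ = N * (η₁ * ρ) := by field_simp
    have h2 : |∑ k ∈ Finset.range N, (M.s (y k ω) (v k ω) θ' i - M.s (y k ω) (v k ω) M.θ₀ i -
        ∫ x, M.s x (v k ω) θ' i ∂(M.law (v k ω) M.θ₀))| ≤ N * (η₁ * ρ) := by
      have := hω3 j hj b hbt i trivial
      have h3 : ¬ (η₁ * N * ρ ≤ _) := fun hh => this ⟨hρε, hh⟩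
      refine (not_le.1 h3).le.trans (le_of_eq (by ring))
    have h3 := abs_sum_mean_add_le (v := v) hη₁0.le hεr hmean hθ'ε i hN ω
    have h4 : N * ((η₁ + (1 + M.C + A) * farFraction v u₀ ε N ω) * ‖θ' - M.θ₀‖) ≤
        N * (2 * η₁ * ρ) := by
      have : (1 + M.C + A) * farFraction v u₀ ε N ω ≤ η₁ := by
        calc _ ≤ (1 + M.C + A) * κ := by gcongr
          _ = η₁ := by simp only [κ]; field_simp
      gcongr
      linarith
    have h5 : M.remainder v y u₀ N θ' i ω =
        ∑ k ∈ Finset.range N, (M.s (y k ω) (v k ω) θ' i - M.s (y k ω) (v k ω) M.θ₀ i -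
          ∫ x, M.s x (v k ω) θ' i ∂(M.law (v k ω) M.θ₀)) +
        (∑ k ∈ Finset.range N, (∫ x, M.s x (v k ω) θ' i ∂(M.law (v k ω) M.θ₀)) +
          N * ∑ j, M.info u₀ M.θ₀ i j * (θ' - M.θ₀) j) := by
      simp only [remainder, Finset.sum_sub_distrib]
      ring
    have h6 : |M.remainder v y u₀ N θ' i ω| ≤ N * (η₁ * ρ) + N * (2 * η₁ * ρ) := by
      rw [h5]
      exact (abs_add_le _ _).trans (add_le_add h2 (h3.trans h4))
    have h7 : |M.remainder v y u₀ N θ i ω| ≤ N * (4 * η₁ * ρ) := by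
      have := abs_sub_abs_le_abs_sub (M.remainder v y u₀ N θ i ω) (M.remainder v y u₀ N θ' i ω)
      linarith
    have h8 : N * (4 * η₁ * ρ) ≤ η * (‖θ - M.θ₀‖ + (√N)⁻¹) * N := by
      have : 4 * η₁ * ρ ≤ η * (‖θ - M.θ₀‖ + (√N)⁻¹) := by
        calc 4 * η₁ * ρ ≤ 4 * η₁ * (2 * ‖θ - M.θ₀‖ + 2 * (√N)⁻¹) := by gcongr; linarith
          _ = _ := by rw [hη₁]; ring
      nlinarith
    linarith
  refine (measure_mono hsub).trans ((measure_union_le _ _).trans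
    ((add_le_add ((measure_union_le _ _).trans (add_le_add hE1 hNfar)) ?_).trans (le_of_eq
      (a := ENNReal.ofReal (e / 3) + ENNReal.ofReal (e / 3) + ENNReal.ofReal (e / 3)) ?_)))
  · calc _ ≤ ∑ j ∈ Finset.range (Nat.log 2 N + 2), ∑ b ∈ htfin.toFinset,
          ∑ i : Fin m, ENNReal.ofReal (R N) := by
          refine (measure_biUnion_finset_le _ _).trans (Finset.sum_le_sum fun j _ => ?_)
          refine (measure_biUnion_finset_le _ _).trans (Finset.sum_le_sum fun b hb => ?_)
          refine (measure_biUnion_finset_le _ _).trans (Finset.sum_le_sum fun i _ => ?_)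
          exact hE3 j b (by simpa using hb) i
      _ = ENNReal.ofReal ((htfin.toFinset.card * m : ℝ) * (((Nat.log 2 N + 2 : ℕ) : ℝ) * R N)) := by
          simp only [Finset.sum_const, Finset.card_range, Finset.card_univ, Fintype.card_fin,
            nsmul_eq_mul]
          rw [← ENNReal.ofReal_natCast, ← ENNReal.ofReal_natCast, ← ENNReal.ofReal_natCast,
            ← ENNReal.ofReal_mul (by positivity), ← ENNReal.ofReal_mul (by positivity),
            ← ENNReal.ofReal_mul (by positivity)]
          congr 1
          ring
      _ ≤ _ := ENNReal.ofReal_le_ofReal hNR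
  · rw [← ENNReal.ofReal_add (by positivity) (by positivity),
      ← ENNReal.ofReal_add (by positivity) (by positivity)]
    congr 1
    ring

end IsDesign
end RegularModel
end Stackelberg

/-! ### Asymptotic normality of the estimate for convergent designs. -/

namespace Stackelberg

namespace RegularModel

variable {X U : Type*} [MeasurableSpace X] [MetricSpace U] [MeasurableSpace U] {m : ℕ}
  (M : RegularModel X U m)

/-- The score at `θ₀` in the direction `a`. -/
noncomputable def dirScore (a : EuclideanSpace ℝ (Fin m)) (x : X) (u : U) : ℝ :=
  inner ℝ (M.s x u M.θ₀) a

lemma dirScore_eq_sum (a : EuclideanSpace ℝ (Fin m)) (x : X) (u : U) :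
    M.dirScore a x u = ∑ i, M.s x u M.θ₀ i * a i := by
  simp [dirScore, PiLp.inner_apply, mul_comm]

lemma integral_dirScore (a : EuclideanSpace ℝ (Fin m)) (u : U) :
    ∫ x, M.dirScore a x u ∂(M.law u M.θ₀) = 0 := by
  simp only [dirScore_eq_sum]
  rw [integral_finsetSum _ fun i _ => (M.integrable_s_apply u i M.mem_Θ).mul_const _]
  refine Finset.sum_eq_zero fun i _ => ?_
  rw [integral_mul_const]
  have : ∫ x, M.s x u M.θ₀ i ∂(M.law u M.θ₀) = 0 := M.integral_s u _ M.mem_Θ i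
  rw [this, zero_mul]

lemma moment_dirScore (a : EuclideanSpace ℝ (Fin m)) (u : U) :
    ∫⁻ x, ‖M.dirScore a x u‖ₑ ^ (3 : ℝ) ∂(M.law u M.θ₀) ≤ (‖a‖₊ ^ 3 * M.C : ℝ≥0) := by
  calc ∫⁻ x, ‖M.dirScore a x u‖ₑ ^ (3 : ℝ) ∂(M.law u M.θ₀)
      ≤ ∫⁻ x, ‖a‖ₑ ^ (3 : ℝ) * ‖M.s x u M.θ₀‖ₑ ^ (3 : ℝ) ∂(M.law u M.θ₀) := by
        refine lintegral_mono fun x => ?_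
        rw [← ENNReal.mul_rpow_of_nonneg _ _ (by norm_num)]
        refine ENNReal.rpow_le_rpow ?_ (by norm_num)
        rw [← ofReal_norm, ← ofReal_norm, ← ofReal_norm, ← ENNReal.ofReal_mul (norm_nonneg _),
          mul_comm]
        exact ENNReal.ofReal_le_ofReal (norm_inner_le_norm _ _)
    _ = ‖a‖ₑ ^ (3 : ℝ) * ∫⁻ x, ‖M.s x u M.θ₀‖ₑ ^ (3 : ℝ) ∂(M.law u M.θ₀) :=
        lintegral_const_mul _ ((M.measurable_s u _ M.mem_Θ).enorm.pow_const _)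
    _ ≤ ‖a‖ₑ ^ (3 : ℝ) * M.C := mul_le_mul_right (M.third_moment u _ M.mem_Θ) _
    _ = _ := by
        rw [ENNReal.coe_mul, ENNReal.coe_pow, show (3 : ℝ) = (3 : ℕ) by norm_num,
          ENNReal.rpow_natCast]
        rfl

lemma integral_dirScore_sq (a : EuclideanSpace ℝ (Fin m)) (u : U) :
    ∫ x, M.dirScore a x u ^ 2 ∂(M.law u M.θ₀) = a.ofLp ⬝ᵥ (M.info u M.θ₀).mulVec a.ofLp := by
  have h : ∀ x, M.dirScore a x u ^ 2 =
      ∑ i, ∑ j, M.s x u M.θ₀ i * M.s x u M.θ₀ j * (a i * a j) := fun x => by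
    rw [sq, dirScore_eq_sum, Finset.sum_mul_sum]
    exact Finset.sum_congr rfl fun i _ => Finset.sum_congr rfl fun j _ => by ring
  simp only [h]
  have hi : ∀ i j, Integrable (fun x => M.s x u M.θ₀ i * M.s x u M.θ₀ j * (a i * a j))
      (M.law u M.θ₀) := fun i j => (M.integrable_mul_s i j u M.mem_Θ M.mem_Θ).mul_const _
  rw [integral_finsetSum _ fun i _ => integrable_finsetSum _ fun j _ => hi i j]
  simp only [dotProduct, Matrix.mulVec, Finset.mul_sum]
  refine Finset.sum_congr rfl fun i _ => ?_
  rw [integral_finsetSum _ fun j _ => hi i j]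
  refine Finset.sum_congr rfl fun j _ => ?_
  rw [integral_mul_const]
  simp only [info, crossInfo, Matrix.of_apply]
  ring

lemma continuous_integral_dirScore_sq (a : EuclideanSpace ℝ (Fin m)) :
    Continuous (M.mean fun x u => M.dirScore a x u ^ 2) := by
  have h : M.mean (fun x u => M.dirScore a x u ^ 2) =
      fun u => a.ofLp ⬝ᵥ (M.info u M.θ₀).mulVec a.ofLp :=
    funext fun u => M.integral_dirScore_sq a u
  rw [h]
  have hc : Continuous fun u => M.info u M.θ₀ :=
    M.continuousOn_info.comp_continuous (f := fun u : U => (u, M.θ₀)) (by fun_prop)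
      fun u => ⟨trivial, M.mem_Θ⟩
  exact continuous_const.dotProduct (hc.matrix_mulVec continuous_const)

/-- The inverse information operator. -/
noncomputable def invInfo (u : U) : EuclideanSpace ℝ (Fin m) →L[ℝ] EuclideanSpace ℝ (Fin m) :=
  Matrix.toEuclideanCLM (𝕜 := ℝ) (M.info u M.θ₀)⁻¹

/-- The normalized total score, to which the estimation error is asymptotically equal. -/
noncomputable def scaledScore {Ω : Type*} (v : ℕ → Ω → U) (y : ℕ → Ω → X) (u₀ : U) (N : ℕ) (ω : Ω) :
    EuclideanSpace ℝ (Fin m) :=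
  M.invInfo u₀ ((√N)⁻¹ • ∑ k ∈ Finset.range N, M.s (y k ω) (v k ω) M.θ₀)

namespace IsDesign

variable {M} [BorelSpace U] [SecondCountableTopology U] [SFinite M.ν]
  {Ω : Type*} {mΩ : MeasurableSpace Ω} {μ : Measure Ω} [IsProbabilityMeasure μ]
  {ℱ : Filtration ℕ mΩ} {v : ℕ → Ω → U} {y : ℕ → Ω → X} (h : M.IsDesign μ ℱ v y)
include h

omit [SFinite M.ν] [IsProbabilityMeasure μ] in
lemma measurable_scaledScore (u₀ : U) (N : ℕ) : Measurable (M.scaledScore v y u₀ N) := by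
  have hk := h.measurable_obs' (M.measurable_uncurry_s M.mem_Θ)
  have hsum : Measurable fun ω => (√N)⁻¹ • ∑ k ∈ Finset.range N, M.s (y k ω) (v k ω) M.θ₀ := by
    fun_prop
  exact (M.invInfo u₀).continuous.measurable.comp hsum

/-- The Cramér–Wold reduction: the test vector `t` is moved onto the score by the adjoint, giving
the direction `a = I⁻¹ t`, where `I` is the information at `u₀`. The scalar limit theorem has
variance `aᵀ I a = tᵀ I⁻¹ t`. -/
theorem tendsto_charFun_scaledScore [CompactSpace U] {u₀ : U}
    (hv : ∀ ε > 0, Tendsto (fun k => μ {ω | ε ≤ dist (v k ω) u₀}) atTop (𝓝 0))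
    (hpos : (M.info u₀ M.θ₀).PosDef) (t : EuclideanSpace ℝ (Fin m)) :
    Tendsto (fun N => charFun (μ.map (M.scaledScore v y u₀ N)) t) atTop
      (𝓝 (charFun (multivariateGaussian 0 (M.info u₀ M.θ₀)⁻¹) t)) := by
  set a : EuclideanSpace ℝ (Fin m) := ContinuousLinearMap.adjoint (M.invInfo u₀) t with ha
  obtain ⟨c, hc⟩ := (isCompact_range (M.continuous_integral_dirScore_sq a)).bddAbove
  have hf : Measurable (Function.uncurry (M.dirScore a)) :=
    (M.measurable_uncurry_s M.mem_Θ).inner_const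
  have key := h.tendsto_integral_cexp_sum hf (M.moment_dirScore a) (M.integral_dirScore a)
    (fun u => hc ⟨u, rfl⟩) (M.continuous_integral_dirScore_sq a).continuousAt hv
  have hL : ∀ N, charFun (μ.map (M.scaledScore v y u₀ N)) t = ∫ ω, Complex.exp
      (((√N)⁻¹ * ∑ k ∈ Finset.range N, M.dirScore a (y k ω) (v k ω) : ℝ) * Complex.I) ∂μ := by
    intro N
    rw [charFun_apply, integral_map (h.measurable_scaledScore u₀ N).aemeasurable
      (by fun_prop)]
    refine integral_congr_ae (ae_of_all _ fun ω => ?_)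
    simp only
    congr 3
    rw [scaledScore, ← ContinuousLinearMap.adjoint_inner_right, real_inner_smul_left, sum_inner]
    rfl
  have hR : charFun (multivariateGaussian 0 (M.info u₀ M.θ₀)⁻¹) t =
      (Real.exp (-(M.mean (fun x u => M.dirScore a x u ^ 2) u₀) / 2) : ℝ) := by
    rw [charFun_multivariateGaussian hpos.inv.posSemidef]
    have hdet : IsUnit (M.info u₀ M.θ₀).det := hpos.det_pos.ne'.isUnit
    have haL : a.ofLp = (M.info u₀ M.θ₀)⁻¹.mulVec t.ofLp := by
      have hadj : ContinuousLinearMap.adjoint (M.invInfo u₀) = M.invInfo u₀ := by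
        rw [invInfo, ← ContinuousLinearMap.star_eq_adjoint, ← map_star, Matrix.star_eq_conjTranspose,
          hpos.inv.isHermitian.eq]
      rw [ha, hadj, invInfo, Matrix.ofLp_toEuclideanCLM]
    have hmean : M.mean (fun x u => M.dirScore a x u ^ 2) u₀ =
        t.ofLp ⬝ᵥ (M.info u₀ M.θ₀)⁻¹.mulVec t.ofLp := by
      rw [mean, integral_dirScore_sq, haL, Matrix.mulVec_mulVec, Matrix.mul_nonsing_inv _ hdet,
        Matrix.one_mulVec, dotProduct_comm]
    rw [hmean, Complex.ofReal_exp]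
    congr 1
    simp
    ring
  rw [hR]
  simp only [hL]
  exact key

theorem tendstoInDistribution_scaledScore [CompactSpace U] {u₀ : U}
    (hv : ∀ ε > 0, Tendsto (fun k => μ {ω | ε ≤ dist (v k ω) u₀}) atTop (𝓝 0))
    (hpos : (M.info u₀ M.θ₀).PosDef) :
    TendstoInDistribution (M.scaledScore v y u₀) atTop id (fun _ => μ)
      (multivariateGaussian 0 (M.info u₀ M.θ₀)⁻¹) where
  forall_aemeasurable N := (h.measurable_scaledScore u₀ N).aemeasurable
  aemeasurable_limit := aemeasurable_id
  tendsto := ProbabilityMeasure.tendsto_iff_tendsto_charFun.2 fun t => by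
    simpa using h.tendsto_charFun_scaledScore hv hpos t

/-- Tightness, from convergence of characteristic functions to a limit continuous at zero. It
absorbs the error in `norm_sub_scaledScore_le` that is proportional to the estimation error itself.
-/
lemma exists_measure_lt_norm_scaledScore_le [CompactSpace U] {u₀ : U}
    (hv : ∀ ε > 0, Tendsto (fun k => μ {ω | ε ≤ dist (v k ω) u₀}) atTop (𝓝 0))
    (hpos : (M.info u₀ M.θ₀).PosDef) {e : ℝ} (he : 0 < e) :
    ∃ K > 0, ∀ N, μ {ω | K < ‖M.scaledScore v y u₀ N ω‖} ≤ ENNReal.ofReal e := by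
  have hprob : ∀ N, IsProbabilityMeasure (μ.map (M.scaledScore v y u₀ N)) := fun N =>
    Measure.isProbabilityMeasure_map (h.measurable_scaledScore u₀ N).aemeasurable
  have ht := isTightMeasureSet_of_tendsto_charFun (μ := fun N => μ.map (M.scaledScore v y u₀ N))
    (f := charFun (multivariateGaussian 0 (M.info u₀ M.θ₀)⁻¹))
    (continuous_charFun.continuousAt) (h.tendsto_charFun_scaledScore hv hpos)
  rw [isTightMeasureSet_iff_tendsto_measure_norm_gt] at ht
  obtain ⟨K, hK, hK0⟩ := ((ht.eventually_lt_const (ENNReal.ofReal_pos.2 he)).and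
    (eventually_gt_atTop 0)).exists
  refine ⟨K, hK0, fun N => ?_⟩
  have h1 : μ.map (M.scaledScore v y u₀ N) {x | K < ‖x‖} ≤ ENNReal.ofReal e :=
    (le_iSup₂ (f := fun (ρ : Measure (EuclideanSpace ℝ (Fin m)))
      (_ : ρ ∈ Set.range fun N => μ.map (M.scaledScore v y u₀ N)) => ρ {x | K < ‖x‖})
      _ ⟨N, rfl⟩).trans hK.le
  rwa [Measure.map_apply (h.measurable_scaledScore u₀ N)
    (measurableSet_lt measurable_const measurable_norm)] at h1

omit [BorelSpace U] [SecondCountableTopology U] [SFinite M.ν] h in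
/-- The total score vanishes at an interior maximizer of the likelihood. -/
lemma sum_s_eq_zero {N : ℕ} {ω : Ω} {θ : EuclideanSpace ℝ (Fin m)}
    (hθ : θ ∈ Metric.ball M.θ₀ M.r)
    (hmax : ∀ θ' ∈ M.Θ, ∑ k ∈ Finset.range N, M.φ (y k ω) (v k ω) θ' ≤
      ∑ k ∈ Finset.range N, M.φ (y k ω) (v k ω) θ) :
    ∑ k ∈ Finset.range N, M.s (y k ω) (v k ω) θ = 0 := by
  have hd : HasFDerivAt (fun θ => ∑ k ∈ Finset.range N, M.φ (y k ω) (v k ω) θ)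
      (∑ k ∈ Finset.range N, innerSL ℝ (M.s (y k ω) (v k ω) θ)) θ :=
    HasFDerivAt.fun_sum fun k _ => M.hasFDerivAt _ _ hθ
  have hloc : IsLocalMax (fun θ => ∑ k ∈ Finset.range N, M.φ (y k ω) (v k ω) θ) θ := by
    filter_upwards [Metric.isOpen_ball.mem_nhds hθ] with θ' hθ'
    exact hmax θ' (M.ball_subset hθ')
  have h0 := hloc.hasFDerivAt_eq_zero hd
  rw [← map_sum] at h0
  exact inner_self_eq_zero.1 (DFunLike.congr_fun h0 _)

omit [BorelSpace U] [SecondCountableTopology U] [SFinite M.ν] h in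
/-- A bound on the remainder at an interior maximizer of the likelihood shows that the scaled
estimation error is close to the scaled score. -/
lemma norm_sub_scaledScore_le {N : ℕ} (hN : 0 < N) {ω : Ω} {θ : EuclideanSpace ℝ (Fin m)} {u₀ : U}
    (hpos : (M.info u₀ M.θ₀).PosDef)
    (hzero : ∑ k ∈ Finset.range N, M.s (y k ω) (v k ω) θ = 0) {η : ℝ}
    (hrem : ∀ i, |M.remainder v y u₀ N θ i ω| ≤ η * (‖θ - M.θ₀‖ + (√N)⁻¹) * N) :
    ‖√(N : ℝ) • (θ - M.θ₀) - M.scaledScore v y u₀ N ω‖ ≤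
      ‖M.invInfo u₀‖ * (m * η * (‖√(N : ℝ) • (θ - M.θ₀)‖ + 1)) := by
  have hN0 : (0 : ℝ) < N := by exact_mod_cast hN
  have hsq : 0 < √(N : ℝ) := Real.sqrt_pos.2 hN0
  have hss : √(N : ℝ) * √(N : ℝ) = N := Real.mul_self_sqrt hN0.le
  set I := Matrix.toEuclideanCLM (𝕜 := ℝ) (M.info u₀ M.θ₀) with hI
  set Y := √(N : ℝ) • (θ - M.θ₀) with hY
  set S := (√(N : ℝ))⁻¹ • ∑ k ∈ Finset.range N, M.s (y k ω) (v k ω) M.θ₀ with hS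
  have hinv : M.invInfo u₀ (I Y) = Y := by
    rw [invInfo, hI, ← mul_apply_eq_comp, ← map_mul,
      Matrix.nonsing_inv_mul _ hpos.det_pos.ne'.isUnit, map_one, one_apply_eq_self]
  have hdiff : Y - M.scaledScore v y u₀ N ω = M.invInfo u₀ (I Y - S) := by
    rw [map_sub, hinv, scaledScore]
  -- Because the total score vanishes at `θ`, the linearization remainder is exactly the defect of
  -- the linear equation `I Y = S`.
  have hcoord : ∀ i, M.remainder v y u₀ N θ i ω = √(N : ℝ) * (I Y - S) i := by
    intro i
    have h1 : ∑ k ∈ Finset.range N, M.s (y k ω) (v k ω) θ i = 0 := by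
      have := congrArg (fun z : EuclideanSpace ℝ (Fin m) => z i) hzero
      simpa using this
    have h2 : (I Y) i = √(N : ℝ) * ∑ j, M.info u₀ M.θ₀ i j * (θ - M.θ₀) j := by
      rw [hI, Matrix.ofLp_toEuclideanCLM, Matrix.mulVec, dotProduct, Finset.mul_sum]
      refine Finset.sum_congr rfl fun j _ => ?_
      rw [hY, PiLp.smul_apply, smul_eq_mul]
      ring
    have h3 : S i = (√(N : ℝ))⁻¹ * ∑ k ∈ Finset.range N, M.s (y k ω) (v k ω) M.θ₀ i := by
      rw [hS, PiLp.smul_apply, smul_eq_mul]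
      simp
    rw [remainder, Finset.sum_sub_distrib, h1, PiLp.sub_apply, h2, h3, mul_sub, ← mul_assoc, hss,
      ← mul_assoc, mul_inv_cancel₀ hsq.ne']
    ring
  have hbound : ∀ i, ‖(I Y - S) i‖ ≤ η * (‖Y‖ + 1) := by
    intro i
    have h1 := hrem i
    rw [hcoord, abs_mul, abs_of_pos hsq] at h1
    have h2 : η * (‖θ - M.θ₀‖ + (√(N : ℝ))⁻¹) * N = √(N : ℝ) * (η * (‖Y‖ + 1)) := by
      rw [hY, norm_smul, Real.norm_of_nonneg hsq.le]
      nth_rewrite 2 [← hss]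
      field_simp
    rw [h2] at h1
    exact le_of_mul_le_mul_left h1 hsq
  rw [hdiff]
  refine (ContinuousLinearMap.le_opNorm _ _).trans (mul_le_mul_of_nonneg_left ?_ (norm_nonneg _))
  calc ‖I Y - S‖ ≤ ∑ i, ‖(I Y - S) i‖ := by
        rw [EuclideanSpace.norm_eq]
        refine Real.sqrt_le_left (Finset.sum_nonneg fun i _ => norm_nonneg _) |>.2 ?_
        exact Finset.sum_sq_le_sq_sum_of_nonneg fun i _ => norm_nonneg _
    _ ≤ ∑ _i : Fin m, η * (‖Y‖ + 1) := Finset.sum_le_sum fun i _ => hbound i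
    _ = m * η * (‖Y‖ + 1) := by
        rw [Finset.sum_const, Finset.card_univ, Fintype.card_fin, nsmul_eq_mul]
        ring

/-- Outside events of total probability at most `e`, the estimate is an interior zero of the total
score, the scaled score is at most `K`, and the linearization holds. The resulting estimate bounds
the difference by `κ` times the scaled error plus one, and a small `κ` can be absorbed. -/
theorem tendstoInMeasure_sub_scaledScore [CompactSpace U] {u₀ : U}
    (hv : ∀ ε > 0, Tendsto (fun k => μ {ω | ε ≤ dist (v k ω) u₀}) atTop (𝓝 0))
    (hpos : (M.info u₀ M.θ₀).PosDef) {θhat : ℕ → Ω → EuclideanSpace ℝ (Fin m)}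
    (hest : ∀ᶠ N : ℕ in atTop, ∀ᵐ ω ∂μ, θhat N ω ∈ M.Θ ∧ ∀ θ ∈ M.Θ,
      ∑ k ∈ Finset.range N, M.φ (y k ω) (v k ω) θ ≤
        ∑ k ∈ Finset.range N, M.φ (y k ω) (v k ω) (θhat N ω)) :
    TendstoInMeasure μ ((fun (N : ℕ) ω => √(N : ℝ) • (θhat N ω - M.θ₀)) -
      M.scaledScore v y u₀) atTop 0 := by
  rw [tendstoInMeasure_iff_norm]
  intro ε hε
  refine tendsto_zero_of_forall_le_ofReal fun e he => ?_
  obtain ⟨K, hK0, hK⟩ := h.exists_measure_lt_norm_scaledScore_le hv hpos (by positivity : 0 < e / 3)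
  set A := ‖M.invInfo u₀‖
  have hA : 0 ≤ A := norm_nonneg _
  -- The bound `1 / 2` moves the difference from the right to the left side, leaving at most `2 * κ
  -- * (K + 1)`; the other bound makes this at most `ε / 2`.
  set κ : ℝ := min (1 / 2) (ε / (4 * (K + 1))) with hκ
  have hκ0 : 0 < κ := lt_min (by norm_num) (by positivity)
  set η : ℝ := κ / (A * m + 1) with hη
  have hη0 : 0 < η := by positivity
  have hAη : A * (m * η) ≤ κ := by
    rw [hη]
    have : A * (m * (κ / (A * m + 1))) = κ * ((A * m) / (A * m + 1)) := by ring
    rw [this]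
    refine mul_le_of_le_one_right hκ0.le ((div_le_one (by positivity)).2 (by linarith))
  obtain ⟨r, hr0, hrr, hrem⟩ := h.exists_measure_remainder_le hv hη0 (by positivity : 0 < e / 3)
  have hfar := (h.tendsto_measure_exists_far hr0).eventually_le_const
    (ENNReal.ofReal_pos.2 (by positivity : 0 < e / 3))
  filter_upwards [hrem, hfar, hest, eventually_gt_atTop 0] with N hNrem hNfar hNest hN
  have hsub : {ω | ε ≤ ‖((fun (N : ℕ) ω => √(N : ℝ) • (θhat N ω - M.θ₀)) -
      M.scaledScore v y u₀) N ω - (0 : ℕ → Ω → EuclideanSpace ℝ (Fin m)) N ω‖} ⊆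
      (({ω | K < ‖M.scaledScore v y u₀ N ω‖} ∪ {ω | ∃ θ ∈ Metric.ball M.θ₀ r, ∃ i,
        η * (‖θ - M.θ₀‖ + (√N)⁻¹) * N < |M.remainder v y u₀ N θ i ω|}) ∪
      {ω | ∃ θ ∈ M.Θ, r ≤ ‖θ - M.θ₀‖ ∧ ∑ k ∈ Finset.range N, M.φ (y k ω) (v k ω) M.θ₀ ≤
        ∑ k ∈ Finset.range N, M.φ (y k ω) (v k ω) θ}) ∪
      {ω | ¬ (θhat N ω ∈ M.Θ ∧ ∀ θ ∈ M.Θ, ∑ k ∈ Finset.range N, M.φ (y k ω) (v k ω) θ ≤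
        ∑ k ∈ Finset.range N, M.φ (y k ω) (v k ω) (θhat N ω))} := by
    intro ω hω
    by_contra hcon
    simp only [Set.mem_union, not_or, Set.mem_ofPred_eq, not_not] at hcon hω
    obtain ⟨⟨⟨h1, h2⟩, h3⟩, h4, h5⟩ := hcon
    push Not at h1 h2 h3
    have hclose : ‖θhat N ω - M.θ₀‖ < r := by
      by_contra! hge
      exact absurd (h5 M.θ₀ M.mem_Θ) (not_le.2 (h3 _ h4 hge))
    have hball : θhat N ω ∈ Metric.ball M.θ₀ r := by rwa [mem_ball_iff_norm]
    have hzero := sum_s_eq_zero (v := v) (y := y) (N := N) (ω := ω)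
      (Metric.ball_subset_ball hrr hball) h5
    have hb := norm_sub_scaledScore_le hN hpos hzero (h2 _ hball)
    simp only [Pi.sub_apply, Pi.zero_apply, sub_zero] at hω
    set Y := √(N : ℝ) • (θhat N ω - M.θ₀)
    set X' := M.scaledScore v y u₀ N ω
    have hYX : ‖Y‖ ≤ ‖Y - X'‖ + ‖X'‖ := by simpa using norm_add_le (Y - X') X'
    have hb2 : ‖Y - X'‖ ≤ κ * (‖Y‖ + 1) := by
      refine hb.trans ?_
      have := mul_le_mul_of_nonneg_right hAη (by positivity : 0 ≤ ‖Y‖ + 1)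
      linarith
    have hκ1 : κ ≤ 1 / 2 := min_le_left _ _
    have hκ2 : κ * (4 * (K + 1)) ≤ ε := by
      rw [← le_div_iff₀ (by positivity)]
      exact min_le_right _ _
    have : ‖Y - X'‖ ≤ 2 * κ * (K + 1) := by
      have h6 : κ * (‖Y‖ + 1) ≤ κ * (‖Y - X'‖ + (K + 1)) :=
        mul_le_mul_of_nonneg_left (by linarith) hκ0.le
      have h7 : κ * ‖Y - X'‖ ≤ 1 / 2 * ‖Y - X'‖ := by gcongr
      nlinarith
    linarith
  refine (measure_mono hsub).trans ((measure_union_le _ _).trans ?_)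
  rw [show μ {ω | ¬ (θhat N ω ∈ M.Θ ∧ ∀ θ ∈ M.Θ, ∑ k ∈ Finset.range N, M.φ (y k ω) (v k ω) θ ≤
    ∑ k ∈ Finset.range N, M.φ (y k ω) (v k ω) (θhat N ω))} = 0 from hNest, add_zero]
  refine (measure_union_le _ _).trans ((add_le_add ((measure_union_le _ _).trans
    (add_le_add (hK N) hNrem)) hNfar).trans (le_of_eq ?_))
  rw [← ENNReal.ofReal_add (by positivity) (by positivity),
    ← ENNReal.ofReal_add (by positivity) (by positivity)]
  congr 1
  ring

/-- **Asymptotic normality of the maximum likelihood estimator** for a design that converges in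
probability. -/
theorem tendstoInDistribution_estimator [CompactSpace U] {u₀ : U}
    (hv : ∀ ε > 0, Tendsto (fun k => μ {ω | ε ≤ dist (v k ω) u₀}) atTop (𝓝 0))
    (hpos : (M.info u₀ M.θ₀).PosDef) {θhat : ℕ → Ω → EuclideanSpace ℝ (Fin m)}
    (hθhat : ∀ N, Measurable (θhat N))
    (hest : ∀ᶠ N : ℕ in atTop, ∀ᵐ ω ∂μ, θhat N ω ∈ M.Θ ∧ ∀ θ ∈ M.Θ,
      ∑ k ∈ Finset.range N, M.φ (y k ω) (v k ω) θ ≤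
        ∑ k ∈ Finset.range N, M.φ (y k ω) (v k ω) (θhat N ω)) :
    TendstoInDistribution (fun (N : ℕ) ω => √(N : ℝ) • (θhat N ω - M.θ₀)) atTop id
      (fun _ => μ) (multivariateGaussian 0 (M.info u₀ M.θ₀)⁻¹) :=
  tendstoInDistribution_of_tendstoInMeasure_sub _ _ (h.tendstoInDistribution_scaledScore hv hpos)
    (h.tendstoInMeasure_sub_scaledScore hv hpos hest)
    fun N => by have := hθhat N; fun_prop

/-- **Consistency of the maximum likelihood estimator** for an arbitrary design. -/
theorem tendsto_measure_le_norm_estimator_sub [CompactSpace U]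
    {θhat : ℕ → Ω → EuclideanSpace ℝ (Fin m)}
    (hest : ∀ᶠ N : ℕ in atTop, ∀ᵐ ω ∂μ, θhat N ω ∈ M.Θ ∧ ∀ θ ∈ M.Θ,
      ∑ k ∈ Finset.range N, M.φ (y k ω) (v k ω) θ ≤
        ∑ k ∈ Finset.range N, M.φ (y k ω) (v k ω) (θhat N ω)) {ε : ℝ} (hε : 0 < ε) :
    Tendsto (fun N => μ {ω | ε ≤ ‖θhat N ω - M.θ₀‖}) atTop (𝓝 0) := by
  refine tendsto_of_tendsto_of_tendsto_of_le_of_le' tendsto_const_nhds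
    (h.tendsto_measure_exists_far hε) (Eventually.of_forall fun _ => zero_le) ?_
  filter_upwards [hest] with N hN
  refine measure_mono_ae ?_
  filter_upwards [hN] with ω hω hfar
  exact ⟨θhat N ω, hω.1, hfar, hω.2 _ M.mem_Θ⟩

end IsDesign

end RegularModel

end Stackelberg

/-! ### Continuity of the criteria and convergence of the designs. -/

namespace Stackelberg

-- Lower bounds on the smallest eigenvalue become semidefiniteness, which is preserved by sums;
-- perturbations can then be compared without eigenvectors.
open scoped MatrixOrder in
lemma le_sInf_spectrum_iff {m : ℕ} [Nonempty (Fin m)] {A : Matrix (Fin m) (Fin m) ℝ}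
    (hA : A.IsHermitian) {c : ℝ} :
    c ≤ sInf (spectrum ℝ A) ↔ (A - algebraMap ℝ (Matrix (Fin m) (Fin m) ℝ) c).PosSemidef := by
  have hne : (spectrum ℝ A).Nonempty := by
    rw [hA.spectrum_real_eq_range_eigenvalues]
    exact Set.range_nonempty _
  have hbdd : BddBelow (spectrum ℝ A) := by
    rw [hA.spectrum_real_eq_range_eigenvalues]
    exact (Set.finite_range _).bddBelow
  rw [← Matrix.le_iff, algebraMap_le_iff_le_spectrum (a := A) (r := c) (ha := hA),
    le_csInf_iff hbdd hne]

/-- In the quadratic form every `|x i| * |x j|` is at most `x ⬝ᵥ x`, so its absolute value is at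
most the sum of the entries of `|D|` times `x ⬝ᵥ x`. -/
lemma posSemidef_add_sum_abs {m : ℕ} {D : Matrix (Fin m) (Fin m) ℝ} (hD : D.IsHermitian) :
    (D + algebraMap ℝ (Matrix (Fin m) (Fin m) ℝ) (∑ i, ∑ j, |D i j|)).PosSemidef := by
  refine Matrix.PosSemidef.of_dotProduct_mulVec_nonneg ?_ fun x => ?_
  · refine hD.add ?_
    rw [Matrix.algebraMap_eq_diagonal]
    exact Matrix.isHermitian_diagonal _
  · have h1 : ∀ i, |x i| ^ 2 ≤ x ⬝ᵥ x := fun i => by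
      rw [sq_abs, sq, dotProduct]
      exact Finset.single_le_sum (f := fun i => x i * x i) (fun j _ => mul_self_nonneg _)
        (Finset.mem_univ i)
    have h2 : ∀ i j, -(|D i j| * (x ⬝ᵥ x)) ≤ x i * (D i j * x j) := fun i j => by
      have h3 : |x i| * |x j| ≤ x ⬝ᵥ x := by nlinarith [h1 i, h1 j, sq_nonneg (|x i| - |x j|)]
      have h4 : |x i * (D i j * x j)| ≤ |D i j| * (x ⬝ᵥ x) := by
        rw [abs_mul, abs_mul]
        nlinarith [mul_le_mul_of_nonneg_left h3 (abs_nonneg (D i j))]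
      exact (abs_le.1 h4).1
    have h5 : x ⬝ᵥ D.mulVec x = ∑ i, ∑ j, x i * (D i j * x j) := by
      simp only [dotProduct, Matrix.mulVec, Finset.mul_sum]
    rw [star_trivial, Matrix.add_mulVec, dotProduct_add, Algebra.algebraMap_eq_smul_one,
      Matrix.smul_mulVec, Matrix.one_mulVec, dotProduct_smul, smul_eq_mul, h5, Finset.sum_mul]
    simp only [Finset.sum_mul]
    rw [← Finset.sum_add_distrib]
    refine Finset.sum_nonneg fun i _ => ?_
    rw [← Finset.sum_add_distrib]
    exact Finset.sum_nonneg fun j _ => by linarith [h2 i j]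

/-- The smallest eigenvalue is a Lipschitz function of the matrix. -/
lemma sInf_spectrum_sub_le {m : ℕ} [Nonempty (Fin m)] {A B : Matrix (Fin m) (Fin m) ℝ}
    (hA : A.IsHermitian) (hB : B.IsHermitian) :
    sInf (spectrum ℝ A) - ∑ i, ∑ j, |(B - A) i j| ≤ sInf (spectrum ℝ B) := by
  rw [le_sInf_spectrum_iff hB]
  have h := ((le_sInf_spectrum_iff hA).1 le_rfl).add (posSemidef_add_sum_abs (hB.sub hA))
  convert! h using 1
  rw [map_sub]
  abel

lemma continuousOn_sInf_spectrum (m : ℕ) :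
    ContinuousOn (fun A : Matrix (Fin m) (Fin m) ℝ => sInf (spectrum ℝ A)) {A | A.IsHermitian} := by
  rcases isEmpty_or_nonempty (Fin m) with he | hne
  · exact continuous_of_const (fun A B => by rw [Subsingleton.elim A B]) |>.continuousOn
  · intro A hA
    have hlim : Tendsto (fun B : Matrix (Fin m) (Fin m) ℝ => ∑ i, ∑ j, |(B - A) i j|)
        (𝓝[{A | A.IsHermitian}] A) (𝓝 0) := by
      have hc : Continuous fun B : Matrix (Fin m) (Fin m) ℝ => ∑ i, ∑ j, |(B - A) i j| := by
        refine continuous_finsetSum _ fun i _ => continuous_finsetSum _ fun j _ => ?_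
        exact ((continuous_id.sub continuous_const).matrix_elem i j).abs
      have := hc.tendsto A
      simp only [sub_self, Matrix.zero_apply, abs_zero, Finset.sum_const_zero] at this
      exact this.mono_left nhdsWithin_le_nhds
    rw [ContinuousWithinAt, tendsto_iff_dist_tendsto_zero]
    refine squeeze_zero' (Eventually.of_forall fun _ => dist_nonneg) ?_ hlim
    filter_upwards [self_mem_nhdsWithin] with B hB
    have h1 := sInf_spectrum_sub_le hA hB
    have h2 := sInf_spectrum_sub_le hB hA
    have h3 : ∑ i, ∑ j, |(A - B) i j| = ∑ i, ∑ j, |(B - A) i j| :=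
      Finset.sum_congr rfl fun i _ => Finset.sum_congr rfl fun j _ => by
        rw [← neg_sub B A, Matrix.neg_apply, abs_neg]
    rw [h3] at h2
    rw [Real.dist_eq, abs_le]
    constructor <;> linarith

/-- The optimality criteria are continuous on symmetric matrices. -/
lemma Criterion.continuousOn_eval {m : ℕ} (c : Criterion) :
    ContinuousOn (c.eval : Matrix (Fin m) (Fin m) ℝ → ℝ) {A | A.IsHermitian} := by
  cases c with
  | A => exact (continuous_id.matrix_trace).continuousOn
  -- For `m = 0` the exponent `1 / m` is zero by convention; a nonnegative exponent is all that
  -- continuity of the power requires.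
  | D => exact ((Real.continuous_rpow_const (by positivity)).comp
      (continuous_id.matrix_det)).continuousOn
  | E => exact continuousOn_sInf_spectrum m

namespace RegularModel

variable {X U : Type*} [MeasurableSpace X] [MetricSpace U] [MeasurableSpace U] {m : ℕ}
  (M : RegularModel X U m)

lemma isHermitian_info (u : U) (θ : EuclideanSpace ℝ (Fin m)) : (M.info u θ).IsHermitian := by
  ext i j
  simp only [Matrix.conjTranspose_apply, star_trivial, info, Matrix.of_apply, crossInfo, mul_comm]

lemma continuousOn_eval_info (c : Criterion) :
    ContinuousOn (fun z : U × EuclideanSpace ℝ (Fin m) => c.eval (M.info z.1 z.2))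
      (Set.univ ×ˢ M.Θ) :=
  c.continuousOn_eval.comp M.continuousOn_info fun z _ => M.isHermitian_info z.1 z.2

variable {M} [BorelSpace U] [SecondCountableTopology U] [SFinite M.ν]
  {Ω : Type*} {mΩ : MeasurableSpace Ω} {μ : Measure Ω} [IsProbabilityMeasure μ]
  {ℱ : Filtration ℕ mΩ} {v : ℕ → Ω → U} {y : ℕ → Ω → X}

/-- Designs maximizing the criterion at a consistent estimate converge in probability to the
maximizer at the true parameter. -/
theorem IsDesign.tendsto_measure_le_dist_design [CompactSpace U] (h : M.IsDesign μ ℱ v y)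
    (c : Criterion) {u₀ : U}
    (huniq : ∀ u, u ≠ u₀ → c.eval (M.info u M.θ₀) < c.eval (M.info u₀ M.θ₀))
    {θhat : ℕ → Ω → EuclideanSpace ℝ (Fin m)}
    (hest : ∀ᶠ N : ℕ in atTop, ∀ᵐ ω ∂μ, θhat N ω ∈ M.Θ ∧ ∀ θ ∈ M.Θ,
      ∑ k ∈ Finset.range N, M.φ (y k ω) (v k ω) θ ≤
        ∑ k ∈ Finset.range N, M.φ (y k ω) (v k ω) (θhat N ω))
    (hlead : ∀ N, ∀ᵐ ω ∂μ, c.eval (M.info u₀ (θhat N ω)) ≤ c.eval (M.info (v N ω) (θhat N ω)))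
    {ε : ℝ} (hε : 0 < ε) :
    Tendsto (fun k => μ {ω | ε ≤ dist (v k ω) u₀}) atTop (𝓝 0) := by
  obtain ⟨δ, hδ, hd⟩ := exists_dist_maximizer_lt M.isCompact M.mem_Θ
    (H := fun u θ => c.eval (M.info u θ)) (M.continuousOn_eval_info c) huniq hε
  refine tendsto_of_tendsto_of_tendsto_of_le_of_le' tendsto_const_nhds
    (h.tendsto_measure_le_norm_estimator_sub hest hδ) (Eventually.of_forall fun _ => zero_le) ?_
  filter_upwards [hest] with N hN
  refine measure_mono_ae ?_
  filter_upwards [hN, hlead N] with ω hω hl hfar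
  by_contra hcon
  refine absurd (hd _ hω.1 ?_ _ hl) (not_lt.2 hfar)
  rw [dist_eq_norm]
  exact not_le.1 hcon

end RegularModel

end Stackelberg

/-! ### Regularity of the density and the score of the game. -/

namespace Stackelberg

/-- Directional derivatives of a family of functions differentiable within a convex set depend
measurably on the index; the directions from a given point to an interior ball span. -/
lemma measurable_of_hasFDerivWithinAt {X : Type*} [MeasurableSpace X] {m : ℕ}
    {Θ : Set (EuclideanSpace ℝ (Fin m))} (hΘ : Convex ℝ Θ) {θ₀ θ : EuclideanSpace ℝ (Fin m)}
    {r : ℝ} (hr : 0 < r) (hball : Metric.ball θ₀ r ⊆ Θ) (hθ : θ ∈ Θ)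
    {g : X → EuclideanSpace ℝ (Fin m) → ℝ} {s : X → EuclideanSpace ℝ (Fin m)}
    (hg : ∀ θ ∈ Θ, Measurable fun x => g x θ)
    (hs : ∀ x, HasFDerivWithinAt (g x) (innerSL ℝ (s x)) Θ θ) : Measurable s := by
  have hdir : ∀ θ₁ ∈ Θ, Measurable fun x => inner ℝ (s x) (θ₁ - θ) := by
    intro θ₁ hθ₁
    have hmem : ∀ n : ℕ, θ + ((n : ℝ) + 1)⁻¹ • (θ₁ - θ) ∈ Θ := fun n => by
      refine hΘ.add_smul_sub_mem hθ hθ₁ ⟨by positivity, ?_⟩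
      exact inv_le_one_of_one_le₀ (by linarith [(n.cast_nonneg : (0 : ℝ) ≤ n)])
    -- Difference quotients along a segment inside the convex set `Θ` give the directional
    -- derivative as a limit of a sequence of measurable functions.
    refine measurable_of_tendsto_metrizable
      (f := fun (n : ℕ) x => ((n : ℝ) + 1) • (g x (θ + ((n : ℝ) + 1)⁻¹ • (θ₁ - θ)) - g x θ))
      (fun n => by have h1 := hg _ (hmem n); have h2 := hg _ hθ; fun_prop) (tendsto_pi_nhds.2 fun x => ?_)
    refine (hs x).lim ?_ (Eventually.of_forall hmem) ?_
    · have : Tendsto (fun n : ℕ => ((n : ℝ) + 1)⁻¹) atTop (𝓝 0) := by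
        simpa using tendsto_one_div_add_atTop_nhds_zero_nat (𝕜 := ℝ)
      simpa using this.smul_const (θ₁ - θ)
    · refine tendsto_const_nhds.congr fun n => ?_
      rw [smul_smul, mul_inv_cancel₀ (by positivity), one_smul]
  have hcoord : ∀ i, Measurable fun x => s x i := by
    intro i
    -- At a boundary point `θ` not every coordinate direction stays in `Θ`. A coordinate is
    -- recovered as the difference of the directions towards two points of the interior ball.
    have hmem : θ₀ + (r / 2) • EuclideanSpace.single i (1 : ℝ) ∈ Θ := hball (by
      rw [Metric.mem_ball, dist_eq_norm, add_sub_cancel_left, norm_smul, PiLp.norm_single,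
        Real.norm_of_nonneg (by positivity)]
      norm_num
      linarith)
    have heq : (fun x => s x i) = fun x => (r / 2)⁻¹ *
        (inner ℝ (s x) (θ₀ + (r / 2) • EuclideanSpace.single i (1 : ℝ) - θ) -
          inner ℝ (s x) (θ₀ - θ)) := by
      funext x
      rw [← inner_sub_right, sub_sub_sub_cancel_right, add_sub_cancel_left, real_inner_smul_right,
        EuclideanSpace.inner_single_right, ← mul_assoc, inv_mul_cancel₀ (by positivity)]
      simp
    rw [heq]
    exact ((hdir _ hmem).sub (hdir _ (hball (Metric.mem_ball_self hr)))).const_mul _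
  exact (PiLp.continuous_toLp 2 _).measurable.comp (measurable_pi_lambda _ hcoord)

namespace Game

variable {n h m : ℕ} {G : Game n h m}

lemma p_pos (hG : G.WellPosed) {uL : EuclideanSpace ℝ (Fin n)} (hu : uL ∈ G.UL)
    {θ : EuclideanSpace ℝ (Fin m)} (hθ : θ ∈ G.Θ) (uF : EuclideanSpace ℝ (Fin h)) :
    0 < G.p uF uL θ :=
  div_pos (Real.exp_pos _) (hG.Z_pos _ hu _ hθ)

lemma exp_Φ (hG : G.WellPosed) {uL : EuclideanSpace ℝ (Fin n)} (hu : uL ∈ G.UL)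
    {θ : EuclideanSpace ℝ (Fin m)} (hθ : θ ∈ G.Θ) (uF : EuclideanSpace ℝ (Fin h)) :
    Real.exp (G.Φ uF uL θ) = G.p uF uL θ :=
  Real.exp_log (p_pos hG hu hθ uF)

lemma measurable_p (hG : G.WellPosed) {uL : EuclideanSpace ℝ (Fin n)} (hu : uL ∈ G.UL)
    {θ : EuclideanSpace ℝ (Fin m)} (hθ : θ ∈ G.Θ) : Measurable fun uF => G.p uF uL θ :=
  ((hG.measurable_J uL hu θ hθ).const_mul _).exp.div_const _

lemma integral_p (hG : G.WellPosed) {uL : EuclideanSpace ℝ (Fin n)} (hu : uL ∈ G.UL)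
    {θ : EuclideanSpace ℝ (Fin m)} (hθ : θ ∈ G.Θ) : ∫ uF in G.UF, G.p uF uL θ = 1 := by
  simp only [p]
  rw [integral_div]
  exact div_self (hG.Z_pos _ hu _ hθ).ne'

lemma lintegral_p (hG : G.WellPosed) {uL : EuclideanSpace ℝ (Fin n)} (hu : uL ∈ G.UL)
    {θ : EuclideanSpace ℝ (Fin m)} (hθ : θ ∈ G.Θ) :
    ∫⁻ uF in G.UF, ENNReal.ofReal (G.p uF uL θ) = 1 := by
  rw [← ofReal_integral_eq_lintegral_ofReal, integral_p hG hu hθ, ENNReal.ofReal_one]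
  · exact (hG.integrableOn_exp uL hu θ hθ).div_const _
  · exact ae_of_all _ fun uF => (p_pos hG hu hθ uF).le

lemma uniqueDiffOn {θ₀ : EuclideanSpace ℝ (Fin m)} (hparam : G.ParamAssumption θ₀) :
    UniqueDiffOn ℝ G.Θ :=
  uniqueDiffOn_convex hparam.convex ⟨θ₀, hparam.mem_interior⟩

lemma contDiffOn_Φ (hG : G.WellPosed) (hsmooth : G.SmoothAssumption)
    {uF : EuclideanSpace ℝ (Fin h)} (huF : uF ∈ G.UF) {uL : EuclideanSpace ℝ (Fin n)}
    (hu : uL ∈ G.UL) : ContDiffOn ℝ 2 (fun θ => G.Φ uF uL θ) G.Θ :=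
  (hsmooth.contDiffOn_two uF huF uL hu).log fun _ hθ => (p_pos hG hu hθ uF).ne'

lemma hasFDerivWithinAt_Φ (hG : G.WellPosed) (hsmooth : G.SmoothAssumption)
    {uF : EuclideanSpace ℝ (Fin h)} (huF : uF ∈ G.UF) {uL : EuclideanSpace ℝ (Fin n)}
    (hu : uL ∈ G.UL) {θ : EuclideanSpace ℝ (Fin m)} (hθ : θ ∈ G.Θ) :
    HasFDerivWithinAt (fun θ => G.Φ uF uL θ) (innerSL ℝ (G.score uF uL θ)) G.Θ θ :=
  ((contDiffOn_Φ hG hsmooth huF hu).differentiableOn (by norm_num) θ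
    hθ).hasGradientWithinAt.hasFDerivWithinAt

lemma score_eq {θ₀ : EuclideanSpace ℝ (Fin m)} (hG : G.WellPosed) (hparam : G.ParamAssumption θ₀)
    (hsmooth : G.SmoothAssumption)
    {uF : EuclideanSpace ℝ (Fin h)} (huF : uF ∈ G.UF) {uL : EuclideanSpace ℝ (Fin n)}
    (hu : uL ∈ G.UL) {θ : EuclideanSpace ℝ (Fin m)} (hθ : θ ∈ G.Θ) :
    G.score uF uL θ = (G.p uF uL θ)⁻¹ • gradOn G.Θ (fun θ' => G.p uF uL θ') θ := by
  have hd : DifferentiableWithinAt ℝ (fun θ' => G.p uF uL θ') G.Θ θ :=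
    (hsmooth.contDiffOn_two uF huF uL hu).differentiableOn (by norm_num) θ hθ
  have hlog := fderivWithin.log hd (p_pos hG hu hθ uF).ne' (uniqueDiffOn hparam θ hθ)
  rw [score, gradOn, gradOn, gradientWithin, gradientWithin]
  change (InnerProductSpace.toDual ℝ _).symm
    (fderivWithin ℝ (fun θ' => Real.log (G.p uF uL θ')) G.Θ θ) = _
  rw [hlog, map_smul]

lemma continuousOn_p (hsmooth : G.SmoothAssumption) {uF : EuclideanSpace ℝ (Fin h)}
    (huF : uF ∈ G.UF) : ContinuousOn (fun z : EuclideanSpace ℝ (Fin n) × EuclideanSpace ℝ (Fin m) =>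
      G.p uF z.1 z.2) (G.UL ×ˢ G.Θ) :=
  (hsmooth.contDiffOn_one uF huF).continuousOn

lemma continuousOn_Φ (hG : G.WellPosed) (hsmooth : G.SmoothAssumption)
    {uF : EuclideanSpace ℝ (Fin h)} (huF : uF ∈ G.UF) :
    ContinuousOn (fun z : EuclideanSpace ℝ (Fin n) × EuclideanSpace ℝ (Fin m) =>
      G.Φ uF z.1 z.2) (G.UL ×ˢ G.Θ) :=
  (continuousOn_p hsmooth huF).log fun _ hz => (p_pos hG hz.1 hz.2 uF).ne'

lemma continuousOn_fderivWithin_p {θ₀ : EuclideanSpace ℝ (Fin m)} (hparam : G.ParamAssumption θ₀)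
    (hsmooth : G.SmoothAssumption) {uF : EuclideanSpace ℝ (Fin h)} (huF : uF ∈ G.UF) :
    ContinuousOn (fun z : EuclideanSpace ℝ (Fin n) × EuclideanSpace ℝ (Fin m) =>
      fderivWithin ℝ (fun θ => G.p uF z.1 θ) G.Θ z.2) (G.UL ×ˢ G.Θ) := by
  intro z hz
  have h1 := hsmooth.contDiffOn_one uF huF z hz
  -- Derivatives within `UL` need not be unique, so a continuous choice `f'` of joint derivatives is
  -- taken from the definition of `C¹`. Its restriction to the parameter directions is unique and
  -- equals the derivative within `Θ`.
  rw [show (1 : WithTop ℕ∞) = 0 + 1 by norm_num,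
    contDiffWithinAt_succ_iff_hasFDerivWithinAt' (by norm_num)] at h1
  obtain ⟨w, hw, hwsub, -, f', hf', hc⟩ := h1
  rw [Set.insert_eq_of_mem hz] at hw hwsub
  have heq : ∀ z' ∈ w, fderivWithin ℝ (fun θ => G.p uF z'.1 θ) G.Θ z'.2 =
      (f' z').comp (ContinuousLinearMap.inr ℝ _ _) := by
    intro z' hz'
    have hmem := hwsub hz'
    refine HasFDerivWithinAt.fderivWithin ?_ (uniqueDiffOn hparam _ hmem.2)
    have hin : HasFDerivWithinAt (fun θ : EuclideanSpace ℝ (Fin m) => (z'.1, θ))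
        (ContinuousLinearMap.inr ℝ (EuclideanSpace ℝ (Fin n)) _) G.Θ z'.2 :=
      (hasFDerivAt_prodMk_right _ _).hasFDerivWithinAt
    have hmaps : Set.MapsTo (fun θ : EuclideanSpace ℝ (Fin m) => (z'.1, θ)) G.Θ (G.UL ×ˢ G.Θ) :=
      fun θ hθ => ⟨hmem.1, hθ⟩
    exact HasFDerivWithinAt.comp (g := fun z : EuclideanSpace ℝ (Fin n) ×
      EuclideanSpace ℝ (Fin m) => G.p uF z.1 z.2) z'.2 (hf' z' hz') hin hmaps
  have hcont : ContinuousWithinAt (fun z' => (f' z').comp (ContinuousLinearMap.inr ℝ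
      (EuclideanSpace ℝ (Fin n)) (EuclideanSpace ℝ (Fin m)))) (G.UL ×ˢ G.Θ) z :=
    hc.continuousWithinAt.clm_comp continuousWithinAt_const
  exact hcont.congr_of_eventuallyEq (eventually_of_mem hw heq)
    (heq z (mem_of_mem_nhdsWithin hz hw))

lemma continuousOn_score {θ₀ : EuclideanSpace ℝ (Fin m)} (hG : G.WellPosed)
    (hparam : G.ParamAssumption θ₀) (hsmooth : G.SmoothAssumption)
    {uF : EuclideanSpace ℝ (Fin h)} (huF : uF ∈ G.UF) :
    ContinuousOn (fun z : EuclideanSpace ℝ (Fin n) × EuclideanSpace ℝ (Fin m) =>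
      G.score uF z.1 z.2) (G.UL ×ˢ G.Θ) := by
  have h1 : ContinuousOn (fun z : EuclideanSpace ℝ (Fin n) × EuclideanSpace ℝ (Fin m) =>
      (G.p uF z.1 z.2)⁻¹ • gradOn G.Θ (fun θ' => G.p uF z.1 θ') z.2) (G.UL ×ˢ G.Θ) :=
    ((continuousOn_p hsmooth huF).inv₀ fun z hz => (p_pos hG hz.1 hz.2 uF).ne').smul
      ((InnerProductSpace.toDual ℝ _).symm.continuous.comp_continuousOn
        (continuousOn_fderivWithin_p hparam hsmooth huF))
  exact h1.congr fun z hz => score_eq hG hparam hsmooth huF hz.1 hz.2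

/-- The integrand is the gradient of the density, and the integral of the gradient is the gradient
of the constant total mass one. -/
lemma setIntegral_p_mul_score {θ₀ : EuclideanSpace ℝ (Fin m)} (hG : G.WellPosed)
    (hparam : G.ParamAssumption θ₀) (hsmooth : G.SmoothAssumption)
    (hinter : G.InterchangeAssumption) {uL : EuclideanSpace ℝ (Fin n)}
    (hu : uL ∈ G.UL) {θ : EuclideanSpace ℝ (Fin m)} (hθ : θ ∈ G.Θ) (i : Fin m) :
    ∫ uF in G.UF, G.p uF uL θ * G.score uF uL θ i = 0 := by
  have h1 : ∫ uF in G.UF, G.p uF uL θ * G.score uF uL θ i =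
      ∫ uF in G.UF, gradOn G.Θ (fun θ' => G.p uF uL θ') θ i := by
    refine setIntegral_congr_fun hG.measurableSet_UF fun uF huF => ?_
    simp only [score_eq hG hparam hsmooth huF hu hθ, PiLp.smul_apply, smul_eq_mul]
    rw [← mul_assoc, mul_inv_cancel₀ (p_pos hG hu hθ uF).ne', one_mul]
  have h2 : gradOn G.Θ (fun θ' => ∫ uF in G.UF, G.p uF uL θ') θ = 0 := by
    rw [gradOn, gradientWithin, fderivWithin_congr (f := fun _ => (1 : ℝ))
      (fun θ' hθ' => integral_p hG hu hθ') (integral_p hG hu hθ)]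
    simp
  have h3 := (EuclideanSpace.proj (𝕜 := ℝ) i : EuclideanSpace ℝ (Fin m) →L[ℝ] ℝ).integral_comp_comm
    (hinter.integrableOn_grad uL hu θ hθ)
  rw [h1]
  refine h3.trans ?_
  rw [← hinter.grad_integral uL hu θ hθ, h2, map_zero]

/-- The second derivative is controlled by the entries of the Hessian. -/
lemma norm_fderivWithin_fderivWithin_le {θ₀ : EuclideanSpace ℝ (Fin m)}
    (hparam : G.ParamAssumption θ₀) (uF : EuclideanSpace ℝ (Fin h)) (uL : EuclideanSpace ℝ (Fin n))
    {θ : EuclideanSpace ℝ (Fin m)} (hθ : θ ∈ G.Θ) :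
    ‖fderivWithin ℝ (fderivWithin ℝ (fun θ' => G.Φ uF uL θ') G.Θ) G.Θ θ‖ ≤
      ∑ i, ∑ j, |G.hessΦ uF uL θ i j| := by
  set D := fderivWithin ℝ (fderivWithin ℝ (fun θ' => G.Φ uF uL θ') G.Θ) G.Θ θ with hD
  have hent : ∀ i j, G.hessΦ uF uL θ i j =
      D (EuclideanSpace.single i (1 : ℝ)) (EuclideanSpace.single j (1 : ℝ)) := fun i j => by
    rw [hessΦ, hessOn, Matrix.of_apply, iteratedFDerivWithin_two_apply' _ (uniqueDiffOn hparam) hθ]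
  have hbasis : ∀ v : EuclideanSpace ℝ (Fin m), v = ∑ i, v i • EuclideanSpace.single i (1 : ℝ) :=
    fun v => by
      ext j
      simp [Finset.sum_apply, Pi.single_apply]
  refine ContinuousLinearMap.opNorm_le_bound₂ _ (by positivity) fun v w => ?_
  have hexp : D v w = ∑ i, ∑ j, v i * (w j * G.hessΦ uF uL θ i j) := by
    conv_lhs => rw [hbasis v, hbasis w]
    simp only [map_sum, map_smul, sum_apply, smul_apply,
      smul_eq_mul, ← hent, Finset.mul_sum]
    rw [Finset.sum_comm]
    exact Finset.sum_congr rfl fun i _ => Finset.sum_congr rfl fun j _ => by ring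
  rw [hexp]
  refine (norm_sum_le _ _).trans ?_
  rw [Finset.sum_mul, Finset.sum_mul]
  refine Finset.sum_le_sum fun i _ => (norm_sum_le _ _).trans ?_
  rw [Finset.sum_mul, Finset.sum_mul]
  refine Finset.sum_le_sum fun j _ => ?_
  rw [norm_mul, norm_mul, Real.norm_eq_abs (G.hessΦ uF uL θ i j)]
  have h1 := PiLp.norm_apply_le v i
  have h2 := PiLp.norm_apply_le w j
  calc ‖v i‖ * (‖w j‖ * |G.hessΦ uF uL θ i j|) ≤ ‖v‖ * (‖w‖ * |G.hessΦ uF uL θ i j|) := by gcongr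
    _ = _ := by ring

/-- The mean value inequality for the first derivative on the ball; the Riesz isometry identifies it
with the score. -/
lemma norm_score_sub_le {θ₀ : EuclideanSpace ℝ (Fin m)} (hG : G.WellPosed)
    (hparam : G.ParamAssumption θ₀) (hsmooth : G.SmoothAssumption)
    {uF : EuclideanSpace ℝ (Fin h)} (huF : uF ∈ G.UF) {uL : EuclideanSpace ℝ (Fin n)}
    (hu : uL ∈ G.UL) {r : ℝ} (hball : Metric.ball θ₀ r ⊆ G.Θ) {K : ℝ}
    (hK : ∀ θ ∈ Metric.ball θ₀ r, ∑ i, ∑ j, |G.hessΦ uF uL θ i j| ≤ K)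
    {θ θ' : EuclideanSpace ℝ (Fin m)} (hθ : θ ∈ Metric.ball θ₀ r) (hθ' : θ' ∈ Metric.ball θ₀ r) :
    ‖G.score uF uL θ - G.score uF uL θ'‖ ≤ K * ‖θ - θ'‖ := by
  have hd : DifferentiableOn ℝ (fderivWithin ℝ (fun θ' => G.Φ uF uL θ') G.Θ) G.Θ :=
    ((contDiffOn_Φ hG hsmooth huF hu).fderivWithin (m := 1) (uniqueDiffOn hparam)
      (by norm_num)).differentiableOn (by norm_num)
  have h1 := (convex_ball θ₀ r).norm_image_sub_le_of_norm_hasFDerivWithin_le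
    (f := fderivWithin ℝ (fun θ' => G.Φ uF uL θ') G.Θ) (C := K)
    (fun z hz => ((hd z (hball hz)).hasFDerivWithinAt).mono hball)
    (fun z hz => (norm_fderivWithin_fderivWithin_le hparam uF uL (hball hz)).trans (hK z hz))
    hθ' hθ
  refine le_of_eq_of_le ?_ h1
  rw [score, score, gradOn, gradOn, gradientWithin, gradientWithin, ← map_sub,
    LinearIsometryEquiv.norm_map]

end Game

end Stackelberg

/-! ### A global dominating function for the Hessian. -/

namespace Stackelberg

/-- Allows the supremum over `Θ` to be replaced by one over a countable dense set, so that the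
envelope of the score is measurable. Compactness makes that supremum finite. -/
lemma le_iSup_denseRange {E : Type*} [TopologicalSpace E] {Θ : Set E} (hΘ : IsCompact Θ)
    {D : ℕ → E} (hD : ∀ k, D k ∈ Θ) (hdense : Θ ⊆ closure (Set.range D)) {f : E → ℝ}
    (hf : ContinuousOn f Θ) {θ : E} (hθ : θ ∈ Θ) : f θ ≤ ⨆ k, f (D k) := by
  have hbdd : BddAbove (Set.range fun k => f (D k)) :=
    (hΘ.image_of_continuousOn hf).bddAbove.mono (by
      rintro _ ⟨k, rfl⟩
      exact ⟨D k, hD k, rfl⟩)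
  have : (𝓝[Set.range D] θ).NeBot := mem_closure_iff_nhdsWithin_neBot.1 (hdense hθ)
  refine le_of_tendsto ((hf θ hθ).mono_left (nhdsWithin_mono θ (Set.range_subset_iff.2 hD))) ?_
  filter_upwards [self_mem_nhdsWithin] with θ' hθ'
  obtain ⟨k, rfl⟩ := hθ'
  exact le_ciSup hbdd k

lemma lintegral_sum_rpow_le {X ι : Type*} [MeasurableSpace X] {μ : Measure X} (S : Finset ι)
    {f : ι → X → ℝ} (hf : ∀ i ∈ S, Measurable (f i)) {p : ℝ} (hp : 1 ≤ p) {C : ι → ℝ≥0}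
    (hC : ∀ i ∈ S, ∫⁻ x, ‖f i x‖ₑ ^ p ∂μ ≤ C i) :
    ∫⁻ x, ‖∑ i ∈ S, f i x‖ₑ ^ p ∂μ ≤ ((S.card : ℝ≥0) ^ (p - 1) * ∑ i ∈ S, C i : ℝ≥0) := by
  calc ∫⁻ x, ‖∑ i ∈ S, f i x‖ₑ ^ p ∂μ
      ≤ ∫⁻ x, (S.card : ℝ≥0∞) ^ (p - 1) * ∑ i ∈ S, ‖f i x‖ₑ ^ p ∂μ := by
        refine lintegral_mono fun x => ?_
        refine (ENNReal.rpow_le_rpow (enorm_sum_le _ _) (by linarith)).trans ?_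
        exact ENNReal.rpow_sum_le_const_mul_sum_rpow S (fun i => ‖f i x‖ₑ) hp
    _ = (S.card : ℝ≥0∞) ^ (p - 1) * ∑ i ∈ S, ∫⁻ x, ‖f i x‖ₑ ^ p ∂μ := by
        rw [lintegral_const_mul' _ _
          (ENNReal.rpow_ne_top_of_nonneg (by linarith) (ENNReal.natCast_ne_top _)),
          lintegral_finsetSum' _ fun i hi => ((hf i hi).enorm.pow_const _).aemeasurable]
    _ ≤ (S.card : ℝ≥0∞) ^ (p - 1) * ∑ i ∈ S, (C i : ℝ≥0∞) := by
        gcongr with i hi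
        exact hC i hi
    _ = _ := by
        rw [ENNReal.coe_mul, ENNReal.coe_rpow_of_nonneg _ (by linarith)]
        push_cast
        rfl

namespace Game

variable {n h m : ℕ} {G : Game n h m}

lemma isProbabilityMeasure_law (hG : G.WellPosed) {uL : EuclideanSpace ℝ (Fin n)} (hu : uL ∈ G.UL)
    {θ : EuclideanSpace ℝ (Fin m)} (hθ : θ ∈ G.Θ) : IsProbabilityMeasure (G.law uL θ) :=
  isProbabilityMeasure_densityLaw (lintegral_p hG hu hθ)

lemma ae_mem_UF (hG : G.WellPosed) (uL : EuclideanSpace ℝ (Fin n))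
    (θ : EuclideanSpace ℝ (Fin m)) : ∀ᵐ uF ∂(G.law uL θ), uF ∈ G.UF :=
  (withDensity_absolutelyContinuous _ _).ae_le (ae_restrict_mem hG.measurableSet_UF)

lemma lintegral_rpow_le_one_add {X : Type*} [MeasurableSpace X] {μ : Measure X}
    [IsProbabilityMeasure μ] (f : X → ℝ≥0∞) {p q : ℝ} (hp : 0 ≤ p) (hpq : p ≤ q) :
    ∫⁻ x, f x ^ p ∂μ ≤ 1 + ∫⁻ x, f x ^ q ∂μ := by
  calc ∫⁻ x, f x ^ p ∂μ ≤ ∫⁻ x, (1 + f x ^ q) ∂μ := by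
        refine lintegral_mono fun x => ?_
        rcases le_total (f x) 1 with h1 | h1
        · exact (ENNReal.rpow_le_one h1 hp).trans le_self_add
        · exact (ENNReal.rpow_le_rpow_of_exponent_le h1 hpq).trans le_add_self
    _ = _ := by rw [lintegral_add_left measurable_const, lintegral_const, measure_univ, mul_one]

/-- Near a given leader action, one function dominates all entries of the Hessian. -/
lemma exists_hess_dominated_near {θ₀ : EuclideanSpace ℝ (Fin m)} (hG : G.WellPosed)
    (hθ₀ : θ₀ ∈ G.Θ) (hbdd : G.BoundedAssumption θ₀) (t : G.UL) :
    ∃ e > (0 : ℝ), ∃ δ > (0 : ℝ), ∃ B : EuclideanSpace ℝ (Fin h) → ℝ, ∃ C : ℝ≥0,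
      Measurable B ∧ (∀ x, 0 ≤ B x) ∧
      (∀ x ∈ G.UF, ∀ u : G.UL, dist u t < e → ∀ θ ∈ G.Θ, ‖θ - θ₀‖ < e →
        ∑ i, ∑ j, |G.hessΦ x u θ i j| ≤ B x) ∧
      ∀ u : G.UL, dist u t < e → ∫⁻ x, ‖B x‖ₑ ^ (1 + δ) ∂(G.law u θ₀) ≤ C := by
  have hd := hbdd.hess_dominated t t.2
  choose ε hε δ hδ B hBm hB C hC using hd
  obtain ⟨e, he, hle⟩ := exists_pos_forall_le (f := fun p : Fin m × Fin m => ε p.1 p.2)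
    fun p => hε _ _
  obtain ⟨δ', hδ', hδle⟩ := exists_pos_forall_le (f := fun p : Fin m × Fin m => δ p.1 p.2)
    fun p => hδ _ _
  -- Halving the radius keeps the two squared distances together below `e ^ 2`. The exponent is
  -- lowered to one common to all entries, at the price of adding one to the moment bounds.
  refine ⟨e / 2, half_pos he, δ', hδ', fun x => ∑ p : Fin m × Fin m, |B p.1 p.2 x|,
    ((Finset.univ : Finset (Fin m × Fin m)).card : ℝ≥0) ^ (1 + δ' - 1) *
      ∑ p : Fin m × Fin m, (1 + C p.1 p.2), Finset.measurable_sum _ fun p _ => (hBm _ _).abs,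
    fun x => Finset.sum_nonneg fun p _ => abs_nonneg _, fun x hx u hu θ hθ hθe => ?_,
    fun u hu => ?_⟩
  · have hun : ‖(u : EuclideanSpace ℝ (Fin n)) - t‖ < e / 2 := by
      rwa [← dist_eq_norm]
    refine le_of_le_of_eq ?_ (Fintype.sum_prod_type fun p : Fin m × Fin m => |B p.1 p.2 x|).symm
    refine Finset.sum_le_sum fun i _ => Finset.sum_le_sum fun j _ => ?_
    refine le_trans ?_ (le_abs_self (B i j x))
    refine hB i j x hx u u.2 θ hθ ?_
    have h3 : e ≤ ε i j := hle (i, j)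
    have h4 : e ^ 2 ≤ ε i j ^ 2 := by gcongr
    have h5 : ‖θ - θ₀‖ ^ 2 ≤ (e / 2) ^ 2 := by gcongr
    have h6 : ‖(u : EuclideanSpace ℝ (Fin n)) - t‖ ^ 2 ≤ (e / 2) ^ 2 := by gcongr
    nlinarith [sq_nonneg e]
  · have := isProbabilityMeasure_law hG u.2 hθ₀
    have hterm : ∀ p ∈ (Finset.univ : Finset (Fin m × Fin m)),
        ∫⁻ x, ‖|B p.1 p.2 x|‖ₑ ^ (1 + δ') ∂(G.law u θ₀) ≤ (1 + C p.1 p.2 : ℝ≥0) := fun p _ => by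
      simp only [Real.enorm_abs]
      refine (lintegral_rpow_le_one_add _ (by linarith)
        (add_le_add_right (hδle p) 1)).trans ?_
      rw [ENNReal.coe_add, ENNReal.coe_one]
      refine add_le_add_right (hC p.1 p.2 u u.2 ?_) 1
      have hun : ‖(u : EuclideanSpace ℝ (Fin n)) - t‖ < e / 2 := by
        rwa [← dist_eq_norm]
      linarith [hle p]
    have key := lintegral_sum_rpow_le (μ := G.law u θ₀) Finset.univ
      (f := fun (p : Fin m × Fin m) x => |B p.1 p.2 x|) (fun p _ => (hBm _ _).abs)
      (by linarith : 1 ≤ 1 + δ') hterm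
    exact key

/-- Local dominating functions of the Hessian can be combined into one for all leader actions. -/
lemma exists_hess_dominated {θ₀ : EuclideanSpace ℝ (Fin m)} (hG : G.WellPosed)
    (hparam : G.ParamAssumption θ₀) (hbdd : G.BoundedAssumption θ₀) :
    ∃ r > (0 : ℝ), ∃ δ > (0 : ℝ), ∃ B : EuclideanSpace ℝ (Fin h) → G.UL → ℝ, ∃ C : ℝ≥0,
      Metric.ball θ₀ r ⊆ G.Θ ∧ Measurable (Function.uncurry B) ∧ (∀ x u, 0 ≤ B x u) ∧
      (∀ x ∈ G.UF, ∀ u : G.UL, ∀ θ ∈ Metric.ball θ₀ r, ∑ i, ∑ j, |G.hessΦ x u θ i j| ≤ B x u) ∧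
      ∀ u : G.UL, ∫⁻ x, ‖B x u‖ₑ ^ (1 + δ) ∂(G.law u θ₀) ≤ C := by
  have hθ₀ : θ₀ ∈ G.Θ := interior_subset hparam.mem_interior
  choose e he δ hδ B C hBm hB0 hB hC using exists_hess_dominated_near hG hθ₀ hbdd
  have : CompactSpace G.UL := isCompact_iff_compactSpace.1 hG.isCompact_UL
  obtain ⟨T, hT⟩ := isCompact_univ.elim_finite_subcover (fun u : G.UL => Metric.ball u (e u))
    (fun u => Metric.isOpen_ball) fun u _ => Set.mem_iUnion.2 ⟨u, Metric.mem_ball_self (he u)⟩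
  obtain ⟨δ', hδ', hδle⟩ := exists_pos_forall_le (f := fun t : T => δ t) fun t => hδ _
  obtain ⟨r₁, hr₁, hr₁le⟩ := exists_pos_forall_le (f := fun t : T => e t) fun t => he t
  obtain ⟨r₂, hr₂, hr₂ball⟩ := Metric.mem_nhds_iff.1 (mem_interior_iff_mem_nhds.1 hparam.mem_interior)
  have hball : Metric.ball θ₀ (min r₁ r₂) ⊆ G.Θ :=
    (Metric.ball_subset_ball (min_le_right _ _)).trans hr₂ball
  -- Each local dominating function is cut off to its own ball of actions, outside of which its
  -- moments are not controlled.
  set w : G.UL → EuclideanSpace ℝ (Fin h) → G.UL → ℝ := fun t x u =>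
    (Metric.ball t (e t)).indicator (fun _ => B t x) u with hw
  have hw0 : ∀ t x u, 0 ≤ w t x u := fun t x u => Set.indicator_nonneg (fun _ _ => hB0 _ _) _
  have hwm : ∀ t, Measurable (Function.uncurry (w t)) := fun t => by
    have : Function.uncurry (w t) = (Prod.snd ⁻¹' Metric.ball t (e t)).indicator
        fun z : EuclideanSpace ℝ (Fin h) × G.UL => B t z.1 := by
      funext z
      simp [hw, Function.uncurry, Set.indicator]
    rw [this]
    exact ((hBm _).comp measurable_fst).indicator
      (measurable_snd Metric.isOpen_ball.measurableSet)
  refine ⟨min r₁ r₂, lt_min hr₁ hr₂, δ', hδ', fun x u => ∑ t ∈ T, w t x u,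
    (T.card : ℝ≥0) ^ (1 + δ' - 1) * ∑ t ∈ T, (1 + C t), hball,
    Finset.measurable_sum _ fun t _ => hwm t, fun x u => Finset.sum_nonneg fun t _ => hw0 t x u,
    fun x hx u θ hθ => ?_, fun u => ?_⟩
  · obtain ⟨t, ht⟩ := Set.mem_iUnion.1 (hT (Set.mem_univ u))
    obtain ⟨htT, htu⟩ := Set.mem_iUnion.1 ht
    have hθn : ‖θ - θ₀‖ < e t := by
      rw [← dist_eq_norm]
      exact (Metric.mem_ball.1 hθ).trans_le ((min_le_left _ _).trans (hr₁le ⟨t, htT⟩))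
    have h1 : w t x u = B t x := Set.indicator_of_mem htu _
    refine (hB t x hx u htu θ (hball hθ) hθn).trans (h1.symm.le.trans ?_)
    exact Finset.single_le_sum (f := fun t => w t x u) (fun t _ => hw0 _ _ _) htT
  · have := isProbabilityMeasure_law hG u.2 hθ₀
    have hterm : ∀ t ∈ T, ∫⁻ x, ‖w t x u‖ₑ ^ (1 + δ') ∂(G.law u θ₀) ≤ (1 + C t : ℝ≥0) := by
      intro t ht
      by_cases hu : u ∈ Metric.ball t (e t)
      · simp only [hw, Set.indicator_of_mem hu]
        refine (lintegral_rpow_le_one_add _ (by linarith)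
          (add_le_add_right (hδle ⟨t, ht⟩) 1)).trans ?_
        rw [ENNReal.coe_add, ENNReal.coe_one]
        exact add_le_add_right (hC t u hu) 1
      · simp only [hw, Set.indicator_of_notMem hu, enorm_zero]
        rw [ENNReal.zero_rpow_of_pos (by linarith), lintegral_zero]
        exact zero_le
    have key := lintegral_sum_rpow_le (μ := G.law u θ₀) T (f := fun t x => w t x u)
      (fun t _ => (hwm t).of_uncurry_right)
      (by linarith : 1 ≤ 1 + δ') hterm
    exact key

end Game

end Stackelberg

/-! ### The game as a regular model. -/

namespace Stackelberg

namespace Game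

variable {n h m : ℕ} (G : Game n h m)

/-- The log-density, extended by zero outside the follower's action set. -/
noncomputable def extΦ (x : EuclideanSpace ℝ (Fin h)) (u : G.UL) (θ : EuclideanSpace ℝ (Fin m)) :
    ℝ :=
  G.UF.indicator (fun x => G.Φ x u θ) x

/-- The score, extended by zero outside the follower's action set. -/
noncomputable def extScore (x : EuclideanSpace ℝ (Fin h)) (u : G.UL)
    (θ : EuclideanSpace ℝ (Fin m)) : EuclideanSpace ℝ (Fin m) :=
  G.UF.indicator (fun x => G.score x u θ) x

variable {G}

lemma extΦ_of_mem {x : EuclideanSpace ℝ (Fin h)} (hx : x ∈ G.UF) (u : G.UL)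
    (θ : EuclideanSpace ℝ (Fin m)) : G.extΦ x u θ = G.Φ x u θ :=
  Set.indicator_of_mem hx _

lemma extΦ_of_notMem {x : EuclideanSpace ℝ (Fin h)} (hx : x ∉ G.UF) (u : G.UL)
    (θ : EuclideanSpace ℝ (Fin m)) : G.extΦ x u θ = 0 :=
  Set.indicator_of_notMem hx _

lemma extScore_of_mem {x : EuclideanSpace ℝ (Fin h)} (hx : x ∈ G.UF) (u : G.UL)
    (θ : EuclideanSpace ℝ (Fin m)) : G.extScore x u θ = G.score x u θ :=
  Set.indicator_of_mem hx _

lemma extScore_of_notMem {x : EuclideanSpace ℝ (Fin h)} (hx : x ∉ G.UF) (u : G.UL)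
    (θ : EuclideanSpace ℝ (Fin m)) : G.extScore x u θ = 0 :=
  Set.indicator_of_notMem hx _

/-- Extension by zero makes pointwise regularity hold at every `x`; the values outside `UF` are
invisible to the restricted measure. -/
lemma densityLaw_exp_extΦ (hG : G.WellPosed) (u : G.UL) {θ : EuclideanSpace ℝ (Fin m)}
    (hθ : θ ∈ G.Θ) :
    densityLaw (volume.restrict G.UF) (fun x => Real.exp (G.extΦ x u θ)) = G.law u θ := by
  refine withDensity_congr_ae ?_
  filter_upwards [ae_restrict_mem hG.measurableSet_UF] with x hx
  rw [extΦ_of_mem hx, exp_Φ hG u.2 hθ]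

lemma measurable_extΦ (hG : G.WellPosed) (u : G.UL) {θ : EuclideanSpace ℝ (Fin m)}
    (hθ : θ ∈ G.Θ) : Measurable fun x => G.extΦ x u θ :=
  (measurable_p hG u.2 hθ).log.indicator hG.measurableSet_UF

lemma hasFDerivWithinAt_extΦ (hG : G.WellPosed) (hsmooth : G.SmoothAssumption)
    (x : EuclideanSpace ℝ (Fin h)) (u : G.UL) {θ : EuclideanSpace ℝ (Fin m)} (hθ : θ ∈ G.Θ) :
    HasFDerivWithinAt (G.extΦ x u) (innerSL ℝ (G.extScore x u θ)) G.Θ θ := by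
  by_cases hx : x ∈ G.UF
  · rw [show G.extΦ x u = fun θ => G.Φ x u θ from funext fun θ => extΦ_of_mem hx u θ,
      extScore_of_mem hx]
    exact hasFDerivWithinAt_Φ hG hsmooth hx u.2 hθ
  · rw [show G.extΦ x u = fun _ => 0 from funext fun θ => extΦ_of_notMem hx u θ,
      extScore_of_notMem hx, map_zero]
    exact hasFDerivWithinAt_const _ _ _

lemma continuousOn_extΦ (hG : G.WellPosed) (hsmooth : G.SmoothAssumption)
    (x : EuclideanSpace ℝ (Fin h)) :
    ContinuousOn (fun z : G.UL × EuclideanSpace ℝ (Fin m) => G.extΦ x z.1 z.2)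
      (Set.univ ×ˢ G.Θ) := by
  by_cases hx : x ∈ G.UF
  · simp only [extΦ_of_mem hx]
    exact (continuousOn_Φ hG hsmooth hx).comp (f := fun z : G.UL × EuclideanSpace ℝ (Fin m) =>
      ((z.1 : EuclideanSpace ℝ (Fin n)), z.2)) (by fun_prop) fun z hz => ⟨z.1.2, hz.2⟩
  · simp only [extΦ_of_notMem hx]
    exact continuousOn_const

lemma continuousOn_extScore {θ₀ : EuclideanSpace ℝ (Fin m)} (hG : G.WellPosed)
    (hparam : G.ParamAssumption θ₀) (hsmooth : G.SmoothAssumption)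
    (x : EuclideanSpace ℝ (Fin h)) :
    ContinuousOn (fun z : G.UL × EuclideanSpace ℝ (Fin m) => G.extScore x z.1 z.2)
      (Set.univ ×ˢ G.Θ) := by
  by_cases hx : x ∈ G.UF
  · simp only [extScore_of_mem hx]
    exact (continuousOn_score hG hparam hsmooth hx).comp
      (f := fun z : G.UL × EuclideanSpace ℝ (Fin m) =>
      ((z.1 : EuclideanSpace ℝ (Fin n)), z.2)) (by fun_prop) fun z hz => ⟨z.1.2, hz.2⟩
  · simp only [extScore_of_notMem hx]
    exact continuousOn_const

lemma measurable_extScore {θ₀ : EuclideanSpace ℝ (Fin m)} (hG : G.WellPosed)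
    (hparam : G.ParamAssumption θ₀) (hsmooth : G.SmoothAssumption) (u : G.UL)
    {θ : EuclideanSpace ℝ (Fin m)} (hθ : θ ∈ G.Θ) : Measurable fun x => G.extScore x u θ := by
  obtain ⟨r, hr, hball⟩ := Metric.mem_nhds_iff.1 (mem_interior_iff_mem_nhds.1 hparam.mem_interior)
  exact measurable_of_hasFDerivWithinAt hparam.convex hr hball hθ (g := fun x => G.extΦ x u)
    (fun θ hθ => measurable_extΦ hG u hθ) fun x => hasFDerivWithinAt_extΦ hG hsmooth x u hθ

lemma measurable_uncurry_extScore {θ₀ : EuclideanSpace ℝ (Fin m)} (hG : G.WellPosed)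
    (hparam : G.ParamAssumption θ₀) (hsmooth : G.SmoothAssumption)
    {θ : EuclideanSpace ℝ (Fin m)} (hθ : θ ∈ G.Θ) :
    Measurable fun z : EuclideanSpace ℝ (Fin h) × G.UL => G.extScore z.1 z.2 θ := by
  have hc : ∀ x, Continuous fun u => G.extScore x u θ := fun x => by
    have h1 := continuousOn_extScore hG hparam hsmooth x
    exact h1.comp_continuous (f := fun u : G.UL => (u, θ)) (by fun_prop) fun u => ⟨trivial, hθ⟩
  have hm := measurable_uncurry_of_continuous_of_measurable (u := fun u x => G.extScore x u θ) hc
    fun u => measurable_extScore hG hparam hsmooth u hθ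
  exact hm.comp measurable_swap

lemma integral_extScore {θ₀ : EuclideanSpace ℝ (Fin m)} (hG : G.WellPosed)
    (hparam : G.ParamAssumption θ₀) (hsmooth : G.SmoothAssumption)
    (hinter : G.InterchangeAssumption) (u : G.UL) {θ : EuclideanSpace ℝ (Fin m)}
    (hθ : θ ∈ G.Θ) (i : Fin m) : ∫ x, G.extScore x u θ i ∂(G.law u θ) = 0 := by
  have h1 := integral_densityLaw (ν := volume.restrict G.UF) (measurable_p hG u.2 hθ)
    (fun x => (p_pos hG u.2 hθ x).le) fun x => G.extScore x u θ i
  refine h1.trans ?_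
  rw [← setIntegral_p_mul_score hG hparam hsmooth hinter u.2 hθ i]
  refine setIntegral_congr_fun hG.measurableSet_UF fun x hx => ?_
  simp only [extScore_of_mem hx]

/-- The supremum of the norm of the score over a sequence of parameters. -/
noncomputable def envelope (G : Game n h m) (D : ℕ → EuclideanSpace ℝ (Fin m))
    (x : EuclideanSpace ℝ (Fin h)) (u : G.UL) : ℝ :=
  ⨆ k, ‖G.extScore x u (D k)‖

/-- The squared norm is the sum of the squared coordinates, so only the `m` diagonal products of the
moment hypothesis enter. -/
lemma lintegral_envelope_sq_le {θ₀ : EuclideanSpace ℝ (Fin m)} (hG : G.WellPosed)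
    (hparam : G.ParamAssumption θ₀) (hsmooth : G.SmoothAssumption)
    {D : ℕ → EuclideanSpace ℝ (Fin m)} (hD : ∀ k, D k ∈ G.Θ) {C : ℝ≥0}
    (u : G.UL) {θ : EuclideanSpace ℝ (Fin m)} 
    (hC : ∀ i j : Fin m, ∫⁻ uF, ⨆ θ' ∈ G.Θ, ‖G.score uF u θ' i * G.score uF u θ' j‖ₑ
      ∂(G.law u θ) ≤ C) :
    ∫⁻ x, ‖G.envelope D x u‖ₑ ^ (2 : ℝ) ∂(G.law u θ) ≤ (m * C : ℝ≥0) := by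
  have hpt : ∀ x, ‖G.envelope D x u‖ₑ ^ (2 : ℝ) ≤
      ∑ i, ⨆ k, ‖G.extScore x u (D k) i * G.extScore x u (D k) i‖ₑ := by
    intro x
    set S := ∑ i, ⨆ k, ‖G.extScore x u (D k) i * G.extScore x u (D k) i‖ₑ
    -- If `S` is infinite the real supremum may be of an unbounded family, but then nothing has to
    -- be proved.
    rcases eq_or_ne S ⊤ with htop | htop
    · rw [htop]
      exact le_top
    have hle : ∀ k, ‖G.extScore x u (D k)‖ ≤ √S.toReal := fun k => by
      rw [EuclideanSpace.norm_eq]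
      refine Real.sqrt_le_sqrt ?_
      rw [← ENNReal.ofReal_le_iff_le_toReal htop,
        ENNReal.ofReal_sum_of_nonneg fun i _ => sq_nonneg _]
      refine Finset.sum_le_sum fun i _ => le_trans (le_of_eq ?_)
        (le_iSup (fun k => ‖G.extScore x u (D k) i * G.extScore x u (D k) i‖ₑ) k)
      rw [← ofReal_norm, norm_mul, sq]
    have h0 : 0 ≤ G.envelope D x u := Real.iSup_nonneg fun k => norm_nonneg _
    have h1 : G.envelope D x u ≤ √S.toReal := ciSup_le hle
    rw [← ofReal_norm, Real.norm_of_nonneg h0, ENNReal.ofReal_rpow_of_nonneg h0 (by norm_num),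
      ENNReal.ofReal_le_iff_le_toReal htop, Real.rpow_two]
    exact (Real.le_sqrt h0 ENNReal.toReal_nonneg).1 h1
  have hm : ∀ i k, Measurable fun x => ‖G.extScore x u (D k) i * G.extScore x u (D k) i‖ₑ := by
    intro i k
    have := (EuclideanSpace.proj (𝕜 := ℝ) i).continuous.measurable.comp
      (measurable_extScore hG hparam hsmooth u (hD k))
    exact (this.mul this).enorm
  refine (lintegral_mono hpt).trans ?_
  rw [lintegral_finsetSum _ fun i _ => Measurable.iSup (hm i)]
  calc _ ≤ ∑ _i : Fin m, (C : ℝ≥0∞) := by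
        refine Finset.sum_le_sum fun i _ => le_trans (lintegral_mono_ae ?_) (hC i i)
        filter_upwards [ae_mem_UF hG u θ] with x hx
        refine iSup_le fun k => ?_
        rw [extScore_of_mem hx]
        exact le_iSup₂ (f := fun θ' (_ : θ' ∈ G.Θ) => ‖G.score x u θ' i * G.score x u θ' i‖ₑ)
          (D k) (hD k)
    _ = _ := by simp

/-- The follower's response under the assumptions on the game is a regular statistical model. -/
theorem exists_regularModel {θ₀ : EuclideanSpace ℝ (Fin m)} (hG : G.WellPosed)
    (hparam : G.ParamAssumption θ₀) (hsmooth : G.SmoothAssumption)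
    (hinter : G.InterchangeAssumption) (hident : G.Identifiable θ₀)
    (hbdd : G.BoundedAssumption θ₀) :
    ∃ M : RegularModel (EuclideanSpace ℝ (Fin h)) G.UL m, M.ν = volume.restrict G.UF ∧
      M.Θ = G.Θ ∧ M.θ₀ = θ₀ ∧ M.φ = G.extΦ ∧ M.s = G.extScore := by
  have hθ₀ : θ₀ ∈ G.Θ := interior_subset hparam.mem_interior
  obtain ⟨r, hr, δ, hδ, B, C₁, hball, hBm, hB0, hB, hBC⟩ := exists_hess_dominated hG hparam hbdd
  obtain ⟨C₂, hC₂⟩ := hbdd.third_moment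
  obtain ⟨C₃, hC₃⟩ := hbdd.sup_score
  have : Nonempty G.Θ := ⟨⟨θ₀, hθ₀⟩⟩
  set D : ℕ → EuclideanSpace ℝ (Fin m) := fun k => TopologicalSpace.denseSeq G.Θ k
  have hD : ∀ k, D k ∈ G.Θ := fun k => (TopologicalSpace.denseSeq G.Θ k).2
  have hdense : G.Θ ⊆ closure (Set.range D) := fun θ hθ => by
    have h1 := TopologicalSpace.denseRange_denseSeq G.Θ ⟨θ, hθ⟩
    rw [closure_subtype] at h1
    rwa [← Set.range_comp] at h1
  have hsθ : ∀ x (u : G.UL), ContinuousOn (G.extScore x u) G.Θ := fun x u =>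
    (continuousOn_extScore hG hparam hsmooth x).comp
      (f := fun θ : EuclideanSpace ℝ (Fin m) => (u, θ)) (by fun_prop) fun θ hθ => ⟨trivial, hθ⟩
  refine ⟨{
    ν := volume.restrict G.UF
    Θ := G.Θ
    θ₀ := θ₀
    φ := G.extΦ
    s := G.extScore
    L := G.envelope D
    B := B
    r := r
    δ := δ
    C := C₁ + C₂ + m * C₃
    isCompact := hparam.isCompact
    convex := hparam.convex
    r_pos := hr
    δ_pos := hδ
    ball_subset := hball
    measurable_φ := fun u θ hθ => measurable_extΦ hG u hθ
    measurable_s := fun u θ hθ => measurable_extScore hG hparam hsmooth u hθ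
    measurable_uncurry_L :=
      Measurable.iSup fun k => (measurable_uncurry_extScore hG hparam hsmooth (hD k)).norm
    measurable_uncurry_B := hBm
    continuousOn_φ := continuousOn_extΦ hG hsmooth
    continuousOn_s := continuousOn_extScore hG hparam hsmooth
    hasFDerivWithinAt := fun x u θ hθ => hasFDerivWithinAt_extΦ hG hsmooth x u hθ
    lintegral_exp := fun u θ hθ => ?_
    integral_s := fun u θ hθ i => ?_
    third_moment := fun u θ hθ => ?_
    norm_s_le := fun x u θ hθ =>
      le_iSup_denseRange hparam.isCompact hD hdense (hsθ x u).norm hθ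
    second_moment := fun u θ hθ => ?_
    identifiable := fun θ hθ hne u hae => ?_
    lipschitz := fun x u θ hθ θ' hθ' => ?_
    moment_B := fun u => ?_ }, rfl, rfl, rfl, rfl, rfl⟩
  · rw [← lintegral_p hG u.2 hθ]
    refine setLIntegral_congr_fun hG.measurableSet_UF fun x hx => ?_
    simp only [extΦ_of_mem hx, exp_Φ hG u.2 hθ]
  · rw [densityLaw_exp_extΦ hG u hθ]
    exact integral_extScore hG hparam hsmooth hinter u hθ i
  · rw [densityLaw_exp_extΦ hG u hθ]
    have h1 : ∫⁻ x, ‖G.extScore x u θ‖ₑ ^ (3 : ℝ) ∂(G.law u θ) =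
        ∫⁻ x, ‖G.score x u θ‖ₑ ^ 3 ∂(G.law u θ) := by
      refine lintegral_congr_ae ?_
      filter_upwards [ae_mem_UF hG u θ] with x hx
      rw [extScore_of_mem hx, show (3 : ℝ) = (3 : ℕ) by norm_num, ENNReal.rpow_natCast]
    rw [h1]
    refine (hC₂ u u.2 θ hθ).trans (ENNReal.coe_le_coe.2 ?_)
    rw [add_assoc]
    exact le_add_left le_self_add
  · rw [densityLaw_exp_extΦ hG u hθ]
    exact (lintegral_envelope_sq_le hG hparam hsmooth hD u (hC₃ u u.2 θ hθ)).trans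
      (ENNReal.coe_le_coe.2 le_add_self)
  · refine (hident θ hθ).1 hne u u.2 ?_
    filter_upwards [hae, ae_restrict_mem hG.measurableSet_UF] with x hx hxF
    rw [extΦ_of_mem hxF, extΦ_of_mem hxF] at hx
    rw [← exp_Φ hG u.2 hθ, ← exp_Φ hG u.2 hθ₀, hx]
  · by_cases hx : x ∈ G.UF
    · rw [extScore_of_mem hx, extScore_of_mem hx]
      exact norm_score_sub_le hG hparam hsmooth hx u.2 hball (hB x hx u) hθ hθ'
    · rw [extScore_of_notMem hx, extScore_of_notMem hx, sub_zero, norm_zero]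
      exact mul_nonneg (hB0 x u) (norm_nonneg _)
  · rw [densityLaw_exp_extΦ hG u hθ₀]
    refine (hBC u).trans (ENNReal.coe_le_coe.2 ?_)
    rw [add_assoc]
    exact le_self_add

end Game

end Stackelberg

/-! ### Runs of the algorithm as sequential designs. -/

namespace Stackelberg

namespace Game

variable {n h m : ℕ} {G : Game n h m} {θ₀ : EuclideanSpace ℝ (Fin m)}
  {M : RegularModel (EuclideanSpace ℝ (Fin h)) G.UL m}

lemma regularModel_law_eq (hG : G.WellPosed) (hν : M.ν = volume.restrict G.UF)
    (hφ : M.φ = G.extΦ) (u : G.UL) {θ : EuclideanSpace ℝ (Fin m)} (hθ : θ ∈ G.Θ) :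
    M.law u θ = G.law u θ := by
  rw [RegularModel.law, hν, hφ, densityLaw_exp_extΦ hG u hθ]

lemma regularModel_info_eq (hG : G.WellPosed) (hν : M.ν = volume.restrict G.UF)
    (hφ : M.φ = G.extΦ) (hs : M.s = G.extScore) (u : G.UL) {θ : EuclideanSpace ℝ (Fin m)}
    (hθ : θ ∈ G.Θ) : M.info u θ = G.info u θ := by
  ext i j
  simp only [RegularModel.info, RegularModel.crossInfo, info, Matrix.of_apply,
    regularModel_law_eq hG hν hφ u hθ, hs]
  refine integral_congr_ae ?_
  filter_upwards [ae_mem_UF hG u θ] with x hx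
  rw [extScore_of_mem hx]

variable {Ω : Type*} {mΩ : MeasurableSpace Ω} {μ : Measure Ω} [IsProbabilityMeasure μ]
  {ℱ : Filtration ℕ mΩ} {c : Criterion}
  {uL : ℕ → Ω → EuclideanSpace ℝ (Fin n)} {uF : ℕ → Ω → EuclideanSpace ℝ (Fin h)}
  {θhat : ℕ → Ω → EuclideanSpace ℝ (Fin m)}

open Classical in
/-- The leader's actions as random elements of the action set. -/
noncomputable def design (u₀ : G.UL) (uL : ℕ → Ω → EuclideanSpace ℝ (Fin n)) (t : ℕ) (ω : Ω) :
    G.UL :=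
  if hu : uL t ω ∈ G.UL then ⟨uL t ω, hu⟩ else u₀

omit [IsProbabilityMeasure μ] in
lemma ae_design_eq (hrun : G.IsRun μ ℱ c θ₀ uL uF θhat) (u₀ : G.UL) (t : ℕ) :
    ∀ᵐ ω ∂μ, (design u₀ uL t ω : EuclideanSpace ℝ (Fin n)) = uL t ω := by
  filter_upwards [hrun.leader t] with ω hω
  rw [design, dif_pos hω.1]

omit [IsProbabilityMeasure μ] in
lemma measurable_design (hG : G.WellPosed) (hrun : G.IsRun μ ℱ c θ₀ uL uF θhat) (u₀ : G.UL)
    (t : ℕ) : Measurable[ℱ t] (design u₀ uL t) := by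
  classical
  refine (MeasurableEmbedding.subtype_coe
    hG.isCompact_UL.isClosed.measurableSet).measurable_comp_iff.1 ?_
  have heq : Subtype.val ∘ design u₀ uL t =
      (uL t ⁻¹' G.UL).piecewise (uL t) fun _ => (u₀ : EuclideanSpace ℝ (Fin n)) := by
    funext ω
    by_cases hu : uL t ω ∈ G.UL
    · simp [design, hu, Set.piecewise]
    · simp [design, hu, Set.piecewise]
  rw [heq]
  exact Measurable.piecewise (hrun.measurable_uL t hG.isCompact_UL.isClosed.measurableSet)
    (hrun.measurable_uL t) measurable_const

/-- The conditional law of the follower's action, integrated over an event `A` of the past. -/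
lemma isDesign (hG : G.WellPosed) (hθ₀ : θ₀ ∈ G.Θ) (hν : M.ν = volume.restrict G.UF)
    (hMθ₀ : M.θ₀ = θ₀) (hφ : M.φ = G.extΦ) (hrun : G.IsRun μ ℱ c θ₀ uL uF θhat) (u₀ : G.UL) :
    M.IsDesign μ ℱ (design u₀ uL) uF where
  measurable_v := measurable_design hG hrun u₀
  measurable_y := hrun.measurable_uF
  measure_inter t A hA S hS := by
    have hyS : MeasurableSet (uF t ⁻¹' S) := (hrun.measurable_uF t).mono (ℱ.le _) le_rfl hS
    have hAm : MeasurableSet A := ℱ.le t _ hA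
    have hind : Integrable ((uF t ⁻¹' S).indicator fun _ => (1 : ℝ)) μ :=
      (integrable_const _).indicator hyS
    have hae : μ⟦uF t ⁻¹' S | ℱ t⟧ =ᵐ[μ] fun ω => (M.law (design u₀ uL t ω) M.θ₀).real S := by
      filter_upwards [hrun.follower t S hS, ae_design_eq hrun u₀ t] with ω hω hd
      rw [hω, hMθ₀, regularModel_law_eq hG hν hφ _ hθ₀, hd]
    have h1 := setIntegral_condExp (ℱ.le t) hind hA
    rw [setIntegral_indicator hyS, setIntegral_const, smul_eq_mul, mul_one,
      setIntegral_congr_ae hAm (hae.mono fun ω hω _ => hω)] at h1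
    have hint : IntegrableOn (fun ω => (M.law (design u₀ uL t ω) M.θ₀).real S) A μ :=
      (integrable_condExp.congr hae).integrableOn
    rw [← ofReal_measureReal, ← h1,
      ofReal_integral_eq_lintegral_ofReal hint (ae_of_all _ fun _ => measureReal_nonneg)]
    exact lintegral_congr fun ω => ofReal_measureReal

-- The extended log-density agrees with `Φ` only on `UF`, so the likelihoods can be identified only
-- once the observations are known to lie there.
omit [IsProbabilityMeasure μ] in
lemma ae_uF_mem (hG : G.WellPosed) (hθ₀ : θ₀ ∈ G.Θ) (hν : M.ν = volume.restrict G.UF)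
    (hMθ₀ : M.θ₀ = θ₀) (hφ : M.φ = G.extΦ) {v : ℕ → Ω → G.UL} (h : M.IsDesign μ ℱ v uF) (t : ℕ) :
    ∀ᵐ ω ∂μ, uF t ω ∈ G.UF := by
  have h1 := h.measure_inter t Set.univ MeasurableSet.univ _ hG.measurableSet_UF.compl
  rw [Set.univ_inter] at h1
  change μ (uF t ⁻¹' G.UFᶜ) = 0
  rw [h1]
  refine (lintegral_congr fun ω => ?_).trans lintegral_zero
  rw [hMθ₀, regularModel_law_eq hG hν hφ _ hθ₀]
  exact ae_mem_UF hG _ _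

lemma ae_estimate (hG : G.WellPosed) (hθ₀ : θ₀ ∈ G.Θ) (hν : M.ν = volume.restrict G.UF)
    (hΘ : M.Θ = G.Θ) (hMθ₀ : M.θ₀ = θ₀) (hφ : M.φ = G.extΦ)
    (hrun : G.IsRun μ ℱ c θ₀ uL uF θhat) (u₀ : G.UL) {N : ℕ} (hN : 0 < N) :
    ∀ᵐ ω ∂μ, θhat N ω ∈ M.Θ ∧ ∀ θ ∈ M.Θ,
      ∑ k ∈ Finset.range N, M.φ (uF k ω) (design u₀ uL k ω) θ ≤
        ∑ k ∈ Finset.range N, M.φ (uF k ω) (design u₀ uL k ω) (θhat N ω) := by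
  -- Only the estimates after at least one round maximize a likelihood; `θhat 0` is the arbitrary
  -- initial one.
  obtain ⟨t, rfl⟩ := Nat.exists_eq_succ_of_ne_zero hN.ne'
  have hd := isDesign hG hθ₀ hν hMθ₀ hφ hrun u₀
  filter_upwards [hrun.estimate t, ae_all_iff.2 (ae_uF_mem hG hθ₀ hν hMθ₀ hφ hd),
    ae_all_iff.2 (ae_design_eq hrun u₀)] with ω hω hF hu
  rw [hΘ]
  refine ⟨hω.1, fun θ hθ => ?_⟩
  have hsum : ∀ θ', ∑ k ∈ Finset.range (t + 1), M.φ (uF k ω) (design u₀ uL k ω) θ' =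
      ∑ k ∈ Finset.range (t + 1), G.Φ (uF k ω) (uL k ω) θ' := fun θ' =>
    Finset.sum_congr rfl fun k _ => by rw [hφ, extΦ_of_mem (hF k), hu k]
  have h1 : G.logLik (fun k => uL k ω) (fun k => uF k ω) (t + 1) θ ≤
      G.logLik (fun k => uL k ω) (fun k => uF k ω) (t + 1) (θhat (t + 1) ω) := hω.2 hθ
  rw [logLik, logLik] at h1
  rw [Nat.succ_eq_add_one, hsum, hsum]
  exact le_of_mul_le_mul_left h1 (by positivity)

end Game

end Stackelberg

/-! ### Asymptotic normality of the active learning estimate. -/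

theorem mainTheorem1 {n h m : ℕ} (G : Stackelberg.Game n h m)
    (θ₀ : EuclideanSpace ℝ (Fin m)) (c : Stackelberg.Criterion)
    (hG : G.WellPosed)
    (hparam : G.ParamAssumption θ₀)
    (hsmooth : G.SmoothAssumption)
    (hinter : G.InterchangeAssumption)
    (hident : G.Identifiable θ₀)
    (hbdd : G.BoundedAssumption θ₀)
    (uLoo : EuclideanSpace ℝ (Fin n)) (huLoo : uLoo ∈ G.UL)
    (hmax : IsMaxOn (fun u => G.query c u θ₀) G.UL uLoo)
    (huniq : ∀ u ∈ G.UL, IsMaxOn (fun u' => G.query c u' θ₀) G.UL u → u = uLoo)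
    (hposDef : (G.info uLoo θ₀).PosDef)
    {Ω : Type*} {mΩ : MeasurableSpace Ω} (μ : Measure Ω) [IsProbabilityMeasure μ]
    (ℱ : Filtration ℕ mΩ)
    (uL : ℕ → Ω → EuclideanSpace ℝ (Fin n)) (uF : ℕ → Ω → EuclideanSpace ℝ (Fin h))
    (θhat : ℕ → Ω → EuclideanSpace ℝ (Fin m))
    (hrun : G.IsRun μ ℱ c θ₀ uL uF θhat) :
    TendstoInDistribution (fun (T : ℕ) ω => √(T : ℝ) • (θhat T ω - θ₀)) atTop id
      (fun _ => μ) (multivariateGaussian 0 (G.info uLoo θ₀)⁻¹) := by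
  have hθ₀ : θ₀ ∈ G.Θ := interior_subset hparam.mem_interior
  obtain ⟨M, hν, hΘ, hMθ₀, hφ, hs⟩ :=
    G.exists_regularModel hG hparam hsmooth hinter hident hbdd
  have hsfin : SFinite M.ν := by
    rw [hν]
    infer_instance
  have hcomp : CompactSpace G.UL := isCompact_iff_compactSpace.1 hG.isCompact_UL
  set u₀ : G.UL := ⟨uLoo, huLoo⟩
  have hinfo : ∀ (u : G.UL) {θ : EuclideanSpace ℝ (Fin m)}, θ ∈ G.Θ →
      M.info u θ = G.info u θ := fun u _ hθ =>
    Stackelberg.Game.regularModel_info_eq hG hν hφ hs u hθ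
  have hdesign := Stackelberg.Game.isDesign hG hθ₀ hν hMθ₀ hφ hrun u₀
  have hest : ∀ᶠ N : ℕ in atTop, ∀ᵐ ω ∂μ, θhat N ω ∈ M.Θ ∧ ∀ θ ∈ M.Θ,
      ∑ k ∈ Finset.range N, M.φ (uF k ω) (Stackelberg.Game.design u₀ uL k ω) θ ≤
        ∑ k ∈ Finset.range N, M.φ (uF k ω) (Stackelberg.Game.design u₀ uL k ω) (θhat N ω) := by
    filter_upwards [eventually_gt_atTop 0] with N hN
    exact Stackelberg.Game.ae_estimate hG hθ₀ hν hΘ hMθ₀ hφ hrun u₀ hN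
  have hmem : ∀ N, ∀ᵐ ω ∂μ, θhat N ω ∈ G.Θ := fun N => by
    cases N with
    | zero => exact hrun.initial_mem
    | succ t => exact (hrun.estimate t).mono fun ω hω => hω.1
  have hlead : ∀ N, ∀ᵐ ω ∂μ, c.eval (M.info u₀ (θhat N ω)) ≤
      c.eval (M.info (Stackelberg.Game.design u₀ uL N ω) (θhat N ω)) := fun N => by
    filter_upwards [hmem N, hrun.leader N, Stackelberg.Game.ae_design_eq hrun u₀ N]
      with ω hω hl hd
    rw [hinfo _ hω, hinfo _ hω, hd]
    exact hl.2 huLoo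
  -- Equality of the values would make `u` a second maximizer.
  have hlt : ∀ u : G.UL, u ≠ u₀ → c.eval (M.info u M.θ₀) < c.eval (M.info u₀ M.θ₀) := by
    intro u hu
    rw [hMθ₀, hinfo _ hθ₀, hinfo _ hθ₀]
    refine lt_of_le_of_ne (hmax u.2) fun heq => hu (Subtype.ext (huniq u u.2 fun u' hu' => ?_))
    exact (hmax hu').trans heq.symm.le
  -- Consistency requires nothing of the designs, so it may be used to prove their convergence
  -- without circularity.
  have hv : ∀ ε > 0, Tendsto (fun k => μ {ω | ε ≤
      dist (Stackelberg.Game.design u₀ uL k ω) u₀}) atTop (𝓝 0) := fun ε hε =>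
    hdesign.tendsto_measure_le_dist_design c hlt hest hlead hε
  have hI : M.info u₀ M.θ₀ = G.info uLoo θ₀ := by rw [hMθ₀, hinfo _ hθ₀]
  have key := hdesign.tendstoInDistribution_estimator hv (hI ▸ hposDef)
    (fun N => (hrun.measurable_θhat N).mono (ℱ.le N) le_rfl) hest
  simp only [hMθ₀] at key
  rw [← hinfo u₀ hθ₀]
  exact key
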